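/- **Model.** Let $\lambda,\lambda^+,\lambda^->0$, $0\le\Delta\tau<\Delta t$, let $\underline q<-1$, $\overline q>1$ be integers and $N\ge 0$ an integer; $t_i=i\Delta t$, $t_{i+}=t_i+\Delta\tau$. The mid-price moves by $\Delta p[a,b]=\sum_{\mathcal N(a)<j\le \mathcal N(b)}X_j$, where $\mathcal N$ is a Poisson process of rate $\lambda$ and the $X_j$ are i.i.d., $\pm1$ with probability $1/2$ each. Uninformed orders hitting the ask (resp. bid) side arrive by a Poisson process $\mathcal N^+$ of rate $\lambda^+$ (resp. $\mathcal N^-$ of rate $\lambda^-$). $\mathcal N,\mathcal N^+,\mathcal N^-,(X_j)$ are independent. Let $\overline{\mathbb Z}=\mathbb Z\cup\{\pm\infty\}$. *Orders.* An ask/bid order with relative price $x\in\overline{\mathbb Z}$ (with respect to time $t_0$) has limit price $p(t_0)\pm(0.5+x)$; $x=-\infty$ is a market order, $x=\infty$ means no order. If it is present at the exchange from time $a$, it is filled by time $b$ if $x<\pm\Delta p[t_0,a]$ (immediate execution), or if for some $u\in(a,b]$ either $x<\pm\Delta p[t_0,u]$ (the price crosses it), or $x=\pm\Delta p[t_0,u]$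 and $\mathcal N^\pm$ jumps at $u$. The value of an order with relative price $x$ sent at time $0$ and reaching the exchange at $t_1'$ is $$H^\pm(t_1',t_2',x)=E\big[(\max\{0.5+x\mp\Delta p[0,t_1'],-0.5\}\mp\Delta p[t_1',t_1'+t_2'])\,\mathbb 1\{\text{filled by } t_1'+t_2'\}\big].$$ Products $\pm\infty\cdot 0$ are $0$. *States and actions.* $S$ is the set of $s=(w,p,q,r^+,r^-)$ (wealth, mid-price, inventory, relative prices of the outstanding ask and bid orders) with $w\in\mathbb Q$, $p,q\in\mathbb Z$, $r^\pm\in\overline{\mathbb Z}$, $\underline q\le q\le\overline q$, $r^\pm\ge0$, $r^+=\infty$ if $q=\underline q$, and $r^-=\infty$ if $q=\overline q$. An action is a pair $(\delta^+,\delta^-)$ of elements of $\overline{\mathbb Z}^o=\overline{\mathbb Z}\cup\{o\}$: $\delta^\pm\in\overline{\mathbb Z}$ cancels the outstanding order on that side and sends an order with relative price $\delta^\pm$ (no order if $\delta^\pm=\infty$), and $o$ does nothing; an action taken at $t_i$ takes effect at $t_{i+}$. Let $\underline S\subset S$ be given by $q=\underline q$, or $\Delta\tau>0$, $q=\underline q+1$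 and $r^+<\infty$; and $\overline S\subset S$ by $q=\overline q$, or $\Delta\tau>0$, $q=\overline q-1$ and $r^-<\infty$. The admissible set $A_s$ is $\{\infty,o\}\times\overline{\mathbb Z}^o\cup\overline{\mathbb Z}^o\times\{-\infty\}$ for $s\in\underline S$, $\{-\infty\}\times\overline{\mathbb Z}^o\cup\overline{\mathbb Z}^o\times\{\infty,o\}$ for $s\in\overline S$, and $\overline{\mathbb Z}^o\times\overline{\mathbb Z}^o$ otherwise. *Dynamics.* For $i<N$, let $\mathbb 1_{fill_i^\pm}$ indicate that the order outstanding at $t_i$ is filled by $t_{i+}$, and $\mathbb 1_{fill_{i+}^\pm}$ that between $t_{i+}$ and $t_{i+1}$ the new order (if $\delta_i^\pm\in\overline{\mathbb Z}$), respectively the still unfilled outstanding order (if $\delta_i^\pm=o$), is filled. Then $$w_{i+1}=w_i+(p_i+0.5+r_i^+)\mathbb 1_{fill_i^+}-(p_i-0.5-r_i^-)\mathbb 1_{fill_i^-}+p_{fill^+_{i+}}\mathbb 1_{fill_{i+}^+}-p_{fill^-_{i+}}\mathbb 1_{fill_{i+}^-},$$ $p_{i+1}=p_i+\Delta p[t_i,t_{i+1}]$,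 $q_{i+1}=q_i-\mathbb 1_{fill_i^+}+\mathbb 1_{fill_i^-}-\mathbb 1_{fill_{i+}^+}+\mathbb 1_{fill_{i+}^-}$, where $p_{fill^\pm_{i+}}=p_i\pm\max\{0.5+\delta_i^\pm,-0.5\pm\Delta p[t_i,t_{i+}]\}$ if $\delta_i^\pm\in\overline{\mathbb Z}$ and $p_i\pm(0.5+r_i^\pm)$ if $\delta_i^\pm=o$. If an order is outstanding at $t_{i+1}$, then $r_{i+1}^\pm=\delta_i^\pm\mp\Delta p[t_i,t_{i+1}]$ (resp. $r_i^\pm\mp\Delta p[t_i,t_{i+1}]$ if $\delta_i^\pm=o$), and otherwise $r_{i+1}^\pm=\infty$. From $t_N$ to $t_{N+}$ only the outstanding orders matter: $w_{N+}=w_N+(p_N+0.5+r_N^+)\mathbb 1_{fill_N^+}-(p_N-0.5-r_N^-)\mathbb 1_{fill_N^-}$, $p_{N+}=p_N+\Delta p[t_N,t_{N+}]$, $q_{N+}=q_N-\mathbb 1_{fill_N^+}+\mathbb 1_{fill_N^-}$. The terminal wealth is $\mathcal W=w_{N+}+p_{N+}q_{N+}-0.5|q_{N+}|$. For $0\le i\le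 N$ let $v_i(s)=\sup_\pi E^\pi[\mathcal W\mid s_i=s]$ over all Markov policies $\pi=(f_0,\dots,f_N)$ with $f_j(s)\in A_s$ for all $j$ and all $s\in S$, and let $v_{N+}(s)=w+pq-0.5|q|$. Put $H^\pm_{act}(r,\delta)=H^\pm(0,\Delta\tau,r)+H^\pm(\Delta\tau,\Delta t-\Delta\tau,\delta)$ for $\delta\in\overline{\mathbb Z}$ and $H^\pm_{act}(r,o)=H^\pm(0,\Delta t,r)$. **Theorem.** All expectations below and in the definitions above exist and are finite, and so are the suprema. For every $s=(w,p,q,r^+,r^-)\in S$ we have $v_{N+}(s)=w+pq-0.5|q|$ and $$v_i(s)=w+pq+g_i(q,r^+,r^-),\qquad i=0,1,\dots,N,$$ where $$g_N(q,r^+,r^-)=H^+(0,\Delta\tau,r^+)+H^-(0,\Delta\tau,r^-)-0.5\,E\big[\,|q-\mathbb 1_{fill_0^+}+\mathbb 1_{fill_0^-}|\,\big|\,(r_0^+,r_0^-)=(r^+,r^-)\big],$$ and for $i=0,\dots,N-1$ $$g_i(q,r^+,r^-)=\max_{(\delta^+,\delta^-)\in A_s}G_i(q,r^+,r^-,\delta^+,\delta^-),$$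 the maximum being attained, with $$G_i(q,r^+,r^-,\delta^+,\delta^-)=E\big[g_{i+1}(q_1,r_1^+,r_1^-)\,\big|\,(q_0,r_0^+,r_0^-)=(q,r^+,r^-),(\delta_0^+,\delta_0^-)=(\delta^+,\delta^-)\big]+H^+_{act}(r^+,\delta^+)+H^-_{act}(r^-,\delta^-).$$ -/

import Mathlib

open MeasureTheory ProbabilityTheory
open scoped NNReal

noncomputable section

namespace MarketMaking

/-! ### The market primitives -/

/-- A (homogeneous) Poisson process of the given rate, as a counting process. -/
structure IsPoissonProcess {Ω : Type*} [MeasurableSpace Ω] (Y : ℝ≥0 → Ω → ℕ) (rate : ℝ≥0)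
    (P : Measure Ω) : Prop where
  measurable : ∀ t, Measurable (Y t)
  zero : ∀ ω, Y 0 ω = 0
  mono : ∀ ω, Monotone fun t => Y t ω
  rightCont : ∀ ω t, ContinuousWithinAt (fun u => Y u ω) (Set.Ici t) t
  indepIncrements : HasIndepIncrements Y P
  law : ∀ s t, s ≤ t → HasLaw (fun ω => Y t ω - Y s ω) (poissonMeasure (rate * (t - s))) P

/-- The two sides of the book. -/
inductive Side
  | ask
  | bid

/-- `+1` for the ask side and `-1` for the bid side. -/
def Side.sgn : Side → ℤ
  | .ask => 1
  | .bid => -1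

/-- The random input of the model: the counting process of the mid-price moves, the moves
themselves, and the counting processes of the uninformed market orders that hit the market
maker's order on the given side (buy orders hit the ask side, sell orders hit the bid side). -/
structure OrderFlow (Ω : Type*) where
  moves : ℝ≥0 → Ω → ℕ
  X : ℕ → Ω → ℤ
  flow : Side → ℝ≥0 → Ω → ℕ

/-- Deterministic data: intensities `lam`, `lamAsk`, `lamBid`, period length `dt`, latency `dtau`,
inventory bounds, and the index `N` of the last (unwinding) decision epoch. -/
structure Params where
  lam : ℝ≥0
  lamAsk : ℝ≥0
  lamBid : ℝ≥0
  dt : ℝ≥0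
  dtau : ℝ≥0
  qLow : ℤ
  qHigh : ℤ
  N : ℕ
  lam_pos : 0 < lam
  lamAsk_pos : 0 < lamAsk
  lamBid_pos : 0 < lamBid
  latency_lt : dtau < dt
  qLow_lt : qLow < -1
  qHigh_gt : 1 < qHigh

/-- The sigma-algebra generated by a process. -/
abbrev sigmaOf {Ω T E : Type*} [MeasurableSpace E] (Y : T → Ω → E) : MeasurableSpace Ω :=
  ⨆ t, MeasurableSpace.comap (Y t) inferInstance

/-- The probabilistic assumptions: three Poisson processes, i.i.d. symmetric `±1` price moves, and
mutual independence of these four objects. -/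
structure OrderFlow.IsMarket {Ω : Type*} [MeasurableSpace Ω] (F : OrderFlow Ω) (m : Params)
    (P : Measure Ω) : Prop where
  moves : IsPoissonProcess F.moves m.lam P
  askFlow : IsPoissonProcess (F.flow .ask) m.lamAsk P
  bidFlow : IsPoissonProcess (F.flow .bid) m.lamBid P
  X_measurable : ∀ j, Measurable (F.X j)
  X_up : ∀ j, P {ω | F.X j ω = 1} = 1 / 2
  X_down : ∀ j, P {ω | F.X j ω = -1} = 1 / 2
  X_indep : iIndepFun F.X P
  indep : iIndep ![sigmaOf F.moves, sigmaOf F.X, sigmaOf (F.flow .ask), sigmaOf (F.flow .bid)] P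

section Model

variable {Ω : Type*}

/-- The compound Poisson mid-price, relative to its value at time zero. -/
def OrderFlow.mid (F : OrderFlow Ω) (t : ℝ≥0) (ω : Ω) : ℤ :=
  ∑ j ∈ Finset.range (F.moves t ω), F.X j ω

/-- The change of the mid-price from time `a` to time `b`. -/
def OrderFlow.dp (F : OrderFlow Ω) (a b : ℝ≥0) (ω : Ω) : ℤ := F.mid b ω - F.mid a ω

/-- An uninformed market order for the given side arrives exactly at time `u`. -/
def OrderFlow.Arrival (F : OrderFlow Ω) (σ : Side) (u : ℝ≥0) (ω : Ω) : Prop :=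
  0 < u ∧ ∀ s < u, F.flow σ s ω < F.flow σ u ω

/-- An order of the market maker with price `p(t₀) + 0.5 + x` (ask) or `p(t₀) - 0.5 - x` (bid) that
arrives at the exchange, or already rests there, at time `a` is executed by time `b`. Either
it is marketable at time `a`, or at some later time `u` up to `b` the best opposite price crosses
its limit price, or an uninformed order arrives while its limit price is the best price of its side.
Here `x = ⊥` is a market order and `x = ⊤` stands for no order. (Windows are closed on the right, as
for increments of right-continuous processes; a fixed time carries a jump with probability zero, so
the other choice of end points changes only a null event.) -/
def OrderFlow.Filled (F : OrderFlow Ω) (σ : Side) (t₀ a b : ℝ≥0) (x : EInt) (ω : Ω) : Prop :=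
  x < ((σ.sgn * F.dp t₀ a ω : ℤ) : EInt) ∨
    ∃ u ∈ Set.Ioc a b, x < ((σ.sgn * F.dp t₀ u ω : ℤ) : EInt) ∨
      (F.Arrival σ u ω ∧ x = ((σ.sgn * F.dp t₀ u ω : ℤ) : EInt))

open Classical in
/-- The indicator of an event. -/
def ind (A : Prop) : ℤ := if A then 1 else 0

/-- `max (x + c) d` for an extended integer `x`, with value `d` at `x = -∞`. The value at `x = ∞`
is irrelevant: it is only multiplied by indicators that vanish, and `∞ * 0 = 0`. -/
def maxShift (x : EInt) (c d : ℚ) : ℚ :=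
  WithBotTop.rec (motive := fun _ => ℚ) d (fun n : ℤ => max ((n : ℚ) + c) d) 0 x

/-- The value of a finite relative price. The value at `±∞` is irrelevant, as above. -/
def finitePart (x : EInt) : ℚ :=
  WithBotTop.rec (motive := fun _ => ℚ) 0 (fun n : ℤ => (n : ℚ)) 0 x

/-! ### The value of an order -/

/-- The profit, relative to the mid-price at time `t₁ + t₂`, of an order with relative price `x`
sent at time `0` and reaching the exchange at time `t₁`. -/
def orderProfit (F : OrderFlow Ω) (σ : Side) (t₁ t₂ : ℝ≥0) (x : EInt) (ω : Ω) : ℝ :=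
  (((maxShift x (1 / 2 - σ.sgn * F.dp 0 t₁ ω) (-1 / 2) - σ.sgn * F.dp t₁ (t₁ + t₂) ω) *
    ind (F.Filled σ 0 t₁ (t₁ + t₂) x ω) : ℚ) : ℝ)

/-- The order value `H^±(t₁, t₂, x)`. -/
def H [MeasurableSpace Ω] (F : OrderFlow Ω) (P : Measure Ω) (σ : Side) (t₁ t₂ : ℝ≥0)
    (x : EInt) : ℝ :=
  ∫ ω, orderProfit F σ t₁ t₂ x ω ∂P

/-! ### States and actions -/

/-- A decision for one side. `replace δ` cancels the outstanding order and sends an order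
with relative price `δ` (`⊥`: a market order, `⊤`: no new order). `keep` does nothing. -/
inductive Decision
  | replace (δ : EInt)
  | keep

/-- Wealth, mid-price, inventory, and relative prices of the outstanding ask and bid orders
(`⊤`: no order). Wealth moves by multiples of half a tick. -/
structure State where
  w : ℚ
  p : ℤ
  q : ℤ
  rAsk : EInt
  rBid : EInt

/-- The constraints that the state space puts on inventory and outstanding orders. -/
def Params.Valid (m : Params) (q : ℤ) (rA rB : EInt) : Prop :=
  m.qLow ≤ q ∧ q ≤ m.qHigh ∧ 0 ≤ rA ∧ 0 ≤ rB ∧ (q = m.qLow → rA = ⊤) ∧ (q = m.qHigh → rB = ⊤)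

/-- The state space `S`. -/
def Params.S (m : Params) : Set State := {s | m.Valid s.q s.rAsk s.rBid}

/-- The inventory has reached the lower bound or may reach it through the outstanding order. -/
def Params.NearLow (m : Params) (q : ℤ) (rA : EInt) : Prop :=
  q = m.qLow ∨ (0 < m.dtau ∧ q = m.qLow + 1 ∧ rA < ⊤)

/-- The inventory has reached the upper bound or may reach it through the outstanding order. -/
def Params.NearHigh (m : Params) (q : ℤ) (rB : EInt) : Prop :=
  q = m.qHigh ∨ (0 < m.dtau ∧ q = m.qHigh - 1 ∧ rB < ⊤)

open Classical in
/-- The admissible actions `A_s`, as pairs (ask decision, bid decision). -/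
def Params.A (m : Params) (q : ℤ) (rA rB : EInt) : Set (Decision × Decision) :=
  if m.NearLow q rA then
    {a | a.1 = .replace ⊤ ∨ a.1 = .keep ∨ a.2 = .replace ⊥}
  else if m.NearHigh q rB then
    {a | a.1 = .replace ⊥ ∨ a.2 = .replace ⊤ ∨ a.2 = .keep}
  else Set.univ

/-! ### The dynamics -/

/-- The `i`-th decision epoch. -/
def Params.t (m : Params) (i : ℕ) : ℝ≥0 := i * m.dt

/-- The time at which the `i`-th action reaches the exchange. -/
def Params.tPlus (m : Params) (i : ℕ) : ℝ≥0 := m.t i + m.dtau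

/-- The order outstanding at epoch `i`, with relative price `r`, is filled before the `i`-th action
reaches the exchange. -/
def fillOut (m : Params) (F : OrderFlow Ω) (σ : Side) (i : ℕ) (r : EInt) (ω : Ω) : Prop :=
  F.Filled σ (m.t i) (m.t i) (m.tPlus i) r ω

/-- An order is filled between the time the `i`-th action reaches the exchange and epoch `i + 1`:
the new one after a replacement, and otherwise the outstanding one. -/
def fillLate (m : Params) (F : OrderFlow Ω) (σ : Side) (i : ℕ) (r : EInt) (a : Decision) (ω : Ω) :
    Prop :=
  match a with
  | .replace δ => F.Filled σ (m.t i) (m.tPlus i) (m.t (i + 1)) δ ω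
  | .keep => ¬ fillOut m F σ i r ω ∧ F.Filled σ (m.t i) (m.tPlus i) (m.t (i + 1)) r ω

/-- The execution price of the outstanding order. -/
def priceOut (σ : Side) (p : ℤ) (r : EInt) : ℚ := p + σ.sgn * (1 / 2 + finitePart r)

/-- The execution price of the order counted by `fillLate`. -/
def priceLate (m : Params) (F : OrderFlow Ω) (σ : Side) (i : ℕ) (p : ℤ) (r : EInt) (a : Decision)
    (ω : Ω) : ℚ :=
  match a with
  | .replace δ =>
      p + σ.sgn * maxShift δ (1 / 2) (-1 / 2 + σ.sgn * F.dp (m.t i) (m.tPlus i) ω)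
  | .keep => priceOut σ p r

/-- The next inventory. -/
def nextQ (m : Params) (F : OrderFlow Ω) (i : ℕ) (q : ℤ) (rA rB : EInt) (a : Decision × Decision)
    (ω : Ω) : ℤ :=
  q - ind (fillOut m F .ask i rA ω) + ind (fillOut m F .bid i rB ω)
    - ind (fillLate m F .ask i rA a.1 ω) + ind (fillLate m F .bid i rB a.2 ω)

open Classical in
/-- The relative price of the order outstanding at the next epoch. -/
def nextR (m : Params) (F : OrderFlow Ω) (σ : Side) (i : ℕ) (r : EInt) (a : Decision) (ω : Ω) :
    EInt :=
  match a with
  | .replace δ =>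
      if fillLate m F σ i r (.replace δ) ω then ⊤
      else δ + ((-(σ.sgn * F.dp (m.t i) (m.t (i + 1)) ω) : ℤ) : EInt)
  | .keep =>
      if fillOut m F σ i r ω ∨ fillLate m F σ i r .keep ω then ⊤
      else r + ((-(σ.sgn * F.dp (m.t i) (m.t (i + 1)) ω) : ℤ) : EInt)

/-- The transition from epoch `i` to epoch `i + 1` under the action `a`. -/
def nextState (m : Params) (F : OrderFlow Ω) (i : ℕ) (s : State) (a : Decision × Decision) (ω : Ω) :
    State where
  w := s.w + priceOut .ask s.p s.rAsk * ind (fillOut m F .ask i s.rAsk ω)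
    - priceOut .bid s.p s.rBid * ind (fillOut m F .bid i s.rBid ω)
    + priceLate m F .ask i s.p s.rAsk a.1 ω * ind (fillLate m F .ask i s.rAsk a.1 ω)
    - priceLate m F .bid i s.p s.rBid a.2 ω * ind (fillLate m F .bid i s.rBid a.2 ω)
  p := s.p + F.dp (m.t i) (m.t (i + 1)) ω
  q := nextQ m F i s.q s.rAsk s.rBid a ω
  rAsk := nextR m F .ask i s.rAsk a.1 ω
  rBid := nextR m F .bid i s.rBid a.2 ω

open Classical in
/-- The relative price, just before unwinding, of the order outstanding at epoch `N`. -/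
def finalR (m : Params) (F : OrderFlow Ω) (σ : Side) (r : EInt) (ω : Ω) : EInt :=
  if fillOut m F σ m.N r ω then ⊤
  else r + ((-(σ.sgn * F.dp (m.t m.N) (m.tPlus m.N) ω) : ℤ) : EInt)

/-- The transition from epoch `N` to the time just before the unwinding order reaches the
exchange. -/
def finalState (m : Params) (F : OrderFlow Ω) (s : State) (ω : Ω) : State where
  w := s.w + priceOut .ask s.p s.rAsk * ind (fillOut m F .ask m.N s.rAsk ω)
    - priceOut .bid s.p s.rBid * ind (fillOut m F .bid m.N s.rBid ω)
  p := s.p + F.dp (m.t m.N) (m.tPlus m.N) ω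
  q := s.q - ind (fillOut m F .ask m.N s.rAsk ω) + ind (fillOut m F .bid m.N s.rBid ω)
  rAsk := finalR m F .ask s.rAsk ω
  rBid := finalR m F .bid s.rBid ω

/-! ### The optimization problem -/

/-- Markov policies: a decision rule for each epoch. -/
abbrev Policy := ℕ → State → Decision × Decision

/-- The policy chooses admissible actions. -/
def Policy.Admissible (π : Policy) (m : Params) : Prop :=
  ∀ i ≤ m.N, ∀ s ∈ m.S, π i s ∈ m.A s.q s.rAsk s.rBid

/-- The state at epoch `i + k` of the system that is in state `s` at epoch `i` and is controlled by
the policy `π`. -/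
def run (m : Params) (F : OrderFlow Ω) (π : Policy) (i : ℕ) (s : State) (ω : Ω) : ℕ → State
  | 0 => s
  | k + 1 => nextState m F (i + k) (run m F π i s ω k) (π (i + k) (run m F π i s ω k)) ω

/-- The value function just before unwinding: wealth after unwinding by a market order. -/
def vFinal (s : State) : ℝ := (s.w : ℝ) + s.p * s.q - 1 / 2 * |(s.q : ℝ)|

/-- The terminal wealth when the system is in state `s` at epoch `i ≤ N` and follows `π`. -/
def terminalWealth (m : Params) (F : OrderFlow Ω) (π : Policy) (i : ℕ) (s : State) (ω : Ω) : ℝ :=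
  vFinal (finalState m F (run m F π i s ω (m.N - i)) ω)

/-- The expected terminal wealths that are achievable from state `s` at epoch `i`. -/
def valueSet [MeasurableSpace Ω] (m : Params) (F : OrderFlow Ω) (P : Measure Ω) (i : ℕ)
    (s : State) : Set ℝ :=
  {x | ∃ π : Policy, π.Admissible m ∧ x = ∫ ω, terminalWealth m F π i s ω ∂P}

/-- The value function `v_i`. -/
def v [MeasurableSpace Ω] (m : Params) (F : OrderFlow Ω) (P : Measure Ω) (i : ℕ) (s : State) : ℝ :=
  sSup (valueSet m F P i s)

/-! ### The reduced recursion -/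

/-- The value `H^±_act` of the outstanding and the new order in one period. -/
def Hact [MeasurableSpace Ω] (m : Params) (F : OrderFlow Ω) (P : Measure Ω) (σ : Side) (r : EInt)
    (a : Decision) : ℝ :=
  match a with
  | .replace δ => H F P σ 0 m.dtau r + H F P σ m.dtau (m.dt - m.dtau) δ
  | .keep => H F P σ 0 m.dt r

/-- The function `g_N`. -/
def gLast [MeasurableSpace Ω] (m : Params) (F : OrderFlow Ω) (P : Measure Ω) (q : ℤ)
    (rA rB : EInt) : ℝ :=
  H F P .ask 0 m.dtau rA + H F P .bid 0 m.dtau rB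
    - 1 / 2 * ∫ ω, |((q - ind (fillOut m F .ask 0 rA ω) + ind (fillOut m F .bid 0 rB ω) : ℤ) : ℝ)| ∂P

/-- Expected continuation value `h` at the end of the first period plus the one-period reward. -/
def oneStep [MeasurableSpace Ω] (m : Params) (F : OrderFlow Ω) (P : Measure Ω)
    (h : ℤ → EInt → EInt → ℝ) (q : ℤ) (rA rB : EInt) (a : Decision × Decision) : ℝ :=
  (∫ ω, h (nextQ m F 0 q rA rB a ω) (nextR m F .ask 0 rA a.1 ω) (nextR m F .bid 0 rB a.2 ω) ∂P)
    + Hact m F P .ask rA a.1 + Hact m F P .bid rB a.2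

/-- The extra value with `k` further decision epochs before the last one. -/
def gRem [MeasurableSpace Ω] (m : Params) (F : OrderFlow Ω) (P : Measure Ω) :
    ℕ → ℤ → EInt → EInt → ℝ
  | 0, q, rA, rB => gLast m F P q rA rB
  | k + 1, q, rA, rB => sSup (oneStep m F P (gRem m F P k) q rA rB '' m.A q rA rB)

/-- The functions `g_i`, `i ≤ N`. -/
def g [MeasurableSpace Ω] (m : Params) (F : OrderFlow Ω) (P : Measure Ω) (i : ℕ) (q : ℤ)
    (rA rB : EInt) : ℝ :=
  gRem m F P (m.N - i) q rA rB

/-- The functions `G_i`, `i < N`. -/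
def G [MeasurableSpace Ω] (m : Params) (F : OrderFlow Ω) (P : Measure Ω) (i : ℕ) (q : ℤ)
    (rA rB : EInt) (a : Decision × Decision) : ℝ :=
  oneStep m F P (g m F P (i + 1)) q rA rB a

end Model

end MarketMaking

end

noncomputable section

namespace MarketMaking

open Filter Topology

/-! ### Extended integers -/

-- All holdings are marked to the mid-price. Over one period w + pq changes by q times the price
-- move plus, for each side of the book, the cash flow of that side marked to the mid-price at the
-- end (`cashflow_eq`, `wealth_next`). The price is a martingale (`integral_dp`), so the first term
-- has mean zero. The marked cash flow has mean `Hact`: when an order is replaced, the old one is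
-- valued at the mid-price at `dtau`, and moving the mark to the end of the period adds nothing on
-- average, because the later price move is independent of the earlier fill
-- (`integral_dp_mul_fillOut`). Fills depend on relative prices only. Hence one step of dynamic
-- programming maps a function w + pq + h(q, r⁺, r⁻) to one of the same form (`integral_nextState`).
--
-- The expectations are computed with the Markov property: the order flow after a fixed time T is
-- independent of the flow until T and has the law of the original flow (`indepFun_path`,
-- `map_path_shift`). The state at an epoch is a function of the past flow, and the state space is
-- countable, so the state can be frozen by Fubini (`integral_freeze`) and policies need no
-- measurability. A fill refers to uncountably many times; right-continuity reduces it to countably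
-- many (`filled_iff_grid`).
--
-- There are infinitely many actions, so attainment of the maximum needs compactness of the extended
-- integers. Along convergent orders, fills and profits are eventually constant on each path, and
-- all profits are dominated by the total price variation, uniformly in the orders. The reduced
-- value is only upper semicontinuous in the outstanding orders, since an order that recedes to
-- infinity may lift a constraint in the limit. This suffices for a maximum, and it is inherited
-- through the backward recursion (`eventually_oneStep_lt`, `upperSemicontinuousOnValid_sSup`).
--
-- The conclusion is a verification argument: the expected marked value does not increase along a
-- run under any admissible policy (`integral_run_le`) and is constant under a maximizing one
-- (`integral_run_eq`). The inventory bounds hold on every path (`valid_next`), so the extra value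
-- stays bounded; wealth and price grow at most geometrically relative to the price variation
-- (`size_run_le`), which gives integrability.

theorem coe_add_coe (a b : ℤ) : (a : EInt) + (b : EInt) = ((a + b : ℤ) : EInt) := rfl

theorem top_add_coe (b : ℤ) : (⊤ : EInt) + (b : EInt) = ⊤ := rfl

theorem zero_eq_coe : (0 : EInt) = ((0 : ℤ) : EInt) := rfl

theorem coe_lt_top (a : ℤ) : (a : EInt) < ⊤ := by
  rw [lt_top_iff_ne_top]; exact WithBotTop.coe_ne_top a

theorem bot_lt_coe (a : ℤ) : (⊥ : EInt) < a := by
  rw [bot_lt_iff_ne_bot]; exact WithBotTop.coe_ne_bot a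

theorem eInt_cases (x : EInt) : x = ⊥ ∨ (∃ n : ℤ, x = n) ∨ x = ⊤ := by
  induction x using WithBotTop.rec with
  | bot => exact Or.inl rfl
  | coe n => exact Or.inr (Or.inl ⟨n, rfl⟩)
  | top => exact Or.inr (Or.inr rfl)

theorem eInt_nonneg_cases {x : EInt} (hx : 0 ≤ x) : (∃ n : ℤ, 0 ≤ n ∧ x = n) ∨ x = ⊤ := by
  rcases eInt_cases x with rfl | ⟨n, rfl⟩ | rfl
  · exact absurd hx (not_le.2 (bot_lt_coe 0))
  · exact Or.inl ⟨n, WithBotTop.coe_le_coe.1 hx, rfl⟩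
  · exact Or.inr rfl

theorem ind_of_true {A : Prop} (h : A) : ind A = 1 := if_pos h

theorem ind_of_false {A : Prop} (h : ¬ A) : ind A = 0 := if_neg h

theorem ind_nonneg (A : Prop) : 0 ≤ ind A := by
  unfold ind; split_ifs <;> simp

theorem ind_le_one (A : Prop) : ind A ≤ 1 := by
  unfold ind; split_ifs <;> simp

@[simp] theorem maxShift_bot (c d : ℚ) : maxShift ⊥ c d = d := rfl

@[simp] theorem maxShift_coe (n : ℤ) (c d : ℚ) : maxShift n c d = max ((n : ℚ) + c) d := rfl

@[simp] theorem finitePart_coe (n : ℤ) : finitePart n = n := rfl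

theorem Side.sgn_mul_self (σ : Side) : σ.sgn * σ.sgn = 1 := by cases σ <;> rfl

theorem Side.abs_sgn_mul (σ : Side) (z : ℤ) : |σ.sgn * z| = |z| := by
  cases σ <;> simp [Side.sgn]

section Deterministic

variable {Ω : Type*} (F : OrderFlow Ω) (m : Params)

/-! ### Deterministic facts about executions -/

theorem not_filled_top (σ : Side) (t₀ a b : ℝ≥0) (ω : Ω) : ¬ F.Filled σ t₀ a b ⊤ ω := by
  rintro (h | ⟨u, -, h | ⟨-, h⟩⟩)
  · exact not_top_lt h
  · exact not_top_lt h
  · exact WithBotTop.coe_ne_top _ h.symm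

theorem filled_bot (σ : Side) (t₀ a b : ℝ≥0) (ω : Ω) : F.Filled σ t₀ a b ⊥ ω :=
  Or.inl (bot_lt_coe _)

theorem dp_self (a : ℝ≥0) (ω : Ω) : F.dp a a ω = 0 := sub_self _

theorem dp_add_dp (a b c : ℝ≥0) (ω : Ω) : F.dp a b ω + F.dp b c ω = F.dp a c ω := by
  simp [OrderFlow.dp]

theorem not_filled_self {r : EInt} (hr : 0 ≤ r) (σ : Side) (t₀ : ℝ≥0) (ω : Ω) :
    ¬ F.Filled σ t₀ t₀ t₀ r ω := by
  rintro (h | ⟨u, hu, -⟩)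
  · rw [dp_self, mul_zero] at h
    exact not_lt.2 hr h
  · simp at hu

theorem le_of_not_filled {σ : Side} {t₀ a b u : ℝ≥0} {r : EInt} {ω : Ω}
    (h : ¬ F.Filled σ t₀ a b r ω) (hu : u ∈ Set.Ioc a b) :
    ((σ.sgn * F.dp t₀ u ω : ℤ) : EInt) ≤ r :=
  not_lt.1 fun hlt => h (Or.inr ⟨u, hu, Or.inl hlt⟩)

/-- An order resting from time `t₀` on is filled by time `c` in one of two consecutive windows. -/
theorem filled_split {r : EInt} (hr : 0 ≤ r) (σ : Side) {t₀ b c : ℝ≥0} (hb : t₀ ≤ b) (hc : b ≤ c)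
    (ω : Ω) : F.Filled σ t₀ t₀ c r ω ↔ F.Filled σ t₀ t₀ b r ω ∨ F.Filled σ t₀ b c r ω := by
  have h0 : ¬ r < ((σ.sgn * F.dp t₀ t₀ ω : ℤ) : EInt) := by
    rw [dp_self, mul_zero]; exact not_lt.2 hr
  constructor
  · rintro (h | ⟨u, hu, h⟩)
    · exact absurd h h0
    · rcases le_or_gt u b with hub | hub
      · exact Or.inl (Or.inr ⟨u, ⟨hu.1, hub⟩, h⟩)
      · exact Or.inr (Or.inr ⟨u, ⟨hub, hu.2⟩, h⟩)
  · rintro ((h | ⟨u, hu, h⟩) | (h | ⟨u, hu, h⟩))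
    · exact absurd h h0
    · exact Or.inr ⟨u, ⟨hu.1, hu.2.trans hc⟩, h⟩
    -- Being marketable at `b` is a crossing at time `b`, which lies in the whole window unless `b =
    -- t₀`.
    · rcases hb.eq_or_lt with rfl | hlt
      · exact absurd h h0
      · exact Or.inr ⟨b, ⟨hlt, hc⟩, Or.inl h⟩
    · exact Or.inr ⟨u, ⟨hb.trans_lt hu.1, hu.2⟩, h⟩

theorem Params.t_zero : m.t 0 = 0 := by simp [Params.t]

theorem Params.t_one : m.t 1 = m.dt := by simp [Params.t]

theorem Params.tPlus_zero : m.tPlus 0 = m.dtau := by simp [Params.tPlus, Params.t]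

theorem Params.t_succ (i : ℕ) : m.t (i + 1) = m.t i + m.dt := by
  simp [Params.t, add_mul]

theorem Params.t_le_tPlus (i : ℕ) : m.t i ≤ m.tPlus i := le_self_add

theorem Params.tPlus_lt (i : ℕ) : m.tPlus i < m.t (i + 1) := by
  rw [m.t_succ]; exact add_lt_add_right m.latency_lt _

theorem Params.t_mono : Monotone m.t := fun i j h => by
  unfold Params.t; gcongr

/-- The facts about one side of the book that preserve the constraints on the state. -/
theorem side_facts (σ : Side) (i : ℕ) {r : EInt} (hr : 0 ≤ r) (a : Decision) (ω : Ω) :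
    0 ≤ nextR m F σ i r a ω ∧
    ((r = ⊤ ∨ m.dtau = 0) → ¬ fillOut m F σ i r ω) ∧
    (fillLate m F σ i r a ω → nextR m F σ i r a ω = ⊤) ∧
    (a = .keep → fillOut m F σ i r ω →
      ¬ fillLate m F σ i r a ω ∧ nextR m F σ i r a ω = ⊤) ∧
    (a = .replace ⊤ ∨ (a = .keep ∧ r = ⊤) →
      ¬ fillLate m F σ i r a ω ∧ nextR m F σ i r a ω = ⊤) ∧
    (a = .replace ⊥ → fillLate m F σ i r a ω) := by
  -- The late window is nonempty because the latency is shorter than the period. So an order still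
  -- unfilled has not been crossed at the end of the period, which makes its new relative price
  -- nonnegative.
  have hend : m.t (i + 1) ∈ Set.Ioc (m.tPlus i) (m.t (i + 1)) := ⟨m.tPlus_lt i, le_rfl⟩
  have key : ∀ x : EInt, ((σ.sgn * F.dp (m.t i) (m.t (i + 1)) ω : ℤ) : EInt) ≤ x →
      0 ≤ x + ((-(σ.sgn * F.dp (m.t i) (m.t (i + 1)) ω) : ℤ) : EInt) := by
    intro x hx
    rcases eInt_cases x with rfl | ⟨n, rfl⟩ | rfl
    · exact absurd hx (not_le.2 (bot_lt_coe _))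
    · rw [coe_add_coe, zero_eq_coe, WithBotTop.coe_le_coe]
      have := WithBotTop.coe_le_coe.1 hx
      omega
    · rw [top_add_coe]; exact le_top
  refine ⟨?_, ?_, ?_, ?_, ?_, ?_⟩
  · cases a with
    | replace δ =>
      simp only [nextR]
      split_ifs with h
      · exact le_top
      · exact key _ (le_of_not_filled F h hend)
    | keep =>
      simp only [nextR]
      split_ifs with h
      · exact le_top
      · push Not at h
        refine key _ (le_of_not_filled F (fun h' => h.2 ⟨h.1, h'⟩) hend)
  · rintro (rfl | h0)
    · exact not_filled_top F _ _ _ _ _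
    · have : m.tPlus i = m.t i := by simp [Params.tPlus, h0]
      unfold fillOut
      rw [this]
      exact not_filled_self F hr _ _ _
  · intro h
    cases a with
    | replace δ => exact if_pos h
    | keep => exact if_pos (Or.inr h)
  · rintro rfl h
    exact ⟨fun h' => h'.1 h, if_pos (Or.inl h)⟩
  · rintro (rfl | ⟨rfl, rfl⟩)
    · have : ¬ fillLate m F σ i r (.replace ⊤) ω := not_filled_top F _ _ _ _ _
      exact ⟨this, by simp only [nextR, if_neg this, top_add_coe]⟩
    · have : ¬ fillLate m F σ i ⊤ .keep ω := fun h => not_filled_top F _ _ _ _ _ h.2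
      refine ⟨this, ?_⟩
      simp only [nextR, top_add_coe, ite_self]
  · rintro rfl
    exact filled_bot F ..

/-- The constraints on inventory and outstanding orders are preserved on every path. -/
theorem valid_next (i : ℕ) {q : ℤ} {rA rB : EInt} (hv : m.Valid q rA rB)
    {a : Decision × Decision} (ha : a ∈ m.A q rA rB) (ω : Ω) :
    m.Valid (nextQ m F i q rA rB a ω) (nextR m F .ask i rA a.1 ω) (nextR m F .bid i rB a.2 ω) := by
  obtain ⟨hq1, hq2, hA, hB, hlo, hhi⟩ := hv
  obtain ⟨a1, a2, a3, a4, a5, a6⟩ := side_facts F m .ask i hA a.1 ω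
  obtain ⟨b1, b2, b3, b4, b5, b6⟩ := side_facts F m .bid i hB a.2 ω
  have hl := m.qLow_lt
  have hh := m.qHigh_gt
  have hnl : ¬ m.NearLow q rA → q = m.qLow + 1 → ¬ fillOut m F .ask i rA ω := by
    intro h hq
    apply a2
    by_contra! hc
    exact h (Or.inr ⟨pos_iff_ne_zero.2 hc.2, hq, lt_top_iff_ne_top.2 hc.1⟩)
  have hnh : ¬ m.NearHigh q rB → q = m.qHigh - 1 → ¬ fillOut m F .bid i rB ω := by
    intro h hq
    apply b2
    by_contra! hc
    exact h (Or.inr ⟨pos_iff_ne_zero.2 hc.2, hq, lt_top_iff_ne_top.2 hc.1⟩)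
  have hl1 : ¬ m.NearLow q rA → q ≠ m.qLow := fun h hq => h (Or.inl hq)
  have hh1 : ¬ m.NearHigh q rB → q ≠ m.qHigh := fun h hq => h (Or.inl hq)
  have hl2 : m.NearLow q rA → q = m.qLow ∨ q = m.qLow + 1 := by
    rintro (h | h)
    exacts [Or.inl h, Or.inr h.2.1]
  have hh2 : m.NearHigh q rB → q = m.qHigh ∨ q = m.qHigh - 1 := by
    rintro (h | h)
    exacts [Or.inl h, Or.inr h.2.1]
  -- The inventory bounds are at least four apart, so the two boundary cases exclude each other and
  -- the order of the tests in `Params.A` is immaterial.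
  have ha' : (m.NearLow q rA → a.1 = .replace ⊤ ∨ a.1 = .keep ∨ a.2 = .replace ⊥) ∧
      (m.NearHigh q rB → a.1 = .replace ⊥ ∨ a.2 = .replace ⊤ ∨ a.2 = .keep) := by
    unfold Params.A at ha
    split_ifs at ha with h1 h2
    · refine ⟨fun _ => ha, fun h => ?_⟩
      have := hl2 h1
      have := hh2 h
      omega
    · exact ⟨fun h => absurd h h1, fun _ => ha⟩
    · exact ⟨fun h => absurd h h1, fun h => absurd h h2⟩
  obtain ⟨hal, hah⟩ := ha'
  unfold Params.Valid nextQ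
  -- What remains is a finite case analysis: a kept order fills at most once, a late fill leaves no
  -- order on its side, and a market order on the other side compensates a fill.
  generalize fillOut m F .ask i rA ω = oA at *
  generalize fillOut m F .bid i rB ω = oB at *
  generalize fillLate m F .ask i rA a.1 ω = lA at *
  generalize fillLate m F .bid i rB a.2 ω = lB at *
  generalize nextR m F .ask i rA a.1 ω = nA at *
  generalize nextR m F .bid i rB a.2 ω = nB at *
  generalize m.NearLow q rA = NL at *
  generalize m.NearHigh q rB = NH at *
  refine ⟨?_, ?_, a1, b1, ?_, ?_⟩ <;> unfold ind <;> grind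

end Deterministic

-- Paths of counting processes

/-- The path of a counting process. -/
structure IsCounting (y : ℝ≥0 → ℕ) : Prop where
  zero : y 0 = 0
  mono : Monotone y
  rightCont : ∀ t, ContinuousWithinAt y (Set.Ici t) t

/-- The values are discrete, so right-continuity means constancy on a right neighbourhood. -/
theorem IsCounting.eventually_eq {y : ℝ≥0 → ℕ} (hy : IsCounting y) (t : ℝ≥0) :
    ∀ᶠ u in 𝓝[≥] t, y u = y t := by
  have := hy.rightCont t
  unfold ContinuousWithinAt at this
  rwa [nhds_discrete, tendsto_pure] at this

theorem IsCounting.shift {y : ℝ≥0 → ℕ} (hy : IsCounting y) (T : ℝ≥0) :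
    IsCounting fun u => y (T + u) - y T where
  zero := by simp
  mono u v h := Nat.sub_le_sub_right (hy.mono (by gcongr)) _
  rightCont t := by
    have h : Tendsto (fun u => T + u) (𝓝[≥] t) (𝓝[≥] (T + t)) :=
      tendsto_nhdsWithin_iff.2 ⟨((continuous_const.add continuous_id).tendsto t).mono_left
        nhdsWithin_le_nhds, eventually_nhdsWithin_of_forall fun u hu => by
          simpa using hu⟩
    unfold ContinuousWithinAt
    rw [nhds_discrete, tendsto_pure]
    filter_upwards [h.eventually (hy.eventually_eq (T + t))] with u hu
    rw [hu]

theorem IsCounting.stopAt {y : ℝ≥0 → ℕ} (hy : IsCounting y) (T : ℝ≥0) :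
    IsCounting fun u => y (min u T) where
  zero := by simp [hy.zero]
  mono u v h := hy.mono (min_le_min_right T h)
  rightCont t := by
    have h : Tendsto (fun u => min u T) (𝓝[≥] t) (𝓝[≥] (min t T)) :=
      tendsto_nhdsWithin_iff.2 ⟨((continuous_id.min continuous_const).tendsto t).mono_left
        nhdsWithin_le_nhds, eventually_nhdsWithin_of_forall fun u hu => 
          min_le_min_right T hu⟩
    unfold ContinuousWithinAt
    rw [nhds_discrete, tendsto_pure]
    exact h.eventually (hy.eventually_eq (min t T))

-- Shifting and stopping the order flow

section Deterministic

variable {Ω : Type*} (F : OrderFlow Ω) (m : Params)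

/-- All counting processes have regular paths. -/
structure OrderFlow.Regular (F : OrderFlow Ω) : Prop where
  moves : ∀ ω, IsCounting fun t => F.moves t ω
  flow : ∀ σ ω, IsCounting fun t => F.flow σ t ω

/-- The order flow after time `T`. -/
def OrderFlow.shift (F : OrderFlow Ω) (T : ℝ≥0) : OrderFlow Ω where
  moves u ω := F.moves (T + u) ω - F.moves T ω
  X j ω := F.X (F.moves T ω + j) ω
  flow σ u ω := F.flow σ (T + u) ω - F.flow σ T ω

/-- The order flow up to time `T`. -/
def OrderFlow.stopAt (F : OrderFlow Ω) (T : ℝ≥0) : OrderFlow Ω where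
  moves u ω := F.moves (min u T) ω
  -- Later price moves are erased, so that the stopped flow carries no information about the future.
  X j ω := if j < F.moves T ω then F.X j ω else 0
  flow σ u ω := F.flow σ (min u T) ω

variable {F}

theorem OrderFlow.Regular.shift (hF : F.Regular) (T : ℝ≥0) : (F.shift T).Regular where
  moves ω := (hF.moves ω).shift T
  flow σ ω := (hF.flow σ ω).shift T

theorem OrderFlow.Regular.stopAt (hF : F.Regular) (T : ℝ≥0) : (F.stopAt T).Regular where
  moves ω := (hF.moves ω).stopAt T
  flow σ ω := (hF.flow σ ω).stopAt T

theorem mid_shift (hF : F.Regular) (T u : ℝ≥0) (ω : Ω) :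
    (F.shift T).mid u ω = F.dp T (T + u) ω := by
  have h : F.moves T ω ≤ F.moves (T + u) ω := (hF.moves ω).mono le_self_add
  unfold OrderFlow.dp OrderFlow.mid OrderFlow.shift
  conv_rhs => rw [← Nat.add_sub_cancel' h, Finset.sum_range_add]
  simp

theorem dp_shift (hF : F.Regular) (T a b : ℝ≥0) (ω : Ω) :
    (F.shift T).dp a b ω = F.dp (T + a) (T + b) ω := by
  rw [OrderFlow.dp, mid_shift hF, mid_shift hF]
  simp [OrderFlow.dp]

theorem mid_stopAt (hF : F.Regular) {T u : ℝ≥0} (hu : u ≤ T) (ω : Ω) :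
    (F.stopAt T).mid u ω = F.mid u ω := by
  unfold OrderFlow.mid OrderFlow.stopAt
  simp only [min_eq_left hu]
  refine Finset.sum_congr rfl fun j hj => if_pos ?_
  exact (Finset.mem_range.1 hj).trans_le ((hF.moves ω).mono hu)

theorem dp_stopAt (hF : F.Regular) {T a b : ℝ≥0} (ha : a ≤ T) (hb : b ≤ T) (ω : Ω) :
    (F.stopAt T).dp a b ω = F.dp a b ω := by
  rw [OrderFlow.dp, OrderFlow.dp, mid_stopAt hF ha, mid_stopAt hF hb]

/-- The condition `0 < u` is needed: a jump at `T` itself is invisible in the shifted flow.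
Execution windows are open on the left, so the condition always holds in `filled_shift`. -/
theorem arrival_shift (hF : F.Regular) (σ : Side) {T u : ℝ≥0} (hu : 0 < u) (ω : Ω) :
    (F.shift T).Arrival σ u ω ↔ F.Arrival σ (T + u) ω := by
  unfold OrderFlow.Arrival OrderFlow.shift
  have hm := (hF.flow σ ω).mono
  constructor
  · rintro ⟨-, h⟩
    refine ⟨by positivity, fun s hs => ?_⟩
    rcases le_total T s with hTs | hTs
    · obtain ⟨v, rfl⟩ := exists_add_of_le hTs
      have h1 := h v (lt_of_add_lt_add_left hs)
      have h2 : F.flow σ T ω ≤ F.flow σ (T + v) ω := hm le_self_add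
      simp only at h1
      omega
    · have h1 := h 0 hu
      have h2 : F.flow σ s ω ≤ F.flow σ T ω := hm hTs
      simp only at h1
      omega
  · rintro ⟨-, h⟩
    refine ⟨hu, fun s hs => ?_⟩
    have h1 := h (T + s) (by gcongr)
    have h2 : F.flow σ T ω ≤ F.flow σ (T + s) ω := hm le_self_add
    simp only
    omega

theorem filled_shift (hF : F.Regular) (σ : Side) (T t₀ a b : ℝ≥0) (x : EInt) (ω : Ω) :
    (F.shift T).Filled σ t₀ a b x ω ↔ F.Filled σ (T + t₀) (T + a) (T + b) x ω := by
  unfold OrderFlow.Filled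
  rw [dp_shift hF]
  refine or_congr Iff.rfl ⟨?_, ?_⟩
  · rintro ⟨u, hu, h⟩
    refine ⟨T + u, ⟨by gcongr; exact hu.1, by gcongr; exact hu.2⟩, ?_⟩
    rwa [arrival_shift hF σ (zero_le.trans_lt hu.1), dp_shift hF] at h
  · rintro ⟨v, hv, h⟩
    obtain ⟨u, rfl⟩ := exists_add_of_le ((le_self_add).trans hv.1.le)
    have hau : a < u := lt_of_add_lt_add_left hv.1
    refine ⟨u, ⟨hau, le_of_add_le_add_left hv.2⟩, ?_⟩
    rwa [arrival_shift hF σ (zero_le.trans_lt hau), dp_shift hF]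

theorem arrival_stopAt (σ : Side) {T u : ℝ≥0} (hu : u ≤ T) (ω : Ω) :
    (F.stopAt T).Arrival σ u ω ↔ F.Arrival σ u ω := by
  unfold OrderFlow.Arrival OrderFlow.stopAt
  refine and_congr Iff.rfl (forall₂_congr fun s hs => ?_)
  simp only [min_eq_left hu, min_eq_left (hs.le.trans hu)]

theorem filled_stopAt (hF : F.Regular) (σ : Side) {T t₀ a b : ℝ≥0} (h₀ : t₀ ≤ T) (ha : a ≤ T)
    (hb : b ≤ T) (x : EInt) (ω : Ω) :
    (F.stopAt T).Filled σ t₀ a b x ω ↔ F.Filled σ t₀ a b x ω := by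
  unfold OrderFlow.Filled
  rw [dp_stopAt hF h₀ ha]
  refine or_congr Iff.rfl (exists_congr fun u => and_congr_right fun hu => ?_)
  rw [dp_stopAt hF h₀ (hu.2.trans hb), arrival_stopAt σ (hu.2.trans hb)]

variable {m}

theorem Params.t_add_t_one (i : ℕ) : m.t i + m.t 1 = m.t (i + 1) := by
  rw [m.t_one, m.t_succ]

theorem Params.t_add_tPlus_zero (i : ℕ) : m.t i + m.tPlus 0 = m.tPlus i := by
  rw [m.tPlus_zero]; rfl

theorem fillOut_shift (hF : F.Regular) (σ : Side) (i : ℕ) (r : EInt) (ω : Ω) :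
    fillOut m (F.shift (m.t i)) σ 0 r ω ↔ fillOut m F σ i r ω := by
  unfold fillOut
  rw [filled_shift hF, Params.t_add_tPlus_zero, m.t_zero, add_zero]

theorem fillLate_shift (hF : F.Regular) (σ : Side) (i : ℕ) (r : EInt) (a : Decision) (ω : Ω) :
    fillLate m (F.shift (m.t i)) σ 0 r a ω ↔ fillLate m F σ i r a ω := by
  cases a <;> simp only [fillLate, fillOut_shift hF] <;>
  rw [filled_shift hF, Params.t_add_tPlus_zero, zero_add, Params.t_add_t_one, m.t_zero, add_zero]

theorem nextR_shift (hF : F.Regular) (σ : Side) (i : ℕ) (r : EInt) (a : Decision) (ω : Ω) :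
    nextR m (F.shift (m.t i)) σ 0 r a ω = nextR m F σ i r a ω := by
  cases a <;> simp only [nextR] <;>
  rw [dp_shift hF, zero_add, Params.t_add_t_one, m.t_zero, add_zero]
  · classical exact if_congr (fillLate_shift hF ..) rfl rfl
  · classical exact if_congr (or_congr (fillOut_shift hF ..) (fillLate_shift hF ..)) rfl rfl

theorem nextQ_shift (hF : F.Regular) (i : ℕ) (q : ℤ) (rA rB : EInt) (a : Decision × Decision)
    (ω : Ω) : nextQ m (F.shift (m.t i)) 0 q rA rB a ω = nextQ m F i q rA rB a ω := by
  simp only [nextQ, fillOut_shift hF, fillLate_shift hF]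

theorem priceLate_shift (hF : F.Regular) (σ : Side) (i : ℕ) (p : ℤ) (r : EInt) (a : Decision)
    (ω : Ω) : priceLate m (F.shift (m.t i)) σ 0 p r a ω = priceLate m F σ i p r a ω := by
  cases a <;> simp only [priceLate]
  rw [dp_shift hF, Params.t_add_tPlus_zero, m.t_zero, add_zero]

/-- The transition at epoch `i` is the transition at epoch zero of the shifted order flow. -/
theorem nextState_shift (hF : F.Regular) (i : ℕ) (s : State) (a : Decision × Decision) (ω : Ω) :
    nextState m (F.shift (m.t i)) 0 s a ω = nextState m F i s a ω := by
  simp only [nextState, nextQ_shift hF, nextR_shift hF, priceLate_shift hF, fillOut_shift hF,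
    fillLate_shift hF]
  rw [dp_shift hF, zero_add, Params.t_add_t_one, m.t_zero, add_zero]

theorem nextState_stopAt (hF : F.Regular) {i : ℕ} {T : ℝ≥0} (hT : m.t (i + 1) ≤ T) (s : State)
    (a : Decision × Decision) (ω : Ω) :
    nextState m (F.stopAt T) i s a ω = nextState m F i s a ω := by
  have h1 : m.tPlus i ≤ T := (m.tPlus_lt i).le.trans hT
  have h0 : m.t i ≤ T := (m.t_le_tPlus i).trans h1
  have ho : ∀ σ r, fillOut m (F.stopAt T) σ i r ω ↔ fillOut m F σ i r ω := fun σ r =>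
    filled_stopAt hF σ h0 h0 h1 r ω
  have hl : ∀ σ r a, fillLate m (F.stopAt T) σ i r a ω ↔ fillLate m F σ i r a ω := by
    intro σ r a
    cases a <;> simp only [fillLate, ho, filled_stopAt hF σ h0 h1 hT]
  have hp : ∀ σ p r a, priceLate m (F.stopAt T) σ i p r a ω = priceLate m F σ i p r a ω := by
    intro σ p r a
    cases a <;> simp only [priceLate, dp_stopAt hF h0 h1]
  have hr : ∀ σ r a, nextR m (F.stopAt T) σ i r a ω = nextR m F σ i r a ω := by
    intro σ r a
    cases a <;> simp only [nextR, dp_stopAt hF h0 hT]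
    · classical exact if_congr (hl ..) rfl rfl
    · classical exact if_congr (or_congr (ho ..) (hl ..)) rfl rfl
  simp only [nextState, nextQ, ho, hl, hp, hr, dp_stopAt hF h0 hT]

/-- The state at epoch `i + k` depends on the order flow up to that epoch only. -/
theorem run_stopAt (hF : F.Regular) (π : Policy) (i : ℕ) (s : State) (ω : Ω) {T : ℝ≥0} :
    ∀ k, m.t (i + k) ≤ T → run m (F.stopAt T) π i s ω k = run m F π i s ω k
  | 0, _ => rfl
  | k + 1, hT => by
    have h : m.t (i + k) ≤ T := (m.t_mono (by omega)).trans hT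
    simp only [run, run_stopAt hF π i s ω k h]
    exact nextState_stopAt hF hT ..

/-- Admissible control keeps the system in the state space. -/
theorem run_mem (F : OrderFlow Ω) {π : Policy} (hπ : π.Admissible m) {i : ℕ} {s : State}
    (hs : s ∈ m.S) (ω : Ω) : ∀ k, i + k ≤ m.N → run m F π i s ω k ∈ m.S
  | 0, _ => hs
  | k + 1, h => by
    have ih := run_mem F hπ (i := i) hs ω k (by omega)
    exact valid_next F m (i + k) ih (hπ _ (by omega) _ ih) ω

/-- The terminal wealth as a function of the state at epoch `N` and the subsequent order flow. -/
def finalValue (m : Params) (F : OrderFlow Ω) (s : State) (ω : Ω) : ℝ :=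
  ((s.w + priceOut .ask s.p s.rAsk * ind (fillOut m F .ask 0 s.rAsk ω)
      - priceOut .bid s.p s.rBid * ind (fillOut m F .bid 0 s.rBid ω) : ℚ) : ℝ)
    + ((s.p + F.dp (m.t 0) (m.tPlus 0) ω : ℤ) : ℝ) *
      ((s.q - ind (fillOut m F .ask 0 s.rAsk ω) + ind (fillOut m F .bid 0 s.rBid ω) : ℤ) : ℝ)
    - 1 / 2 * |((s.q - ind (fillOut m F .ask 0 s.rAsk ω)
        + ind (fillOut m F .bid 0 s.rBid ω) : ℤ) : ℝ)|

theorem vFinal_finalState (hF : F.Regular) (s : State) (ω : Ω) :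
    vFinal (finalState m F s ω) = finalValue m (F.shift (m.t m.N)) s ω := by
  simp only [vFinal, finalState, finalValue, fillOut_shift hF]
  rw [dp_shift hF, Params.t_add_tPlus_zero, m.t_zero, add_zero]

end Deterministic

-- Cash flows marked to the mid-price

section Profit

variable {Ω : Type*} (F : OrderFlow Ω) (m : Params)

/-- The rational-valued version of `orderProfit`. -/
def profit (F : OrderFlow Ω) (σ : Side) (t₁ t₂ : ℝ≥0) (x : EInt) (ω : Ω) : ℚ :=
  (maxShift x (1 / 2 - σ.sgn * F.dp 0 t₁ ω) (-1 / 2) - σ.sgn * F.dp t₁ (t₁ + t₂) ω) *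
    ind (F.Filled σ 0 t₁ (t₁ + t₂) x ω)

theorem orderProfit_eq (σ : Side) (t₁ t₂ : ℝ≥0) (x : EInt) (ω : Ω) :
    orderProfit F σ t₁ t₂ x ω = (profit F σ t₁ t₂ x ω : ℝ) := rfl

/-- The profit of one side in the first period, relative to the mid-price at its end. -/
def periodProfit (σ : Side) (r : EInt) (a : Decision) (ω : Ω) : ℚ :=
  match a with
  -- The profit of the old order is marked to the mid-price at `dtau`. The last term moves the mark
  -- to the end of the period.
  | .replace δ => profit F σ 0 m.dtau r ω + profit F σ m.dtau (m.dt - m.dtau) δ ω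
      - σ.sgn * F.dp m.dtau m.dt ω * ind (fillOut m F σ 0 r ω)
  | .keep => profit F σ 0 m.dt r ω

/-- The value of an executed resting order. -/
theorem profit_resting (σ : Side) {r : EInt} (hr : 0 ≤ r) (p : ℤ) (t : ℝ≥0) (ω : Ω) :
    profit F σ 0 t r ω = σ.sgn * (priceOut σ p r - (p + F.dp 0 t ω)) *
      ind (F.Filled σ 0 0 t r ω) := by
  unfold profit
  rw [zero_add]
  rcases eInt_nonneg_cases hr with ⟨n, hn, rfl⟩ | rfl
  · have hn' : (0 : ℚ) ≤ n := by exact_mod_cast hn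
    have hs : (σ.sgn : ℚ) * σ.sgn = 1 := by exact_mod_cast σ.sgn_mul_self
    congr 1
    rw [maxShift_coe, dp_self, priceOut, finitePart_coe, max_eq_left (by push_cast; linarith)]
    push_cast
    linear_combination (-(1/2 : ℚ) - n) * hs
  · simp [ind_of_false (not_filled_top F _ _ _ _ _)]

/-- The cash flow of one side in the first period, marked to the mid-price at its end. -/
theorem cashflow_eq (σ : Side) {r : EInt} (hr : 0 ≤ r) (a : Decision) (p : ℤ) (ω : Ω) :
    (σ.sgn : ℚ) * (priceOut σ p r - (p + F.dp (m.t 0) (m.t 1) ω)) * ind (fillOut m F σ 0 r ω)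
      + σ.sgn * (priceLate m F σ 0 p r a ω - (p + F.dp (m.t 0) (m.t 1) ω))
        * ind (fillLate m F σ 0 r a ω) = periodProfit F m σ r a ω := by
  have hs : (σ.sgn : ℚ) * σ.sgn = 1 := by exact_mod_cast σ.sgn_mul_self
  have hsplit : (F.dp 0 m.dtau ω : ℚ) + F.dp m.dtau m.dt ω = F.dp 0 m.dt ω := by
    exact_mod_cast dp_add_dp F 0 m.dtau m.dt ω
  have hdt : m.dtau + (m.dt - m.dtau) = m.dt := add_tsub_cancel_of_le m.latency_lt.le
  cases a with
  | keep =>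
    simp only [periodProfit, priceLate]
    rw [profit_resting F σ hr p, ← mul_add, m.t_zero, m.t_one]
    congr 1
    have h := filled_split F hr σ (zero_le (a := m.dtau)) m.latency_lt.le ω
    simp only [fillLate, fillOut, m.t_zero, m.tPlus_zero, m.t_one, zero_add]
    unfold ind
    by_cases h1 : F.Filled σ 0 0 m.dtau r ω <;> by_cases h2 : F.Filled σ 0 m.dtau m.dt r ω <;>
      simp [h, h1, h2]
  | replace δ =>
    simp only [periodProfit, priceLate, fillLate]
    rw [profit_resting F σ hr p]
    simp only [fillOut, m.t_zero, m.tPlus_zero, m.t_one, zero_add, profit, hdt]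
    -- The execution price is relative to the mid-price at the epoch, while `profit` refers to the
    -- mid-price at `dtau`; the move between the two passes through the maximum.
    have hlate : (σ.sgn : ℚ) * (p + σ.sgn * maxShift δ (1 / 2) (-1 / 2 + σ.sgn * F.dp 0 m.dtau ω)
          - (p + F.dp 0 m.dt ω)) * ind (F.Filled σ 0 m.dtau m.dt δ ω) =
        (maxShift δ (1 / 2 - σ.sgn * F.dp 0 m.dtau ω) (-1 / 2) - σ.sgn * F.dp m.dtau m.dt ω) *
          ind (F.Filled σ 0 m.dtau m.dt δ ω) := by
      rcases eInt_cases δ with rfl | ⟨n, rfl⟩ | rfl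
      · congr 1
        simp only [maxShift_bot]
        linear_combination (-1 / 2 + (σ.sgn : ℚ) * F.dp 0 m.dtau ω) * hs + (σ.sgn : ℚ) * hsplit
      · congr 1
        simp only [maxShift_coe]
        have : max ((n : ℚ) + 1 / 2) (-1 / 2 + σ.sgn * F.dp 0 m.dtau ω) =
            max ((n : ℚ) + (1 / 2 - σ.sgn * F.dp 0 m.dtau ω)) (-1 / 2)
              + σ.sgn * F.dp 0 m.dtau ω := by
          rw [max_add]; congr 1; ring
        rw [this]
        linear_combination (max ((n : ℚ) + (1 / 2 - σ.sgn * F.dp 0 m.dtau ω)) (-1 / 2)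
              + σ.sgn * F.dp 0 m.dtau ω) * hs + (σ.sgn : ℚ) * hsplit
      · simp [ind_of_false (not_filled_top F _ _ _ _ _)]
    rw [hlate]
    linear_combination ((σ.sgn : ℚ) * ind (F.Filled σ 0 0 m.dtau r ω)) * hsplit

/-- Marked-to-market wealth after one period. -/
theorem wealth_next (s : State) (hs : s ∈ m.S) (a : Decision × Decision) (ω : Ω) :
    (nextState m F 0 s a ω).w + (nextState m F 0 s a ω).p * (nextState m F 0 s a ω).q =
      s.w + s.p * s.q + s.q * F.dp 0 m.dt ω
        + periodProfit F m .ask s.rAsk a.1 ω + periodProfit F m .bid s.rBid a.2 ω := by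
  have hA := cashflow_eq F m .ask hs.2.2.1 a.1 s.p ω
  have hB := cashflow_eq F m .bid hs.2.2.2.1 a.2 s.p ω
  simp only [nextState, nextQ]
  simp only [Side.sgn] at hA hB
  rw [← hA, ← hB, m.t_zero, zero_add, m.t_one]
  push_cast
  ring

/-- The terminal wealth in terms of the profits of the outstanding orders. -/
theorem finalValue_eq (s : State) (hs : s ∈ m.S) (ω : Ω) :
    finalValue m F s ω = s.w + s.p * s.q + s.q * F.dp 0 m.dtau ω
      + orderProfit F .ask 0 m.dtau s.rAsk ω + orderProfit F .bid 0 m.dtau s.rBid ω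
      - 1 / 2 * |((s.q - ind (fillOut m F .ask 0 s.rAsk ω)
        + ind (fillOut m F .bid 0 s.rBid ω) : ℤ) : ℝ)| := by
  rw [finalValue, orderProfit_eq, orderProfit_eq, profit_resting F .ask hs.2.2.1 s.p,
    profit_resting F .bid hs.2.2.2.1 s.p]
  simp only [fillOut, m.t_zero, m.tPlus_zero, Side.sgn]
  push_cast
  ring

end Profit

-- Pathwise bounds by the price variation

section Bounds

variable {Ω : Type*} (F : OrderFlow Ω)

/-- A bound for all mid-price changes up to time `c`. -/
def OrderFlow.span (c : ℝ≥0) (ω : Ω) : ℤ := 2 * ∑ j ∈ Finset.range (F.moves c ω), |F.X j ω|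

variable {F}

theorem span_nonneg (c : ℝ≥0) (ω : Ω) : 0 ≤ F.span c ω :=
  mul_nonneg (by norm_num) (Finset.sum_nonneg fun _ _ => abs_nonneg _)

/-- Each of the two mid-prices is bounded by the sum of the absolute moves, whence the factor 2 in
`OrderFlow.span`. -/
theorem abs_dp_le (hF : F.Regular) {u v c : ℝ≥0} (hu : u ≤ c) (hv : v ≤ c) (ω : Ω) :
    |F.dp u v ω| ≤ F.span c ω := by
  have key : ∀ w ≤ c, |F.mid w ω| ≤ ∑ j ∈ Finset.range (F.moves c ω), |F.X j ω| := by
    intro w hw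
    refine (Finset.abs_sum_le_sum_abs _ _).trans ?_
    refine Finset.sum_le_sum_of_subset_of_nonneg ?_ fun _ _ _ => abs_nonneg _
    gcongr
    exact (hF.moves ω).mono hw
  have := key u hu
  have := key v hv
  have := abs_sub (F.mid v ω) (F.mid u ω)
  unfold OrderFlow.dp OrderFlow.span
  linarith

/-- The price must reach the limit of an order to fill it. On a given path, orders far from the
mid-price are therefore never filled; this yields both domination and continuity at `⊤`. -/
theorem le_span_of_filled (hF : F.Regular) {σ : Side} {t₀ a b c : ℝ≥0} (h₀ : t₀ ≤ c) (ha : a ≤ c)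
    (hb : b ≤ c) {x : EInt} {ω : Ω} (h : F.Filled σ t₀ a b x ω) : x ≤ (F.span c ω : ℤ) := by
  have key : ∀ u ≤ c, ((σ.sgn * F.dp t₀ u ω : ℤ) : EInt) ≤ (F.span c ω : ℤ) := by
    intro u hu
    rw [WithBotTop.coe_le_coe]
    refine (le_abs_self _).trans ?_
    rw [σ.abs_sgn_mul]
    exact abs_dp_le hF h₀ hu ω
  rcases h with h | ⟨u, hu, h | ⟨-, h⟩⟩
  · exact h.le.trans (key a ha)
  · exact h.le.trans (key u (hu.2.trans hb))
  · exact h.le.trans (key u (hu.2.trans hb))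

/-- The value of an executed order is controlled by the mid-price moves. -/
theorem abs_maxShift_le {x : EInt} {B c : ℤ} {d : ℚ} (hx : x ≤ B) (hB : 0 ≤ B)
    (hxt : x ≠ ⊤) (hc : |c| ≤ B) (hd : d = -1 / 2) :
    |maxShift x (1 / 2 - c) d| ≤ 2 * B + 1 := by
  subst hd
  have hB' : (0 : ℚ) ≤ B := by exact_mod_cast hB
  have hc' : |(c : ℚ)| ≤ B := by exact_mod_cast hc
  rcases eInt_cases x with rfl | ⟨n, rfl⟩ | rfl
  · rw [maxShift_bot, abs_le]; constructor <;> linarith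
  · have hn : (n : ℚ) ≤ B := by exact_mod_cast WithBotTop.coe_le_coe.1 hx
    rw [maxShift_coe, abs_le]
    have := abs_le.1 hc'
    exact ⟨(by linarith : _ ≤ (-1 / 2 : ℚ)).trans (le_max_right _ _),
      max_le (by linarith) (by linarith)⟩
  · exact absurd rfl hxt

/-- The value at execution contributes twice the variation plus 1, the later price move once more.
What matters is that the bound does not depend on `x`. -/
theorem abs_profit_le (hF : F.Regular) (σ : Side) (t₁ t₂ : ℝ≥0) (x : EInt) (ω : Ω) :
    |profit F σ t₁ t₂ x ω| ≤ 3 * F.span (t₁ + t₂) ω + 1 := by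
  have h0 := span_nonneg (F := F) (t₁ + t₂) ω
  have h0' : (0 : ℚ) ≤ F.span (t₁ + t₂) ω := by exact_mod_cast h0
  unfold profit
  by_cases h : F.Filled σ 0 t₁ (t₁ + t₂) x ω
  · rw [ind_of_true h, Int.cast_one, mul_one]
    have h1 : |(σ.sgn : ℚ) * F.dp t₁ (t₁ + t₂) ω| ≤ F.span (t₁ + t₂) ω := by
      have := abs_dp_le hF (le_self_add (a := t₁) (b := t₂)) le_rfl ω
      rw [← σ.abs_sgn_mul] at this
      exact_mod_cast this
    have h2 : |maxShift x (1 / 2 - σ.sgn * F.dp 0 t₁ ω) (-1 / 2)| ≤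
        2 * F.span (t₁ + t₂) ω + 1 := by
      have := abs_maxShift_le (c := σ.sgn * F.dp 0 t₁ ω) (d := -1 / 2)
        (le_span_of_filled hF zero_le le_self_add le_rfl h) h0
        (by rintro rfl; exact not_filled_top F _ _ _ _ _ h)
        (by rw [σ.abs_sgn_mul]; exact abs_dp_le hF zero_le le_self_add ω) rfl
      exact_mod_cast this
    have := abs_sub (maxShift x (1 / 2 - σ.sgn * F.dp 0 t₁ ω) (-1 / 2))
      ((σ.sgn : ℚ) * F.dp t₁ (t₁ + t₂) ω)
    linarith
  · rw [ind_of_false h, Int.cast_zero, mul_zero, abs_zero]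
    linarith

end Bounds

/-! ### Independence of past and future -/

section Independence

variable {Ω : Type*} [mΩ : MeasurableSpace Ω] {P : Measure Ω} [IsProbabilityMeasure P]

/-- If independent sigma-algebras contain independent pairs, then the sigma-algebras generated by
the first and by the second components are independent. -/
theorem indep_iSup_iSup {ι : Type*} [Fintype ι] {H A B : ι → MeasurableSpace Ω}
    (hH : iIndep H P) (hle : ∀ i, H i ≤ mΩ) (hA : ∀ i, A i ≤ H i) (hB : ∀ i, B i ≤ H i)
    (h : ∀ i, Indep (A i) (B i) P) : Indep (⨆ i, A i) (⨆ i, B i) P := by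
  -- An intersection over some of the indices becomes one over all indices by inserting `Set.univ`.
  have hsets : ∀ (C : ι → MeasurableSpace Ω) (s : Set Ω),
      s ∈ piiUnionInter (fun i => {s | MeasurableSet[C i] s}) Set.univ →
        ∃ f : ι → Set Ω, (∀ i, MeasurableSet[C i] (f i)) ∧ s = ⋂ i, f i := by
    classical
    rintro C s ⟨t, -, f, hf, rfl⟩
    refine ⟨fun i => if i ∈ t then f i else Set.univ, fun i => ?_, ?_⟩
    · dsimp only
      split_ifs with hi
      · exact hf i hi
      · exact @MeasurableSet.univ _ (C i)
    · ext ω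
      simp only [Set.mem_iInter]
      refine forall_congr' fun i => ?_
      by_cases hi : i ∈ t <;> simp [hi]
  refine IndepSets.indep (p1 := piiUnionInter (fun i => {s | MeasurableSet[A i] s}) Set.univ)
    (p2 := piiUnionInter (fun i => {s | MeasurableSet[B i] s}) Set.univ)
    (iSup_le fun i => (hA i).trans (hle i)) (iSup_le fun i => (hB i).trans (hle i))
    (isPiSystem_piiUnionInter _ (fun i => @MeasurableSpace.isPiSystem_measurableSet _ (A i)) _)
    (isPiSystem_piiUnionInter _ (fun i => @MeasurableSpace.isPiSystem_measurableSet _ (B i)) _)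
    ?_ ?_ ?_
  · exact (by simpa using (generateFrom_piiUnionInter_measurableSet A Set.univ).symm)
  · exact (by simpa using (generateFrom_piiUnionInter_measurableSet B Set.univ).symm)
  · rw [IndepSets_iff]
    intro s1 s2 h1 h2
    obtain ⟨f, hf, rfl⟩ := hsets A s1 h1
    obtain ⟨g, hg, rfl⟩ := hsets B s2 h2
    rw [← Set.iInter_inter_distrib, hH.meas_iInter fun i => ((hA i) _ (hf i)).inter ((hB i) _ (hg i)),
      hH.meas_iInter fun i => (hA i) _ (hf i), hH.meas_iInter fun i => (hB i) _ (hg i),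
      ← Finset.prod_mul_distrib]
    exact Finset.prod_congr rfl fun i _ => (Indep_iff _ _ _).1 (h i) _ _ (hf i) (hg i)

/-- The joint law of four random variables that generate independent sigma-algebras. -/
theorem map_quadruple {E₁ E₂ E₃ E₄ : Type*} [MeasurableSpace E₁] [MeasurableSpace E₂]
    [MeasurableSpace E₃] [MeasurableSpace E₄] {f₁ : Ω → E₁} {f₂ : Ω → E₂} {f₃ : Ω → E₃}
    {f₄ : Ω → E₄} (h₁ : Measurable f₁) (h₂ : Measurable f₂) (h₃ : Measurable f₃)
    (h₄ : Measurable f₄)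
    (h : iIndep ![MeasurableSpace.comap f₁ inferInstance, MeasurableSpace.comap f₂ inferInstance,
      MeasurableSpace.comap f₃ inferInstance, MeasurableSpace.comap f₄ inferInstance] P) :
    P.map (fun ω => (f₁ ω, f₂ ω, f₃ ω, f₄ ω)) =
      (P.map f₁).prod ((P.map f₂).prod ((P.map f₃).prod (P.map f₄))) := by
  have hle : ∀ i, ![MeasurableSpace.comap f₁ inferInstance, MeasurableSpace.comap f₂ inferInstance,
      MeasurableSpace.comap f₃ inferInstance, MeasurableSpace.comap f₄ inferInstance] i ≤ mΩ := by
    intro i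
    fin_cases i
    exacts [h₁.comap_le, h₂.comap_le, h₃.comap_le, h₄.comap_le]
  have key := fun S T hST => indep_iSup_of_disjoint hle h (S := S) (T := T) hST
  have i1 : IndepFun f₁ (fun ω => (f₂ ω, f₃ ω, f₄ ω)) P := by
    rw [IndepFun_iff_Indep]
    refine indep_of_indep_of_le_left (indep_of_indep_of_le_right
      (key {0} {1, 2, 3} (by simp)) ?_) ?_
    · simp only [iSup_insert, iSup_singleton]
      exact (MeasurableSpace.comap_prodMk f₂ fun ω => (f₃ ω, f₄ ω)).trans_le
        (sup_le_sup_left (MeasurableSpace.comap_prodMk f₃ f₄).le _)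
    · simp
  have i2 : IndepFun f₂ (fun ω => (f₃ ω, f₄ ω)) P := by
    rw [IndepFun_iff_Indep]
    refine indep_of_indep_of_le_left (indep_of_indep_of_le_right
      (key {1} {2, 3} (by simp)) ?_) ?_
    · simp only [iSup_insert, iSup_singleton]
      exact (MeasurableSpace.comap_prodMk f₃ f₄).le
    · simp
  have i3 : IndepFun f₃ f₄ P := by
    rw [IndepFun_iff_Indep]
    refine indep_of_indep_of_le_left (indep_of_indep_of_le_right
      (key {2} {3} (by simp)) ?_) ?_
    · simp
    · simp
  rw [(indepFun_iff_map_prod_eq_prod_map_map h₁.aemeasurable (by fun_prop)).1 i1,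
    (indepFun_iff_map_prod_eq_prod_map_map h₂.aemeasurable (by fun_prop)).1 i2,
    (indepFun_iff_map_prod_eq_prod_map_map h₃.aemeasurable (by fun_prop)).1 i3]

end Independence

/-! ### Poisson processes -/

/-- Values of a process at finitely many times become sums of its increments along one monotone
sequence, to which independence of increments applies. -/
theorem exists_monotone_enum (S : Finset ℝ≥0) :
    ∃ t : ℕ → ℝ≥0, Monotone t ∧ t 0 = 0 ∧ ∀ s ∈ S, ∃ k, t k = s := by
  classical
  set S' := insert 0 S with hS'
  have hpos : 0 < S'.card := Finset.card_pos.2 ⟨0, by simp [hS']⟩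
  -- The enumeration stays at the largest point once all points are listed.
  refine ⟨fun k => S'.orderEmbOfFin rfl ⟨min k (S'.card - 1), by omega⟩, ?_, ?_, ?_⟩
  · intro i j h
    refine (S'.orderEmbOfFin rfl).monotone ?_
    simp only [Fin.mk_le_mk]
    omega
  · obtain ⟨j, hj⟩ : (0 : ℝ≥0) ∈ Set.range (S'.orderEmbOfFin rfl) := by
      rw [Finset.range_orderEmbOfFin]; simp [hS']
    refine le_antisymm (hj ▸ (S'.orderEmbOfFin rfl).monotone ?_) zero_le
    simp [Fin.le_def]
  · intro s hs
    obtain ⟨j, hj⟩ : s ∈ Set.range (S'.orderEmbOfFin rfl) := by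
      rw [Finset.range_orderEmbOfFin]; simp [hS', hs]
    refine ⟨j, ?_⟩
    rw [← hj]
    exact congrArg _ (Fin.ext (min_eq_left (Nat.le_sub_one_of_lt j.2)))

section Poisson

variable {Ω Ω' : Type*} [mΩ : MeasurableSpace Ω] [mΩ' : MeasurableSpace Ω'] {P : Measure Ω}
  {P' : Measure Ω'} {Y : ℝ≥0 → Ω → ℕ}
  {Y' : ℝ≥0 → Ω' → ℕ} {rate : ℝ≥0}

theorem IsPoissonProcess.isCounting (h : IsPoissonProcess Y rate P) (ω : Ω) :
    IsCounting fun t => Y t ω := ⟨h.zero ω, h.mono ω, h.rightCont ω⟩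

theorem IsPoissonProcess.shift (h : IsPoissonProcess Y rate P) (T : ℝ≥0) :
    IsPoissonProcess (fun u ω => Y (T + u) ω - Y T ω) rate P := by
  -- Subtraction in `ℕ` is truncated; monotone paths make it exact.
  have hsub : ∀ s t ω, Y (T + t) ω - Y T ω - (Y (T + s) ω - Y T ω) = Y (T + t) ω - Y (T + s) ω :=
    fun s t ω => by
      have : Y T ω ≤ Y (T + s) ω := h.mono ω le_self_add
      omega
  refine ⟨fun t => (h.measurable _).sub (h.measurable _), fun ω => ((h.isCounting ω).shift T).zero,
    fun ω => ((h.isCounting ω).shift T).mono, fun ω => ((h.isCounting ω).shift T).rightCont, ?_, ?_⟩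
  · intro n t ht
    simp only [hsub]
    exact h.indepIncrements n (fun k => T + t k) fun i j hij => by have := ht hij; dsimp only; gcongr
  · intro s t hst
    simp only [hsub]
    have := h.law (T + s) (T + t) (by gcongr)
    rwa [add_tsub_add_eq_tsub_left] at this

theorem IsPoissonProcess.eq_sum (h : IsPoissonProcess Y rate P) {t : ℕ → ℝ≥0} (ht : Monotone t)
    {i j : ℕ} (hij : i ≤ j) (ω : Ω) :
    Y (t j) ω - Y (t i) ω = ∑ k ∈ Finset.Ico i j, (Y (t (k + 1)) ω - Y (t k) ω) := by
  induction j, hij using Nat.le_induction with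
  | base => simp
  | succ j hij ih =>
    rw [Finset.sum_Ico_succ_top hij, ← ih]
    have h1 : Y (t i) ω ≤ Y (t j) ω := h.mono ω (ht hij)
    have h2 : Y (t j) ω ≤ Y (t (j + 1)) ω := h.mono ω (ht (Nat.le_succ j))
    omega

theorem IsPoissonProcess.measurable_path (h : IsPoissonProcess Y rate P) :
    Measurable fun ω t => Y t ω := measurable_pi_lambda _ h.measurable

/-- The law of a Poisson process is determined by its rate. -/
theorem IsPoissonProcess.map_eq [IsProbabilityMeasure P] [IsProbabilityMeasure P']
    (h : IsPoissonProcess Y rate P)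
    (h' : IsPoissonProcess Y' rate P') :
    P.map (fun ω t => Y t ω) = P'.map (fun ω t => Y' t ω) := by
  have hfd : ∀ I : Finset ℝ≥0, P.map (fun ω => I.restrict (Y · ω)) =
      P'.map (fun ω => I.restrict (Y' · ω)) := by
    intro I
    obtain ⟨t, ht, ht0, hI⟩ := exists_monotone_enum I
    choose! k hk using hI
    -- Partial sums recover the values because the sequence starts at time zero, where the process
    -- vanishes.
    let Φ : (ℕ → ℕ) → (I → ℕ) := fun v i => ∑ j ∈ Finset.Ico 0 (k i), v j
    have hΦ : Measurable Φ := measurable_pi_lambda _ fun i =>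
      Finset.measurable_sum _ fun j _ => measurable_pi_apply j
    have e : (fun ω => I.restrict (Y · ω)) = Φ ∘ fun ω j => Y (t (j + 1)) ω - Y (t j) ω := by
      funext ω i
      have := h.eq_sum ht (Nat.zero_le (k i)) ω
      rwa [hk i i.2, ht0, h.zero, Nat.sub_zero] at this
    have e' : (fun ω => I.restrict (Y' · ω)) = Φ ∘ fun ω j => Y' (t (j + 1)) ω - Y' (t j) ω := by
      funext ω i
      have := h'.eq_sum ht (Nat.zero_le (k i)) ω
      rwa [hk i i.2, ht0, h'.zero, Nat.sub_zero] at this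
    have hm : ∀ j, Measurable fun ω => Y (t (j + 1)) ω - Y (t j) ω := fun j =>
      (h.measurable _).sub (h.measurable _)
    have hm' : ∀ j, Measurable fun ω => Y' (t (j + 1)) ω - Y' (t j) ω := fun j =>
      (h'.measurable _).sub (h'.measurable _)
    rw [e, e', ← Measure.map_map hΦ (measurable_pi_lambda _ hm),
      ← Measure.map_map hΦ (measurable_pi_lambda _ hm'),
      (iIndepFun_iff_map_fun_eq_infinitePi_map hm).1 (h.indepIncrements.nat ht),
      (iIndepFun_iff_map_fun_eq_infinitePi_map hm').1 (h'.indepIncrements.nat ht)]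
    congr 2
    funext j
    rw [(h.law _ _ (ht (Nat.le_succ j))).map_eq, (h'.law _ _ (ht (Nat.le_succ j))).map_eq]
  -- A finite measure on path space is determined by its finite-dimensional marginals.
  have l1 := isProjectiveLimit_map (P := P) (X := Y) h.measurable_path.aemeasurable
  have l2 := isProjectiveLimit_map (P := P') (X := Y') h'.measurable_path.aemeasurable
  have : ∀ I : Finset ℝ≥0, IsFiniteMeasure (P.map fun ω => I.restrict (Y · ω)) := fun I => by
    infer_instance
  refine IsProjectiveLimit.unique l1 ?_
  rw [funext hfd]
  exact l2

/-- A Poisson process up to time `T` is independent of its increments after time `T`. -/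
theorem IsPoissonProcess.indepFun_stopAt_shift [IsProbabilityMeasure P]
    (h : IsPoissonProcess Y rate P) (T : ℝ≥0) :
    IndepFun (fun ω u => Y (min u T) ω) (fun ω u => Y (T + u) ω - Y T ω) P := by
  classical
  refine IndepFun.process_indepFun_process (fun u => h.measurable _)
    (fun u => (h.measurable _).sub (h.measurable _)) fun I J => ?_
  obtain ⟨t, ht, ht0, hS⟩ := exists_monotone_enum
    (insert T (I.image (fun u => min u T) ∪ J.image (fun u => T + u)))
  obtain ⟨kT, hkT⟩ := hS T (by simp)
  have hm : ∀ j, Measurable fun ω => Y (t (j + 1)) ω - Y (t j) ω := fun j =>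
    (h.measurable _).sub (h.measurable _)
  have hind := indep_iSup_of_disjoint (fun j => (hm j).comap_le)
    (h.indepIncrements.nat ht).iIndep (S := Set.Iio kT) (T := Set.Ici kT)
    (Set.disjoint_left.2 fun j h1 h2 => absurd (Set.mem_Iio.1 h1) (not_lt.2 h2))
  have hsum : ∀ (S : Set ℕ) (a b : ℕ), (∀ j ∈ Finset.Ico a b, j ∈ S) →
      Measurable[⨆ j ∈ S, MeasurableSpace.comap (fun ω => Y (t (j + 1)) ω - Y (t j) ω)
        inferInstance] fun ω => ∑ j ∈ Finset.Ico a b, (Y (t (j + 1)) ω - Y (t j) ω) := by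
    intro S a b hab
    refine Finset.measurable_sum _ fun j hj => ?_
    exact (comap_measurable _).mono (le_iSup₂_of_le j (hab j hj) le_rfl) le_rfl
  rw [IndepFun_iff_Indep]
  refine indep_of_indep_of_le_left (indep_of_indep_of_le_right hind ?_) ?_
  · refine measurable_iff_comap_le.1 (@measurable_pi_lambda _ _ _ (_) _ _ fun u => ?_)
    obtain ⟨k, hk⟩ := hS (T + u) (by simp [u.2])
    -- The enumeration may repeat values. An index below `kT` is possible only if `T + u = T`, and
    -- then `kT` serves instead.
    have hle : ∃ k, kT ≤ k ∧ t k = T + u := by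
      rcases le_total kT k with hkk | hkk
      · exact ⟨k, hkk, hk⟩
      · refine ⟨kT, le_rfl, le_antisymm (hkT.trans_le le_self_add) ?_⟩
        rw [← hk]; exact ht hkk
    obtain ⟨k, hkk, hk⟩ := hle
    have := hsum (Set.Ici kT) kT k fun j hj => (Finset.mem_Ico.1 hj).1
    simp only [← h.eq_sum ht hkk, hk, hkT] at this
    exact this
  · refine measurable_iff_comap_le.1 (@measurable_pi_lambda _ _ _ (_) _ _ fun u => ?_)
    obtain ⟨k, hk⟩ := hS (min (u : ℝ≥0) T) (by
      simp only [Finset.mem_insert, Finset.mem_union, Finset.mem_image]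
      exact Or.inr (Or.inl ⟨u, u.2, rfl⟩))
    have hle : ∃ k, k ≤ kT ∧ t k = min (u : ℝ≥0) T := by
      rcases le_total k kT with hkk | hkk
      · exact ⟨k, hkk, hk⟩
      · refine ⟨kT, le_rfl, le_antisymm ?_ (hkT ▸ min_le_right _ _)⟩
        rw [← hk]; exact ht hkk
    obtain ⟨k, hkk, hk⟩ := hle
    have := hsum (Set.Iio kT) 0 k fun j hj => (Finset.mem_Ico.1 hj).2.trans_le hkk
    simp only [← h.eq_sum ht (Nat.zero_le k), hk, ht0, h.zero, Nat.sub_zero] at this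
    exact this

/-- Without its zero term, and after cancelling one factor of the factorial, the series of the mean
is a multiple of the exponential series. -/
theorem IsPoissonProcess.integrable (h : IsPoissonProcess Y rate P) (t : ℝ≥0) :
    Integrable (fun ω => (Y t ω : ℝ)) P := by
  have hl := h.law 0 t zero_le
  simp only [h.zero, Nat.sub_zero] at hl
  have : Integrable (fun n : ℕ => (n : ℝ)) (poissonMeasure (rate * t)) := by
    rw [integrable_poissonMeasure_iff]
    rw [← summable_nat_add_iff 1]
    have hs := (Real.summable_pow_div_factorial ((rate * t : ℝ≥0) : ℝ)).mul_left
      (Real.exp (-((rate * t : ℝ≥0) : ℝ)) * ((rate * t : ℝ≥0) : ℝ))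
    refine hs.congr fun n => ?_
    have : ((n : ℝ) + 1) ≠ 0 := by positivity
    rw [Nat.factorial_succ, Real.norm_natCast]
    push_cast
    field_simp
    ring
  have h2 := hl.map_eq
  rw [tsub_zero] at h2
  rw [← h2, integrable_map_measure (by measurability) hl.aemeasurable] at this
  exact this

end Poisson

/-! ### Symmetric signs -/

section Signs

variable {Ω : Type*} [mΩ : MeasurableSpace Ω] {P : Measure Ω}

theorem ae_sign [IsProbabilityMeasure P] {X : Ω → ℤ} (hX : Measurable X)
    (h1 : P {ω | X ω = 1} = 1 / 2)
    (h2 : P {ω | X ω = -1} = 1 / 2) : ∀ᵐ ω ∂P, X ω = 1 ∨ X ω = -1 := by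
  have hm : ∀ c, MeasurableSet {ω | X ω = c} := fun c => hX (measurableSet_singleton c)
  have hd : Disjoint {ω | X ω = 1} {ω | X ω = -1} :=
    Set.disjoint_left.2 fun ω ha hb => by
      simp only [Set.mem_ofPred_eq] at ha hb; omega
  have : P ({ω | X ω = 1} ∪ {ω | X ω = -1}) = 1 := by
    rw [measure_union hd (hm _), h1, h2, one_div, ENNReal.inv_two_add_inv_two]
  rw [← prob_compl_eq_zero_iff ((hm _).union (hm _))] at this
  exact measure_eq_zero_iff_ae_notMem.1 this |>.mono fun ω hω => by
    simpa [or_iff_not_imp_left] using hω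

theorem map_sign_eq [IsProbabilityMeasure P] {X : Ω → ℤ} (hX : Measurable X)
    (h1 : P {ω | X ω = 1} = 1 / 2)
    (h2 : P {ω | X ω = -1} = 1 / 2) :
    P.map X = (1 / 2 : ENNReal) • Measure.dirac 1 + (1 / 2 : ENNReal) • Measure.dirac (-1) := by
  refine Measure.ext_of_singleton fun c => ?_
  rw [Measure.map_apply hX (measurableSet_singleton c)]
  simp only [Measure.coe_add, Measure.coe_smul, Pi.add_apply, Pi.smul_apply, smul_eq_mul]
  rw [Measure.dirac_apply, Measure.dirac_apply]
  by_cases hc1 : c = 1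
  · subst hc1
    refine h1.trans ?_
    simp
  · by_cases hc2 : c = -1
    · subst hc2
      refine h2.trans ?_
      simp
    · have : P (X ⁻¹' {c}) = 0 := by
        rw [measure_eq_zero_iff_ae_notMem]
        filter_upwards [ae_sign hX h1 h2] with ω hω
        simp only [Set.mem_preimage, Set.mem_singleton_iff]
        rintro rfl
        rcases hω with h | h
        · exact hc1 h
        · exact hc2 h
      rw [this]
      simp [Ne.symm hc1, Ne.symm hc2]

/-- The two families depend on disjoint blocks of indices, as the first one is constant from `n` on.
-/
theorem indepFun_signs {X : ℕ → Ω → ℤ} (hX : ∀ j, Measurable (X j)) (h : iIndepFun X P) (n : ℕ) :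
    IndepFun (fun ω j => if j < n then X j ω else 0) (fun ω j => X (n + j) ω) P := by
  have hind := indep_iSup_of_disjoint (fun j => (hX j).comap_le) h.iIndep (S := Set.Iio n)
    (T := Set.Ici n) (Set.disjoint_left.2 fun j h1 h2 => absurd (Set.mem_Iio.1 h1) (not_lt.2 h2))
  rw [IndepFun_iff_Indep]
  refine indep_of_indep_of_le_left (indep_of_indep_of_le_right hind ?_) ?_
  · refine measurable_iff_comap_le.1 (@measurable_pi_lambda _ _ _ (_) _ _ fun j => ?_)
    exact (comap_measurable (X (n + j))).mono
      (le_iSup₂_of_le (n + j) (Set.mem_Ici.2 (by omega)) le_rfl) le_rfl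
  · refine measurable_iff_comap_le.1 (@measurable_pi_lambda _ _ _ (_) _ _ fun j => ?_)
    by_cases hj : j < n
    · simp only [hj, if_true]
      exact (comap_measurable (X j)).mono (le_iSup₂_of_le j hj le_rfl) le_rfl
    · simp only [hj, if_false]
      exact measurable_const

theorem map_signs_shift [IsProbabilityMeasure P] {X : ℕ → Ω → ℤ} (hX : ∀ j, Measurable (X j))
    (h : iIndepFun X P)
    (h1 : ∀ j, P {ω | X j ω = 1} = 1 / 2) (h2 : ∀ j, P {ω | X j ω = -1} = 1 / 2) (n : ℕ) :
    P.map (fun ω j => X (n + j) ω) = P.map (fun ω j => X j ω) := by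
  rw [(iIndepFun_iff_map_fun_eq_infinitePi_map fun j => hX j).1 h,
    (iIndepFun_iff_map_fun_eq_infinitePi_map fun j => hX (n + j)).1
      (h.precomp (g := fun j => n + j) fun a b hab => by simpa using hab)]
  congr 1
  funext j
  rw [map_sign_eq (hX _) (h1 _) (h2 _), map_sign_eq (hX _) (h1 _) (h2 _)]

end Signs

/-! ### Path space -/

/-- The data of an order flow on one path. -/
abbrev RawPath := (ℝ≥0 → ℕ) × (ℕ → ℤ) × (Side → ℝ≥0 → ℕ)

/-- The regular paths of order flows. -/
abbrev Path := {z : RawPath // IsCounting z.1 ∧ ∀ σ, IsCounting (z.2.2 σ)}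

/-- The canonical order flow on path space. -/
def pathFlow : OrderFlow Path where
  moves t z := z.1.1 t
  X j z := z.1.2.1 j
  flow σ t z := z.1.2.2 σ t

/-- Path space contains regular paths only, because measurability of executions uses
right-continuity of every path. Functionals of the canonical flow are then measurable, and
statements about laws and independence of paths carry over to them by composition. -/
theorem pathFlow_regular : pathFlow.Regular := ⟨fun z => z.2.1, fun σ z => z.2.2 σ⟩

/-- Measurability of an order flow. -/
structure OrderFlow.Meas {Ω : Type*} [MeasurableSpace Ω] (F : OrderFlow Ω) : Prop where
  moves : ∀ t, Measurable (F.moves t)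
  X : ∀ j, Measurable (F.X j)
  flow : ∀ σ t, Measurable (F.flow σ t)

theorem pathFlow_meas : pathFlow.Meas where
  moves t := (measurable_pi_apply t).comp (measurable_fst.comp measurable_subtype_coe)
  X j := (measurable_pi_apply j).comp
    (measurable_fst.comp (measurable_snd.comp measurable_subtype_coe))
  flow σ t := (measurable_pi_apply t).comp ((measurable_pi_apply σ).comp
    (measurable_snd.comp (measurable_snd.comp measurable_subtype_coe)))

section PathMap

variable {Ω : Type*} {F : OrderFlow Ω}

/-- The data of an order flow on the path `ω`. -/
def OrderFlow.raw (F : OrderFlow Ω) (ω : Ω) : RawPath :=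
  (fun t => F.moves t ω, fun j => F.X j ω, fun σ t => F.flow σ t ω)

/-- The path of a regular order flow. -/
def OrderFlow.Regular.path (hF : F.Regular) (ω : Ω) : Path :=
  ⟨F.raw ω, hF.moves ω, fun σ => hF.flow σ ω⟩

variable [mΩ : MeasurableSpace Ω]

theorem OrderFlow.Meas.measurable_raw (hM : F.Meas) : Measurable F.raw :=
  (measurable_pi_lambda _ hM.moves).prodMk ((measurable_pi_lambda _ hM.X).prodMk
    (measurable_pi_lambda _ fun σ => measurable_pi_lambda _ (hM.flow σ)))

theorem OrderFlow.Meas.measurable_path (hM : F.Meas) (hF : F.Regular) : Measurable hF.path :=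
  hM.measurable_raw.subtype_mk

theorem OrderFlow.Meas.shift (hM : F.Meas) (T : ℝ≥0) : (F.shift T).Meas where
  moves _ := (hM.moves _).sub (hM.moves _)
  X j := by
    -- The index of the price move is random, but it takes countably many values.
    have : Measurable fun p : ℕ × Ω => F.X (p.1 + j) p.2 :=
      measurable_from_prod_countable_right fun n => hM.X (n + j)
    exact this.comp ((hM.moves T).prodMk measurable_id)
  flow σ _ := (hM.flow σ _).sub (hM.flow σ _)

theorem OrderFlow.Meas.stopAt (hM : F.Meas) (T : ℝ≥0) : (F.stopAt T).Meas where
  moves _ := hM.moves _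
  X j := Measurable.ite ((hM.moves T) (measurableSet_Ioi (a := j))) (hM.X j) measurable_const
  flow σ _ := hM.flow σ _

end PathMap

/-! ### The Markov property of the order flow -/

section Market

variable {Ω : Type*} [mΩ : MeasurableSpace Ω] {F : OrderFlow Ω} {m : Params} {P : Measure Ω}

theorem OrderFlow.IsMarket.regular (h : F.IsMarket m P) : F.Regular where
  moves ω := h.moves.isCounting ω
  flow σ ω := by
    cases σ
    · exact h.askFlow.isCounting ω
    · exact h.bidFlow.isCounting ω

theorem OrderFlow.IsMarket.meas (h : F.IsMarket m P) : F.Meas where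
  moves := h.moves.measurable
  X := h.X_measurable
  flow σ := by
    cases σ
    · exact h.askFlow.measurable
    · exact h.bidFlow.measurable

/-- The data of a path, from the four independent components. -/
def toRaw (z : (ℝ≥0 → ℕ) × (ℕ → ℤ) × (ℝ≥0 → ℕ) × (ℝ≥0 → ℕ)) : RawPath :=
  (z.1, z.2.1, fun σ => match σ with
    | .ask => z.2.2.1
    | .bid => z.2.2.2)

theorem measurable_toRaw : Measurable toRaw := by
  refine measurable_fst.prodMk ((measurable_fst.comp measurable_snd).prodMk
    (measurable_pi_lambda _ fun σ => ?_))
  cases σ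
  · exact measurable_fst.comp (measurable_snd.comp measurable_snd)
  · exact measurable_snd.comp (measurable_snd.comp measurable_snd)

theorem raw_eq_toRaw {Ω : Type*} (F : OrderFlow Ω) : F.raw = fun ω =>
    toRaw (fun t => F.moves t ω, fun j => F.X j ω, fun t => F.flow .ask t ω,
      fun t => F.flow .bid t ω) := by
  funext ω
  refine Prod.ext rfl (Prod.ext rfl (funext fun σ => ?_))
  cases σ <;> rfl

theorem measurable_sigmaOf {Ω T E : Type*} [MeasurableSpace E] (Y : T → Ω → E) (t : T) :
    Measurable[sigmaOf Y] (Y t) :=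
  (comap_measurable (Y t)).mono (le_iSup (fun t => MeasurableSpace.comap (Y t) inferInstance) t) le_rfl

theorem comap_le_sigmaOf {Ω T T' E E' : Type*} [MeasurableSpace E] [MeasurableSpace E']
    {Y : T → Ω → E} {f : Ω → T' → E'} (h : ∀ t, Measurable[sigmaOf Y] fun ω => f ω t) :
    MeasurableSpace.comap f inferInstance ≤ sigmaOf Y :=
  measurable_iff_comap_le.1 (@measurable_pi_lambda _ _ _ (_) _ _ h)

variable [IsProbabilityMeasure P]

/-- For a fixed number `n` of mid-price moves until `T`, the order flow until `T`. -/
def pastRaw (F : OrderFlow Ω) (T : ℝ≥0) (n : ℕ) (ω : Ω) : RawPath :=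
  toRaw (fun u => F.moves (min u T) ω, fun j => if j < n then F.X j ω else 0,
    fun u => F.flow .ask (min u T) ω, fun u => F.flow .bid (min u T) ω)

/-- For a fixed number `n` of mid-price moves until `T`, the order flow after `T`. -/
def futureRaw (F : OrderFlow Ω) (T : ℝ≥0) (n : ℕ) (ω : Ω) : RawPath :=
  toRaw (fun u => F.moves (T + u) ω - F.moves T ω, fun j => F.X (n + j) ω,
    fun u => F.flow .ask (T + u) ω - F.flow .ask T ω,
    fun u => F.flow .bid (T + u) ω - F.flow .bid T ω)

/-- With the number of price moves fixed at `n`, each of the four independent components splits into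
an independent past and future, and `indep_iSup_iSup` joins them. The law of the future is the image
of a product of four laws, each of them invariant under the shift. -/
theorem indepFun_pastRaw_futureRaw (h : F.IsMarket m P) (T : ℝ≥0) (n : ℕ) :
    IndepFun (pastRaw F T n) (futureRaw F T n) P ∧
      P.map (futureRaw F T n) = P.map F.raw := by
  have hM := h.meas
  set fM : Ω → ℝ≥0 → ℕ := fun ω u => F.moves (T + u) ω - F.moves T ω with hfM
  set fX : Ω → ℕ → ℤ := fun ω j => F.X (n + j) ω with hfX
  set fA : Ω → ℝ≥0 → ℕ := fun ω u => F.flow .ask (T + u) ω - F.flow .ask T ω with hfA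
  set fB : Ω → ℝ≥0 → ℕ := fun ω u => F.flow .bid (T + u) ω - F.flow .bid T ω with hfB
  set pM : Ω → ℝ≥0 → ℕ := fun ω u => F.moves (min u T) ω with hpM
  set pX : Ω → ℕ → ℤ := fun ω j => if j < n then F.X j ω else 0 with hpX
  set pA : Ω → ℝ≥0 → ℕ := fun ω u => F.flow .ask (min u T) ω with hpA
  set pB : Ω → ℝ≥0 → ℕ := fun ω u => F.flow .bid (min u T) ω with hpB
  have mfM : Measurable fM := (h.moves.shift T).measurable_path
  have mfX : Measurable fX := measurable_pi_lambda _ fun j => hM.X _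
  have mfA : Measurable fA := (h.askFlow.shift T).measurable_path
  have mfB : Measurable fB := (h.bidFlow.shift T).measurable_path
  have hfuture : ∀ {R : ℝ≥0 → Ω → ℕ},
      MeasurableSpace.comap (fun ω u => R (T + u) ω - R T ω) inferInstance ≤ sigmaOf R :=
    fun {R} => comap_le_sigmaOf fun u =>
      (measurable_sigmaOf R (T + u)).sub (measurable_sigmaOf R T)
  have hpast : ∀ {R : ℝ≥0 → Ω → ℕ},
      MeasurableSpace.comap (fun ω u => R (min u T) ω) inferInstance ≤ sigmaOf R :=
    fun {R} => comap_le_sigmaOf fun u => measurable_sigmaOf R (min u T)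
  have hpastX : MeasurableSpace.comap pX inferInstance ≤ sigmaOf F.X := by
    refine comap_le_sigmaOf fun j => ?_
    by_cases hj : j < n
    · simp only [hpX, hj, if_true]
      exact measurable_sigmaOf F.X j
    · simp only [hpX, hj, if_false]
      exact measurable_const
  have hfutureX : MeasurableSpace.comap fX inferInstance ≤ sigmaOf F.X :=
    comap_le_sigmaOf fun j => measurable_sigmaOf F.X (n + j)
  have hsig : ∀ {T' E : Type} [MeasurableSpace E] {R : T' → Ω → E}, (∀ t, Measurable (R t)) →
      sigmaOf R ≤ mΩ := fun hR => iSup_le fun t => (hR t).comap_le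
  have hind := indep_iSup_iSup h.indep
    (A := ![MeasurableSpace.comap pM inferInstance, MeasurableSpace.comap pX inferInstance,
      MeasurableSpace.comap pA inferInstance, MeasurableSpace.comap pB inferInstance])
    (B := ![MeasurableSpace.comap fM inferInstance, MeasurableSpace.comap fX inferInstance,
      MeasurableSpace.comap fA inferInstance, MeasurableSpace.comap fB inferInstance])
    (by
      intro i
      fin_cases i
      exacts [hsig hM.moves, hsig hM.X, hsig (hM.flow .ask), hsig (hM.flow .bid)])
    (by
      intro i
      fin_cases i
      exacts [hpast, hpastX, hpast, hpast])
    (by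
      intro i
      fin_cases i
      exacts [hfuture, hfutureX, hfuture, hfuture])
    (by
      intro i
      fin_cases i
      exacts [(IndepFun_iff_Indep _ _ _).1 (h.moves.indepFun_stopAt_shift T),
        (IndepFun_iff_Indep _ _ _).1 (indepFun_signs hM.X h.X_indep n),
        (IndepFun_iff_Indep _ _ _).1 (h.askFlow.indepFun_stopAt_shift T),
        (IndepFun_iff_Indep _ _ _).1 (h.bidFlow.indepFun_stopAt_shift T)])
  have hquad : ∀ {f₁ : Ω → ℝ≥0 → ℕ} {f₂ : Ω → ℕ → ℤ} {f₃ f₄ : Ω → ℝ≥0 → ℕ}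
      {C : MeasurableSpace Ω}, MeasurableSpace.comap f₁ inferInstance ≤ C →
      MeasurableSpace.comap f₂ inferInstance ≤ C → MeasurableSpace.comap f₃ inferInstance ≤ C →
      MeasurableSpace.comap f₄ inferInstance ≤ C →
      MeasurableSpace.comap (fun ω => toRaw (f₁ ω, f₂ ω, f₃ ω, f₄ ω)) inferInstance ≤ C := by
    intro f₁ f₂ f₃ f₄ C h₁ h₂ h₃ h₄
    rw [← measurable_iff_comap_le] at h₁ h₂ h₃ h₄ ⊢
    exact measurable_toRaw.comp (h₁.prodMk (h₂.prodMk (h₃.prodMk h₄)))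
  constructor
  · rw [IndepFun_iff_Indep]
    refine indep_of_indep_of_le_left (indep_of_indep_of_le_right hind ?_) ?_
    · exact hquad (le_iSup_of_le 0 le_rfl) (le_iSup_of_le 1 le_rfl) (le_iSup_of_le 2 le_rfl)
        (le_iSup_of_le 3 le_rfl)
    · exact hquad (le_iSup_of_le 0 le_rfl) (le_iSup_of_le 1 le_rfl) (le_iSup_of_le 2 le_rfl)
        (le_iSup_of_le 3 le_rfl)
  · have hlaw : ∀ {f₁ : Ω → ℝ≥0 → ℕ} {f₂ : Ω → ℕ → ℤ} {f₃ f₄ : Ω → ℝ≥0 → ℕ},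
        Measurable f₁ → Measurable f₂ → Measurable f₃ → Measurable f₄ →
        MeasurableSpace.comap f₁ inferInstance ≤ sigmaOf F.moves →
        MeasurableSpace.comap f₂ inferInstance ≤ sigmaOf F.X →
        MeasurableSpace.comap f₃ inferInstance ≤ sigmaOf (F.flow .ask) →
        MeasurableSpace.comap f₄ inferInstance ≤ sigmaOf (F.flow .bid) →
        P.map (fun ω => toRaw (f₁ ω, f₂ ω, f₃ ω, f₄ ω)) =
          ((P.map f₁).prod ((P.map f₂).prod ((P.map f₃).prod (P.map f₄)))).map toRaw := by
      intro f₁ f₂ f₃ f₄ h₁ h₂ h₃ h₄ l₁ l₂ l₃ l₄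
      rw [← map_quadruple h₁ h₂ h₃ h₄, Measure.map_map measurable_toRaw (by fun_prop)]
      · rfl
      · rw [iIndep_iff]
        intro s f hf
        refine (iIndep_iff _ _).1 h.indep s fun i hi => ?_
        have := hf i hi
        fin_cases i
        exacts [l₁ _ this, l₂ _ this, l₃ _ this, l₄ _ this]
    rw [raw_eq_toRaw F, hlaw h.moves.measurable_path (measurable_pi_lambda _ hM.X)
      h.askFlow.measurable_path h.bidFlow.measurable_path
      (comap_le_sigmaOf (measurable_sigmaOf F.moves)) (comap_le_sigmaOf (measurable_sigmaOf F.X))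
      (comap_le_sigmaOf (measurable_sigmaOf (F.flow .ask)))
      (comap_le_sigmaOf (measurable_sigmaOf (F.flow .bid)))]
    refine (hlaw mfM mfX mfA mfB hfuture hfutureX hfuture hfuture).trans ?_
    rw [(h.moves.shift T).map_eq h.moves, (h.askFlow.shift T).map_eq h.askFlow,
      (h.bidFlow.shift T).map_eq h.bidFlow,
      map_signs_shift hM.X h.X_indep h.X_up h.X_down n]

/-- The shifted flow starts its price moves at a random index. The probability is decomposed
according to the number `n` of moves until `T`: this number is known from the past, for fixed `n`
past and future are independent, and the law of the future does not depend on `n`, so the sum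
factorizes. -/
theorem measure_stopAt_inter_shift (h : F.IsMarket m P) (T : ℝ≥0) {a b : Set RawPath}
    (ha : MeasurableSet a) (hb : MeasurableSet b) :
    P ((F.stopAt T).raw ⁻¹' a ∩ (F.shift T).raw ⁻¹' b) =
      P ((F.stopAt T).raw ⁻¹' a) * P (F.raw ⁻¹' b) := by
  have hM := h.meas
  set A := (F.stopAt T).raw ⁻¹' a
  set B := (F.shift T).raw ⁻¹' b
  have mA : MeasurableSet A := (hM.stopAt T).measurable_raw ha
  have mB : MeasurableSet B := (hM.shift T).measurable_raw hb
  have hsplit : ∀ C : Set Ω, MeasurableSet C → P C = ∑' n, P (C ∩ F.moves T ⁻¹' {n}) := by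
    intro C hC
    rw [← measure_iUnion]
    · rw [← Set.inter_iUnion, ← Set.preimage_iUnion, Set.iUnion_of_singleton, Set.preimage_univ,
        Set.inter_univ]
    · intro i j hij
      refine Set.disjoint_left.2 fun ω h1 h2 => hij ?_
      exact (h1.2 : F.moves T ω = i).symm.trans h2.2
    · exact fun n => hC.inter (hM.moves T (measurableSet_singleton n))
  rw [hsplit (A ∩ B) (mA.inter mB), hsplit A mA, ← ENNReal.tsum_mul_right]
  congr 1
  funext n
  obtain ⟨hind, hlaw⟩ := indepFun_pastRaw_futureRaw h T n
  have hpast : A ∩ F.moves T ⁻¹' {n} = pastRaw F T n ⁻¹' (a ∩ {z | z.1 T = n}) := by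
    ext ω
    have h1 : F.moves T ω = n → (F.stopAt T).raw ω = pastRaw F T n ω := by
      rintro rfl
      rw [raw_eq_toRaw]; rfl
    have h2 : (pastRaw F T n ω).1 T = F.moves T ω := by simp [pastRaw, toRaw]
    simp only [A, Set.mem_inter_iff, Set.mem_preimage, Set.mem_singleton_iff]
    change _ ↔ _ ∧ (pastRaw F T n ω).1 T = n
    rw [h2]
    exact and_congr_left fun hn => by rw [h1 hn]
  have hfut : A ∩ B ∩ F.moves T ⁻¹' {n} =
      pastRaw F T n ⁻¹' (a ∩ {z | z.1 T = n}) ∩ futureRaw F T n ⁻¹' b := by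
    rw [← hpast]
    ext ω
    have h1 : F.moves T ω = n → (F.shift T).raw ω = futureRaw F T n ω := by
      rintro rfl
      rw [raw_eq_toRaw]; rfl
    simp only [B, Set.mem_inter_iff, Set.mem_preimage, Set.mem_singleton_iff]
    constructor
    · rintro ⟨⟨hA, hB⟩, hn⟩
      exact ⟨⟨hA, hn⟩, h1 hn ▸ hB⟩
    · rintro ⟨⟨hA, hn⟩, hB⟩
      exact ⟨⟨hA, (h1 hn).symm ▸ hB⟩, hn⟩
  have ma' : MeasurableSet (a ∩ {z : RawPath | z.1 T = n}) :=
    ha.inter (measurableSet_eq_fun ((measurable_pi_apply T).comp measurable_fst) measurable_const)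
  rw [hfut, hpast, hind.measure_inter_preimage_eq_mul _ _ ma' hb]
  congr 1
  have mfut : Measurable (futureRaw F T n) :=
    measurable_toRaw.comp ((h.moves.shift T).measurable_path.prodMk
      ((measurable_pi_lambda _ fun j => hM.X (n + j)).prodMk
        ((h.askFlow.shift T).measurable_path.prodMk (h.bidFlow.shift T).measurable_path)))
  rw [← Measure.map_apply mfut hb, hlaw, Measure.map_apply hM.measurable_raw hb]

/-- The order flow after time `T` has the law of the order flow from time zero. -/
theorem map_path_shift (h : F.IsMarket m P) (T : ℝ≥0) :
    P.map (h.regular.shift T).path = P.map h.regular.path := by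
  refine Measure.ext fun s hs => ?_
  obtain ⟨b, hb, rfl⟩ := hs
  rw [Measure.map_apply ((h.meas.shift T).measurable_path _) (measurable_subtype_coe hb),
    Measure.map_apply (h.meas.measurable_path _) (measurable_subtype_coe hb)]
  -- A trivial past isolates the law of the future.
  have := measure_stopAt_inter_shift h T MeasurableSet.univ hb
  simp only [Set.preimage_univ, Set.univ_inter, measure_univ, one_mul] at this
  exact this

/-- The order flow after time `T` is independent of the order flow until `T`. -/
theorem indepFun_path (h : F.IsMarket m P) (T : ℝ≥0) :
    IndepFun (h.regular.stopAt T).path (h.regular.shift T).path P := by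
  rw [indepFun_iff_measure_inter_preimage_eq_mul]
  rintro s t ⟨a, ha, rfl⟩ ⟨b, hb, rfl⟩
  have h1 := measure_stopAt_inter_shift h T ha hb
  have h2 := measure_stopAt_inter_shift h T MeasurableSet.univ hb
  simp only [Set.preimage_univ, Set.univ_inter, measure_univ, one_mul] at h2
  rw [← h2] at h1
  exact h1

end Market

/-! ### Measurability of executions -/

/-- The points of an equidistant partition of `[a, b]`. -/
def grid (a b : ℝ≥0) (n j : ℕ) : ℝ≥0 := a + j * ((b - a) / (n + 1))

theorem grid_zero (a b : ℝ≥0) (n : ℕ) : grid a b n 0 = a := by simp [grid]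

theorem grid_succ (a b : ℝ≥0) (n j : ℕ) :
    grid a b n (j + 1) = grid a b n j + (b - a) / (n + 1) := by
  simp only [grid, Nat.cast_add, Nat.cast_one]; ring

theorem grid_last {a b : ℝ≥0} (h : a ≤ b) (n : ℕ) : grid a b n (n + 1) = b := by
  have : ((n : ℝ≥0) + 1) ≠ 0 := by positivity
  rw [grid, Nat.cast_add, Nat.cast_one, mul_div_cancel₀ _ this, add_tsub_cancel_of_le h]

theorem grid_mono (a b : ℝ≥0) (n : ℕ) : Monotone (grid a b n) := fun i j h => by
  unfold grid; gcongr

theorem exists_grid {a b u : ℝ≥0} (hu : u ∈ Set.Ioc a b) (n : ℕ) :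
    ∃ j < n + 1, grid a b n j < u ∧ u ≤ grid a b n (j + 1) ∧
      grid a b n (j + 1) ≤ u + (b - a) / (n + 1) := by
  classical
  have hex : ∃ k, u ≤ grid a b n k := ⟨n + 1, by rw [grid_last (hu.1.le.trans hu.2)]; exact hu.2⟩
  have hk := Nat.find_spec hex
  have hle : Nat.find hex ≤ n + 1 :=
    Nat.find_le (by rw [grid_last (hu.1.le.trans hu.2)]; exact hu.2)
  obtain ⟨j, hj⟩ : ∃ j, Nat.find hex = j + 1 := by
    refine Nat.exists_eq_succ_of_ne_zero fun h0 => ?_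
    rw [h0, grid_zero] at hk
    exact absurd hu.1 (not_lt.2 hk)
  have hlt : grid a b n j < u := not_le.1 (Nat.find_min hex (by omega))
  rw [hj] at hk hle
  refine ⟨j, by omega, hlt, hk, ?_⟩
  rw [grid_succ]
  gcongr

/-- The right end points of the grid intervals containing `u` approach `u` from the right, where a
property that holds on a right neighbourhood of `u` applies. -/
theorem eventually_grid {Q : ℝ≥0 → Prop} {u : ℝ≥0} (hQ : ∀ᶠ v in 𝓝[≥] u, Q v) (c : ℝ≥0) :
    ∃ M : ℕ, ∀ n ≥ M, ∀ v, u ≤ v → v ≤ u + c / (n + 1) → Q v := by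
  obtain ⟨w, hw, hQw⟩ := mem_nhdsGE_iff_exists_Ico_subset.1 hQ
  have hlim : Tendsto (fun n : ℕ => u + c / ((n : ℝ≥0) + 1)) atTop (𝓝 u) := by
    have h1 : Tendsto (fun n : ℕ => c / (n : ℝ≥0)) atTop (𝓝 0) :=
      tendsto_const_div_atTop_nhds_zero_nat c
    have h2 := (tendsto_const_nhds (x := u)).add ((tendsto_add_atTop_iff_nat 1).2 h1)
    simpa using h2
  obtain ⟨M, hM⟩ := eventually_atTop.1 (hlim.eventually (gt_mem_nhds (Set.mem_Ioi.1 hw)))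
  exact ⟨M, fun n hn v h1 h2 => hQw ⟨h1, h2.trans_lt (hM n hn)⟩⟩

section Grid

variable {Ω : Type*} {F : OrderFlow Ω}

theorem eventually_dp_eq (hF : F.Regular) (t₀ u : ℝ≥0) (ω : Ω) :
    ∀ᶠ v in 𝓝[≥] u, F.dp t₀ v ω = F.dp t₀ u ω := by
  filter_upwards [(hF.moves ω).eventually_eq u] with v hv
  simp only [OrderFlow.dp, OrderFlow.mid, hv]

/-- If a counting process increases in arbitrarily fine grid intervals from the same level, then
it jumps in one of them. -/
theorem exists_jump {y : ℝ≥0 → ℕ} (hy : IsCounting y) {k : ℕ} {a b : ℝ≥0} (ha : y a = k)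
    (hb : k < y b) : ∃ u, a < u ∧ u ≤ b ∧ k < y u ∧ ∀ s < u, y s ≤ k := by
  -- The jump time is the infimum of the times above level `k`; by right-continuity it belongs to
  -- this set.
  set S := {t : ℝ≥0 | k < y t} with hS
  have hbS : b ∈ S := hb
  have hbdd : BddBelow S := OrderBot.bddBelow S
  have hmem : k < y (sInf S) := by
    by_contra hcon
    obtain ⟨w, hw, hQ⟩ := mem_nhdsGE_iff_exists_Ico_subset.1
      (hy.eventually_eq (sInf S))
    obtain ⟨t, htS, htw⟩ := exists_lt_of_csInf_lt ⟨b, hbS⟩ (Set.mem_Ioi.1 hw)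
    have : y t = y (sInf S) := hQ ⟨csInf_le hbdd htS, htw⟩
    have h2 : k < y t := htS
    omega
  refine ⟨sInf S, ?_, csInf_le hbdd hbS, hmem, fun s hs => ?_⟩
  · by_contra! hle
    have := hy.mono hle
    omega
  · by_contra! hlt
    exact absurd hs (not_lt.2 (csInf_le hbdd hlt))

/-- Executions can be read off from the order flow at countably many times. -/
theorem filled_iff_grid (hF : F.Regular) (σ : Side) (t₀ a b : ℝ≥0) (x : EInt) (ω : Ω) :
    F.Filled σ t₀ a b x ω ↔ x < ((σ.sgn * F.dp t₀ a ω : ℤ) : EInt) ∨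
      (∃ n j, j < n + 1 ∧ x < ((σ.sgn * F.dp t₀ (grid a b n (j + 1)) ω : ℤ) : EInt)) ∨
      ∃ M, ∀ n ≥ M, ∃ j < n + 1, F.flow σ (grid a b n j) ω < F.flow σ (grid a b n (j + 1)) ω ∧
        x = ((σ.sgn * F.dp t₀ (grid a b n (j + 1)) ω : ℤ) : EInt) := by
  have hfl := hF.flow σ ω
  rcases le_or_gt b a with hba | hab
  · have hg : ∀ n j, grid a b n j = a := fun n j => by simp [grid, tsub_eq_zero_of_le hba]
    simp only [hg, lt_irrefl, false_and, and_false, exists_false]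
    constructor
    · rintro (h | ⟨u, hu, -⟩)
      · exact Or.inl h
      · exact absurd (hu.1.trans_le hu.2) (not_lt.2 hba)
    · rintro (h | ⟨n, j, -, h⟩ | ⟨M, h⟩)
      · exact Or.inl h
      · exact Or.inl h
      · exact absurd (h M le_rfl) (by simp)
  constructor
  · rintro (h | ⟨u, hu, h | ⟨harr, h⟩⟩)
    · exact Or.inl h
    · obtain ⟨M, hM⟩ := eventually_grid (eventually_dp_eq hF t₀ u ω) (b - a)
      obtain ⟨j, hj, -, h1, h2⟩ := exists_grid hu M
      refine Or.inr (Or.inl ⟨M, j, hj, ?_⟩)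
      rwa [hM M le_rfl _ h1 h2]
    -- Unlike a crossing, an arrival must be recorded on all fine grids: a single interval with an
    -- arrival does not determine the price at the arrival time.
    · obtain ⟨M, hM⟩ := eventually_grid (eventually_dp_eq hF t₀ u ω) (b - a)
      refine Or.inr (Or.inr ⟨M, fun n hn => ?_⟩)
      obtain ⟨j, hj, h0, h1, h2⟩ := exists_grid hu n
      refine ⟨j, hj, (harr.2 _ h0).trans_le (hfl.mono h1), ?_⟩
      rwa [hM n hn _ h1 h2]
  · rintro (h | ⟨n, j, hj, h⟩ | ⟨M, h⟩)
    · exact Or.inl h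
    · refine Or.inr ⟨grid a b n (j + 1), ⟨?_, ?_⟩, Or.inl h⟩
      · have : 0 < (b - a) / ((n : ℝ≥0) + 1) := div_pos (tsub_pos_of_lt hab) (by positivity)
        rw [grid_succ]
        calc a = grid a b n 0 := (grid_zero a b n).symm
          _ ≤ grid a b n j := grid_mono a b n (Nat.zero_le j)
          _ < _ := lt_add_of_pos_right _ this
      · exact (grid_mono a b n (Nat.succ_le_of_lt hj)).trans (grid_last hab.le n).le
    · choose! j hj hlt hx using h
      have hab' : ∀ n i, i ≤ n + 1 → a ≤ grid a b n i ∧ grid a b n i ≤ b := by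
        intro n i hi
        constructor
        · calc a = grid a b n 0 := (grid_zero a b n).symm
            _ ≤ _ := grid_mono a b n (Nat.zero_le i)
        · exact (grid_mono a b n hi).trans (grid_last hab.le n).le
      -- a level from which the flow increases infinitely often
      have hlev : ∃ k, ∃ᶠ n in atTop, F.flow σ (grid a b n (j n)) ω = k := by
        by_contra! hcon
        have hall : ∀ᶠ n in atTop, ∀ k ∈ Finset.range (F.flow σ b ω + 1),
            F.flow σ (grid a b n (j n)) ω ≠ k := by
          rw [Finset.eventually_all]
          exact fun k _ => hcon k
        obtain ⟨n, hn, hnM⟩ := (hall.and (eventually_ge_atTop M)).exists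
        refine hn _ (Finset.mem_range.2 ?_) rfl
        have := hfl.mono (hab' n (j n) (by have := hj n hnM; omega)).2
        exact Nat.lt_succ_of_le this
      obtain ⟨k, hk⟩ := hlev
      obtain ⟨n₀, hn₀, hn₀M⟩ := (hk.and_eventually (eventually_ge_atTop M)).exists
      obtain ⟨u, -, -, hku, hlow⟩ := exists_jump hfl hn₀
        (by have := hlt n₀ hn₀M; simp only [hn₀] at this; exact this)
      -- Every recorded interval on which the flow starts from level `k` contains the first time `u`
      -- above this level. As the grid is refined, the right end points therefore approach `u` from
      -- the right, and the price there is the price at `u`.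
      have hloc : ∀ n ≥ M, F.flow σ (grid a b n (j n)) ω = k →
          grid a b n (j n) < u ∧ u ≤ grid a b n (j n + 1) := by
        intro n hn hnk
        constructor
        · by_contra! hle
          have h1 : F.flow σ u ω ≤ F.flow σ (grid a b n (j n)) ω := hfl.mono hle
          omega
        · by_contra! hlt'
          have h1 := hlow _ hlt'
          have h2 := hlt n hn
          omega
      obtain ⟨M', hM'⟩ := eventually_grid (eventually_dp_eq hF t₀ u ω) (b - a)
      obtain ⟨n, ⟨hnk, hnM⟩, hnM'⟩ := ((hk.and_eventually (eventually_ge_atTop M)).and_eventually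
        (eventually_ge_atTop M')).exists
      obtain ⟨h1, h2⟩ := hloc n hnM hnk
      have h3 := hab' n (j n) (by have := hj n hnM; omega)
      have h4 := hab' n (j n + 1) (by have := hj n hnM; omega)
      refine Or.inr ⟨u, ⟨h3.1.trans_lt h1, h2.trans h4.2⟩, Or.inr ⟨⟨zero_le.trans_lt h1,
        fun s hs => (hlow s hs).trans_lt hku⟩, ?_⟩⟩
      rw [hx n hnM, hM' n hnM' _ h2]
      rw [grid_succ]
      gcongr

variable [MeasurableSpace Ω]

instance instMeasurableSpaceEInt : MeasurableSpace EInt := ⊤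

instance instDiscreteMeasurableSpaceEInt : DiscreteMeasurableSpace EInt := ⟨fun _ => trivial⟩

/-- States form a countable set. With the discrete sigma-algebra every policy and every function of
the state is measurable. -/
instance instMeasurableSpaceState : MeasurableSpace State := ⊤

instance instDiscreteMeasurableSpaceState : DiscreteMeasurableSpace State := ⟨fun _ => trivial⟩

/-- The components of a state. -/
def stateEquiv : State ≃ ℚ × ℤ × ℤ × EInt × EInt where
  toFun s := (s.w, s.p, s.q, s.rAsk, s.rBid)
  invFun z := ⟨z.1, z.2.1, z.2.2.1, z.2.2.2.1, z.2.2.2.2⟩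
  left_inv _ := rfl
  right_inv _ := rfl

instance instCountableState : Countable State := stateEquiv.injective.countable

theorem measurable_mid (hM : F.Meas) (t : ℝ≥0) : Measurable (F.mid t) := by
  have : Measurable fun p : ℕ × Ω => ∑ j ∈ Finset.range p.1, F.X j p.2 :=
    measurable_from_prod_countable_right fun n =>
      Finset.measurable_sum (Finset.range n) fun j _ => hM.X j
  exact this.comp ((hM.moves t).prodMk measurable_id)

theorem measurable_dp (hM : F.Meas) (a b : ℝ≥0) : Measurable (F.dp a b) :=
  (measurable_mid hM b).sub (measurable_mid hM a)

theorem measurableSet_filled (hF : F.Regular) (hM : F.Meas) (σ : Side) (t₀ a b : ℝ≥0) (x : EInt) :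
    MeasurableSet {ω | F.Filled σ t₀ a b x ω} := by
  have hdp : ∀ (p : ℤ → Prop) u, MeasurableSet {ω | p (F.dp t₀ u ω)} := fun p u =>
    measurable_dp hM t₀ u (MeasurableSet.of_discrete (s := {z | p z}))
  have hfl : ∀ u v, MeasurableSet {ω | F.flow σ u ω < F.flow σ v ω} := fun u v =>
    measurableSet_lt (hM.flow σ u) (hM.flow σ v)
  simp only [filled_iff_grid hF, measurableSet_setOfPred] at hdp hfl ⊢
  refine (hdp (fun z => x < ((σ.sgn * z : ℤ) : EInt)) a).or (Measurable.or ?_ ?_)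
  · exact Measurable.exists fun n => Measurable.exists fun j => measurable_const.and
      (hdp (fun z => x < ((σ.sgn * z : ℤ) : EInt)) _)
  · exact Measurable.exists fun M => Measurable.forall fun n => measurable_const.imp
      (Measurable.exists fun j => measurable_const.and ((hfl _ _).and
        (hdp (fun z => x = ((σ.sgn * z : ℤ) : EInt)) _)))

theorem measurable_ind {p : Ω → Prop} (hp : MeasurableSet {ω | p ω}) :
    Measurable fun ω => ind (p ω) := by
  classical
  have : (fun ω => ind (p ω)) = fun ω => if p ω then 1 else 0 := by
    funext ω; unfold ind; congr
  rw [this]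
  exact Measurable.ite hp measurable_const measurable_const

variable {m : Params}

theorem measurableSet_fillOut (hF : F.Regular) (hM : F.Meas) (σ : Side) (i : ℕ) (r : EInt) :
    MeasurableSet {ω | fillOut m F σ i r ω} := measurableSet_filled hF hM ..

theorem measurableSet_fillLate (hF : F.Regular) (hM : F.Meas) (σ : Side) (i : ℕ) (r : EInt)
    (a : Decision) : MeasurableSet {ω | fillLate m F σ i r a ω} := by
  cases a with
  | replace δ => exact measurableSet_filled hF hM ..
  | keep => exact (measurableSet_fillOut hF hM σ i r).compl.inter (measurableSet_filled hF hM ..)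

theorem measurable_nextQ (hF : F.Regular) (hM : F.Meas) (i : ℕ) (q : ℤ) (rA rB : EInt)
    (a : Decision × Decision) : Measurable (nextQ m F i q rA rB a) :=
  ((((measurable_const.sub (measurable_ind (measurableSet_fillOut hF hM ..))).add
    (measurable_ind (measurableSet_fillOut hF hM ..))).sub
    (measurable_ind (measurableSet_fillLate hF hM ..))).add
    (measurable_ind (measurableSet_fillLate hF hM ..)))

theorem measurable_nextR (hF : F.Regular) (hM : F.Meas) (σ : Side) (i : ℕ) (r : EInt)
    (a : Decision) : Measurable (nextR m F σ i r a) := by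
  have h : ∀ x : EInt, Measurable fun ω =>
      x + ((-(σ.sgn * F.dp (m.t i) (m.t (i + 1)) ω) : ℤ) : EInt) := fun x =>
    (Measurable.of_discrete (f := fun z : ℤ => x + ((-(σ.sgn * z) : ℤ) : EInt))).comp
      (measurable_dp hM (m.t i) (m.t (i + 1)))
  cases a with
  | replace δ => 
    exact Measurable.ite (measurableSet_fillLate hF hM σ i r (.replace δ)) measurable_const (h δ)
  | keep =>
    exact Measurable.ite ((measurableSet_fillOut hF hM σ i r).union
      (measurableSet_fillLate hF hM σ i r .keep)) measurable_const (h r)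

theorem measurable_priceLate (hM : F.Meas) (σ : Side) (i : ℕ) (p : ℤ) (r : EInt) (a : Decision) :
    Measurable (priceLate m F σ i p r a) := by
  cases a with
  | replace δ => 
    exact (Measurable.of_discrete (f := fun z : ℤ =>
      (p : ℚ) + σ.sgn * maxShift δ (1 / 2) (-1 / 2 + σ.sgn * z))).comp
      (measurable_dp hM (m.t i) (m.tPlus i))
  | keep => exact measurable_const

theorem measurable_intCast_rat : Measurable fun z : ℤ => (z : ℚ) := Measurable.of_discrete

theorem measurable_nextState (hF : F.Regular) (hM : F.Meas) (i : ℕ) (s : State)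
    (a : Decision × Decision) : Measurable (nextState m F i s a) := by
  have hind : ∀ {p : Ω → Prop}, MeasurableSet {ω | p ω} → Measurable fun ω => (ind (p ω) : ℚ) :=
    fun hp => measurable_intCast_rat.comp (measurable_ind hp)
  have h : Measurable fun ω => stateEquiv (nextState m F i s a ω) := by
    refine Measurable.prodMk ?_ (Measurable.prodMk ?_ (Measurable.prodMk ?_ (Measurable.prodMk ?_ ?_)))
    · exact (((measurable_const.add (measurable_const.mul
        (hind (measurableSet_fillOut hF hM ..)))).sub (measurable_const.mul
        (hind (measurableSet_fillOut hF hM ..)))).add ((measurable_priceLate hM ..).mul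
        (hind (measurableSet_fillLate hF hM ..)))).sub ((measurable_priceLate hM ..).mul
        (hind (measurableSet_fillLate hF hM ..)))
    · exact measurable_const.add (measurable_dp hM _ _)
    · exact measurable_nextQ hF hM ..
    · exact measurable_nextR hF hM ..
    · exact measurable_nextR hF hM ..
  have h2 : Measurable stateEquiv.symm := Measurable.of_discrete
  exact h2.comp h

theorem measurable_run (hF : F.Regular) (hM : F.Meas) (π : Policy) (i : ℕ) (s : State) :
    ∀ k, Measurable fun ω => run m F π i s ω k
  | 0 => measurable_const
  | k + 1 => by
    have h : Measurable fun z : State × Ω => nextState m F (i + k) z.1 (π (i + k) z.1) z.2 :=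
      measurable_from_prod_countable_right fun s =>
        measurable_nextState hF hM (i + k) s (π (i + k) s)
    exact h.comp ((measurable_run hF hM π i s k).prodMk measurable_id)

theorem measurable_finalValue (hF : F.Regular) (hM : F.Meas) (s : State) :
    Measurable (finalValue m F s) := by
  have h : Measurable fun z : ℤ × ℤ × ℤ =>
      ((s.w + priceOut .ask s.p s.rAsk * z.1 - priceOut .bid s.p s.rBid * z.2.1 : ℚ) : ℝ)
        + ((s.p + z.2.2 : ℤ) : ℝ) * ((s.q - z.1 + z.2.1 : ℤ) : ℝ)
        - 1 / 2 * |((s.q - z.1 + z.2.1 : ℤ) : ℝ)| := Measurable.of_discrete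
  have h2 := h.comp ((measurable_ind (measurableSet_fillOut (m := m) hF hM .ask 0 s.rAsk)).prodMk
    ((measurable_ind (measurableSet_fillOut (m := m) hF hM .bid 0 s.rBid)).prodMk
      (measurable_dp hM (m.t 0) (m.tPlus 0))))
  change Measurable fun ω => finalValue m F s ω
  simpa only [finalValue, Function.comp_def] using h2

theorem measurable_profit (hF : F.Regular) (hM : F.Meas) (σ : Side) (t₁ t₂ : ℝ≥0) (x : EInt) :
    Measurable (profit F σ t₁ t₂ x) := by
  have h1 := (Measurable.of_discrete (f := fun z : ℤ × ℤ =>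
    maxShift x (1 / 2 - σ.sgn * z.1) (-1 / 2) - σ.sgn * z.2)).comp
      ((measurable_dp hM 0 t₁).prodMk (measurable_dp hM t₁ (t₁ + t₂)))
  exact h1.mul (measurable_intCast_rat.comp (measurable_ind (measurableSet_filled hF hM ..)))

theorem measurable_ratCast_real : Measurable fun z : ℚ => (z : ℝ) := Measurable.of_discrete

theorem measurable_orderProfit (hF : F.Regular) (hM : F.Meas) (σ : Side) (t₁ t₂ : ℝ≥0)
    (x : EInt) : Measurable (orderProfit F σ t₁ t₂ x) :=
  measurable_ratCast_real.comp (measurable_profit hF hM ..)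

end Grid

/-! ### Expectations -/

section Freeze

variable {Ω S E : Type*} [MeasurableSpace Ω] {P : Measure Ω} [IsProbabilityMeasure P]
  [MeasurableSpace S] [MeasurableSpace E] [Countable S] [DiscreteMeasurableSpace S]

/-- Integration of a function of two independent random variables, the first of which is
discrete. -/
theorem integral_freeze {T : Ω → S} {Z : Ω → E} (hind : IndepFun T Z P) (hT : Measurable T)
    (hZ : Measurable Z) {f : S → E → ℝ} (hf : ∀ s, Measurable (f s))
    (hint : Integrable (fun ω => f (T ω) (Z ω)) P) :
    Integrable (fun ω => ∫ ω', f (T ω) (Z ω') ∂P) P ∧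
      ∫ ω, f (T ω) (Z ω) ∂P = ∫ ω, ∫ ω', f (T ω) (Z ω') ∂P ∂P := by
  have hF : Measurable fun z : S × E => f z.1 z.2 := measurable_from_prod_countable_right hf
  have hmap := (indepFun_iff_map_prod_eq_prod_map_map hT.aemeasurable hZ.aemeasurable).1 hind
  have hTZ : Measurable fun ω => (T ω, Z ω) := hT.prodMk hZ
  have hint' : Integrable (fun z : S × E => f z.1 z.2) ((P.map T).prod (P.map Z)) := by
    rw [← hmap, integrable_map_measure hF.aestronglyMeasurable hTZ.aemeasurable]
    exact hint
  have : IsProbabilityMeasure (P.map T) := Measure.isProbabilityMeasure_map hT.aemeasurable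
  have : IsProbabilityMeasure (P.map Z) := Measure.isProbabilityMeasure_map hZ.aemeasurable
  have hin : ∀ s, ∫ e, f s e ∂(P.map Z) = ∫ ω', f s (Z ω') ∂P := fun s =>
    integral_map hZ.aemeasurable (hf s).aestronglyMeasurable
  have h1 := hint'.integral_prod_left
  simp only [hin] at h1
  rw [integrable_map_measure (Measurable.of_discrete).aestronglyMeasurable hT.aemeasurable] at h1
  refine ⟨h1, ?_⟩
  have h2 := integral_prod _ hint'
  rw [← hmap, integral_map hTZ.aemeasurable hF.aestronglyMeasurable] at h2
  rw [h2]
  simp only [hin]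
  rw [integral_map hT.aemeasurable (Measurable.of_discrete).aestronglyMeasurable]

end Freeze

-- Moments of the price and of the profits

section Market

variable {Ω : Type*} [mΩ : MeasurableSpace Ω] {F : OrderFlow Ω} {m : Params} {P : Measure Ω}
  [IsProbabilityMeasure P]

theorem measurable_span (hM : F.Meas) (c : ℝ≥0) : Measurable (F.span c) := by
  have h1 : Measurable fun p : ℕ × Ω => ∑ j ∈ Finset.range p.1, |F.X j p.2| :=
    measurable_from_prod_countable_right fun n =>
      Finset.measurable_sum (Finset.range n) fun j _ =>
        (Measurable.of_discrete (f := fun z : ℤ => |z|)).comp (hM.X j)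
  have h2 : Measurable fun z : ℤ => 2 * z := Measurable.of_discrete
  have h3 := h2.comp (h1.comp ((hM.moves c).prodMk measurable_id))
  change Measurable fun ω => F.span c ω
  simpa only [OrderFlow.span, Function.comp_def, id] using h3

theorem measurable_intCast_real : Measurable fun z : ℤ => (z : ℝ) := Measurable.of_discrete

/-- Price moves almost surely have absolute value 1, so the variation is almost surely twice the
number of moves, which has a finite mean. -/
theorem integrable_span (h : F.IsMarket m P) (c : ℝ≥0) :
    Integrable (fun ω => (F.span c ω : ℝ)) P := by
  refine ((h.moves.integrable c).const_mul 2).mono'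
    (measurable_intCast_real.comp (measurable_span h.meas c)).aestronglyMeasurable ?_
  have hX : ∀ᵐ ω ∂P, ∀ j, F.X j ω = 1 ∨ F.X j ω = -1 :=
    ae_all_iff.2 fun j => ae_sign (h.X_measurable j) (h.X_up j) (h.X_down j)
  filter_upwards [hX] with ω hω
  have h1 : ∀ j, |F.X j ω| = 1 := fun j => by
    rcases hω j with h | h <;> rw [h] <;> rfl
  simp [OrderFlow.span, h1]

theorem integrable_dp (h : F.IsMarket m P) (a b : ℝ≥0) :
    Integrable (fun ω => (F.dp a b ω : ℝ)) P := by
  refine (integrable_span h (max a b)).mono'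
    (measurable_intCast_real.comp (measurable_dp h.meas a b)).aestronglyMeasurable
    (ae_of_all _ fun ω => ?_)
  have := abs_dp_le h.regular (le_max_left a b) (le_max_right a b) ω
  rw [Real.norm_eq_abs]
  exact_mod_cast this

theorem norm_orderProfit_le {Ω : Type*} {F : OrderFlow Ω} (hF : F.Regular)
    (σ : Side) (t₁ t₂ : ℝ≥0) (x : EInt) (ω : Ω) :
    ‖orderProfit F σ t₁ t₂ x ω‖ ≤ 3 * (F.span (t₁ + t₂) ω : ℝ) + 1 := by
  have := abs_profit_le hF σ t₁ t₂ x ω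
  rw [orderProfit_eq, Real.norm_eq_abs]
  exact_mod_cast this

theorem integrable_orderProfit_bound (h : F.IsMarket m P) (c : ℝ≥0) :
    Integrable (fun ω => 3 * (F.span c ω : ℝ) + 1) P :=
  ((integrable_span h c).const_mul 3).add (integrable_const 1)

theorem integrable_orderProfit (h : F.IsMarket m P) (σ : Side) (t₁ t₂ : ℝ≥0) (x : EInt) :
    Integrable (orderProfit F σ t₁ t₂ x) P :=
  (integrable_orderProfit_bound h (t₁ + t₂)).mono'
    (measurable_orderProfit h.regular h.meas ..).aestronglyMeasurable
    (ae_of_all _ (norm_orderProfit_le h.regular σ t₁ t₂ x))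

theorem integral_X (h : F.IsMarket m P) (j : ℕ) : ∫ ω, (F.X j ω : ℝ) ∂P = 0 := by
  have h1 := integral_map (μ := P) (h.X_measurable j).aemeasurable
    (measurable_intCast_real.aestronglyMeasurable)
  rw [← h1, map_sign_eq (h.X_measurable j) (h.X_up j) (h.X_down j), integral_add_measure,
    integral_smul_measure, integral_smul_measure, integral_dirac, integral_dirac]
  · simp
  · exact (integrable_dirac (by simp)).smul_measure (by simp)
  · exact (integrable_dirac (by simp)).smul_measure (by simp)

theorem integrable_X (h : F.IsMarket m P) (j : ℕ) : Integrable (fun ω => (F.X j ω : ℝ)) P := by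
  refine (integrable_const (1 : ℝ)).mono'
    (measurable_intCast_real.comp (h.X_measurable j)).aestronglyMeasurable ?_
  filter_upwards [ae_sign (h.X_measurable j) (h.X_up j) (h.X_down j)] with ω hω
  rcases hω with h | h <;> simp [h]

/-- The number of moves is independent of the moves themselves, so it can be frozen; the remaining
finite sum has mean zero. -/
theorem integral_mid (h : F.IsMarket m P) (t : ℝ≥0) : ∫ ω, (F.mid t ω : ℝ) ∂P = 0 := by
  have hind : IndepFun (F.moves t) (fun ω j => F.X j ω) P := by
    rw [IndepFun_iff_Indep]
    have h01 := h.indep.indep (show (0 : Fin 4) ≠ 1 by decide)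
    exact indep_of_indep_of_le_left (indep_of_indep_of_le_right h01
      (comap_le_sigmaOf (measurable_sigmaOf F.X))) (measurable_sigmaOf F.moves t).comap_le
  have hint : Integrable (fun ω => (F.mid t ω : ℝ)) P := by
    refine (integrable_dp h 0 t).congr (ae_of_all _ fun ω => ?_)
    simp [OrderFlow.dp, OrderFlow.mid, h.moves.zero]
  have hf : ∀ n : ℕ, Measurable fun x : ℕ → ℤ => ((∑ j ∈ Finset.range n, x j : ℤ) : ℝ) :=
    fun n => measurable_intCast_real.comp
      (Finset.measurable_sum (Finset.range n) fun j _ => measurable_pi_apply j)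
  have := (integral_freeze hind (h.moves.measurable t) (measurable_pi_lambda _ h.X_measurable)
    hf hint).2
  refine this.trans ?_
  have h0 : ∀ n : ℕ, ∫ ω, ((∑ j ∈ Finset.range n, F.X j ω : ℤ) : ℝ) ∂P = 0 := by
    intro n
    simp only [Int.cast_sum]
    rw [integral_finsetSum _ fun j _ => integrable_X h j]
    exact Finset.sum_eq_zero fun j _ => integral_X h j
  simp only [h0, integral_zero]

/-- The mid-price is a martingale: its increments have mean zero. -/
theorem integral_dp (h : F.IsMarket m P) (a b : ℝ≥0) : ∫ ω, (F.dp a b ω : ℝ) ∂P = 0 := by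
  have hint : ∀ t, Integrable (fun ω => (F.mid t ω : ℝ)) P := fun t => by
    refine (integrable_dp h 0 t).congr (ae_of_all _ fun ω => ?_)
    simp [OrderFlow.dp, OrderFlow.mid, h.moves.zero]
  simp only [OrderFlow.dp, Int.cast_sub]
  rw [integral_sub (hint b) (hint a), integral_mid h, integral_mid h, sub_zero]

/-- Expectations of functionals of the order flow do not change under time shifts. -/
theorem integral_shift (h : F.IsMarket m P) (T : ℝ≥0) {f : Path → ℝ} (hf : Measurable f) :
    ∫ ω, f ((h.regular.shift T).path ω) ∂P = ∫ ω, f (h.regular.path ω) ∂P := by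
  rw [← integral_map ((h.meas.shift T).measurable_path _).aemeasurable hf.aestronglyMeasurable,
    map_path_shift h T, integral_map (h.meas.measurable_path _).aemeasurable
      hf.aestronglyMeasurable]

theorem integrable_shift (h : F.IsMarket m P) (T : ℝ≥0) {f : Path → ℝ} (hf : Measurable f) :
    Integrable (fun ω => f ((h.regular.shift T).path ω)) P ↔
      Integrable (fun ω => f (h.regular.path ω)) P := by
  have h1 := integrable_map_measure (μ := P) hf.aestronglyMeasurable
    ((h.meas.shift T).measurable_path (h.regular.shift T)).aemeasurable
  have h2 := integrable_map_measure (μ := P) hf.aestronglyMeasurable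
    (h.meas.measurable_path h.regular).aemeasurable
  rw [map_path_shift h T] at h1
  exact h1.symm.trans h2

/-- The mid-price move after the first `dtau` is uncorrelated with executions before. -/
theorem integral_dp_mul_fillOut (h : F.IsMarket m P) (σ : Side) (r : EInt) :
    Integrable (fun ω => (F.dp m.dtau m.dt ω : ℝ) * ind (fillOut m F σ 0 r ω)) P ∧
      ∫ ω, (F.dp m.dtau m.dt ω : ℝ) * ind (fillOut m F σ 0 r ω) ∂P = 0 := by
  have hF := h.regular
  have hM := h.meas
  -- The price move is a functional of the flow after `dtau`, the fill is one of the flow until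
  -- `dtau`.
  have hdp : ∀ ω, F.dp m.dtau m.dt ω =
      pathFlow.dp 0 (m.dt - m.dtau) ((hF.shift m.dtau).path ω) := by
    intro ω
    have := dp_shift hF m.dtau 0 (m.dt - m.dtau) ω
    rw [add_zero, add_tsub_cancel_of_le m.latency_lt.le] at this
    exact this.symm
  have hfill : ∀ ω, ind (fillOut m F σ 0 r ω) =
      ind (fillOut m pathFlow σ 0 r ((hF.stopAt m.dtau).path ω)) := by
    intro ω
    congr 1
    refine propext (Iff.symm ?_)
    exact filled_stopAt hF σ (by rw [m.t_zero]; exact zero_le) (by rw [m.t_zero]; exact zero_le)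
      m.tPlus_zero.le r ω
  have hind := ((indepFun_path h m.dtau).comp
    (measurable_ind (measurableSet_fillOut (m := m) pathFlow_regular pathFlow_meas σ 0 r))
    (measurable_dp pathFlow_meas 0 (m.dt - m.dtau))).comp measurable_intCast_real
      measurable_intCast_real
  have hmul := hind.symm.integral_fun_mul_eq_mul_integral
    (measurable_intCast_real.comp ((measurable_dp pathFlow_meas 0 (m.dt - m.dtau)).comp
      ((hM.shift m.dtau).measurable_path _))).aestronglyMeasurable
    (measurable_intCast_real.comp ((measurable_ind (measurableSet_fillOut (m := m) pathFlow_regular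
      pathFlow_meas σ 0 r)).comp ((hM.stopAt m.dtau).measurable_path _))).aestronglyMeasurable
  simp only [Function.comp_def, ← hdp, ← hfill] at hmul
  constructor
  · refine (integrable_dp h m.dtau m.dt).norm.mono' 
      ((measurable_intCast_real.comp (measurable_dp hM _ _)).mul (measurable_intCast_real.comp
        (measurable_ind (measurableSet_fillOut hF hM ..)))).aestronglyMeasurable
      (ae_of_all _ fun ω => ?_)
    rw [norm_mul]
    refine mul_le_of_le_one_right (norm_nonneg _) ?_
    unfold ind
    split_ifs <;> simp
  · rw [hmul, integral_dp h, zero_mul]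

/-- The expected profit of one side in the first period. -/
theorem integral_periodProfit (h : F.IsMarket m P) (σ : Side) (r : EInt) (a : Decision) :
    Integrable (fun ω => (periodProfit F m σ r a ω : ℝ)) P ∧
      ∫ ω, (periodProfit F m σ r a ω : ℝ) ∂P = Hact m F P σ r a := by
  cases a with
  | keep => exact ⟨integrable_orderProfit h σ 0 m.dt r, rfl⟩
  | replace δ =>
    obtain ⟨h1, h2⟩ := integral_dp_mul_fillOut h σ r
    have e : (fun ω => (periodProfit F m σ r (.replace δ) ω : ℝ)) = fun ω =>
        orderProfit F σ 0 m.dtau r ω + orderProfit F σ m.dtau (m.dt - m.dtau) δ ω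
          - σ.sgn * ((F.dp m.dtau m.dt ω : ℝ) * ind (fillOut m F σ 0 r ω)) := by
      funext ω
      simp only [periodProfit, orderProfit_eq]
      push_cast
      ring
    have i1 := integrable_orderProfit h σ 0 m.dtau r
    have i2 := integrable_orderProfit h σ m.dtau (m.dt - m.dtau) δ
    rw [e]
    refine ⟨(i1.add i2).sub (h1.const_mul _), ?_⟩
    rw [integral_sub (f := fun ω => _ + _) (i1.add i2) (h1.const_mul _), integral_add i1 i2,
      integral_const_mul, h2,
      mul_zero, sub_zero]
    rfl

end Market

/-! ### One-step expectations -/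

section OneStep

variable {Ω : Type*} [mΩ : MeasurableSpace Ω] {F : OrderFlow Ω} {m : Params} {P : Measure Ω}
  [IsProbabilityMeasure P]

theorem measurable_next (hF : F.Regular) (hM : F.Meas) (h : ℤ → EInt → EInt → ℝ) (q : ℤ)
    (rA rB : EInt) (a : Decision × Decision) :
    Measurable fun ω => h (nextQ m F 0 q rA rB a ω) (nextR m F .ask 0 rA a.1 ω)
      (nextR m F .bid 0 rB a.2 ω) :=
  (Measurable.of_discrete (f := fun z : ℤ × EInt × EInt => h z.1 z.2.1 z.2.2)).comp
    ((measurable_nextQ hF hM 0 q rA rB a).prodMk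
      ((measurable_nextR hF hM .ask 0 rA a.1).prodMk (measurable_nextR hF hM .bid 0 rB a.2)))

/-- Conditional expectation of a separable function of the next state. -/
theorem integral_nextState (hF : F.IsMarket m P) (j : ℕ) {s : State} (hs : s ∈ m.S)
    (a : Decision × Decision) {h : ℤ → EInt → EInt → ℝ}
    (hint : Integrable (fun ω => h (nextQ m F 0 s.q s.rAsk s.rBid a ω)
      (nextR m F .ask 0 s.rAsk a.1 ω) (nextR m F .bid 0 s.rBid a.2 ω)) P)
    {V : State → ℝ} (hV : ∀ s, V s = (s.w : ℝ) + s.p * s.q + h s.q s.rAsk s.rBid) :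
    Integrable (fun ω => V (nextState m F j s a ω)) P ∧
      ∫ ω, V (nextState m F j s a ω) ∂P =
        (s.w : ℝ) + s.p * s.q + oneStep m F P h s.q s.rAsk s.rBid a := by
  have hm : Measurable fun z : Path => V (nextState m pathFlow 0 s a z) :=
    (Measurable.of_discrete (f := V)).comp
      (measurable_nextState pathFlow_regular pathFlow_meas 0 s a)
  -- As a functional of the shifted path, the transition at epoch `j` has the law of the transition
  -- at epoch zero.
  have e : ∀ ω, V (nextState m F j s a ω) =
      V (nextState m pathFlow 0 s a ((hF.regular.shift (m.t j)).path ω)) := fun ω =>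
    congrArg V (nextState_shift hF.regular j s a ω).symm
  simp only [e]
  rw [integral_shift hF (m.t j) hm, integrable_shift hF (m.t j) hm]
  have e2 : ∀ ω, V (nextState m pathFlow 0 s a (hF.regular.path ω)) =
      ((s.w : ℝ) + s.p * s.q) + s.q * (F.dp 0 m.dt ω : ℝ)
        + (periodProfit F m .ask s.rAsk a.1 ω : ℝ) + (periodProfit F m .bid s.rBid a.2 ω : ℝ)
        + h (nextQ m F 0 s.q s.rAsk s.rBid a ω) (nextR m F .ask 0 s.rAsk a.1 ω)
          (nextR m F .bid 0 s.rBid a.2 ω) := by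
    intro ω
    have h1 := wealth_next F m s hs a ω
    have h2 : V (nextState m F 0 s a ω) = _ := hV (nextState m F 0 s a ω)
    have h3 : ((nextState m F 0 s a ω).w : ℝ) + (nextState m F 0 s a ω).p *
        (nextState m F 0 s a ω).q = ((s.w : ℝ) + s.p * s.q) + s.q * (F.dp 0 m.dt ω : ℝ)
        + (periodProfit F m .ask s.rAsk a.1 ω : ℝ)
        + (periodProfit F m .bid s.rBid a.2 ω : ℝ) := by exact_mod_cast h1
    exact h2.trans (by rw [h3]; rfl)
  simp only [e2]
  obtain ⟨iA, jA⟩ := integral_periodProfit hF .ask s.rAsk a.1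
  obtain ⟨iB, jB⟩ := integral_periodProfit hF .bid s.rBid a.2
  have i0 : Integrable (fun _ : Ω => (s.w : ℝ) + s.p * s.q) P := integrable_const _
  have i1 := (integrable_dp hF 0 m.dt).const_mul (s.q : ℝ)
  have i01 : Integrable (fun ω => ((s.w : ℝ) + s.p * s.q) + s.q * (F.dp 0 m.dt ω : ℝ)) P :=
    i0.add i1
  have i02 : Integrable (fun ω => ((s.w : ℝ) + s.p * s.q) + s.q * (F.dp 0 m.dt ω : ℝ)
        + (periodProfit F m .ask s.rAsk a.1 ω : ℝ)) P := i01.add iA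
  have i03 : Integrable (fun ω => ((s.w : ℝ) + s.p * s.q) + s.q * (F.dp 0 m.dt ω : ℝ)
        + (periodProfit F m .ask s.rAsk a.1 ω : ℝ)
        + (periodProfit F m .bid s.rBid a.2 ω : ℝ)) P := i02.add iB
  refine ⟨i03.add hint, ?_⟩
  rw [integral_add i03 hint, integral_add i02 iB, integral_add i01 iA, integral_add i0 i1,
    integral_const_mul, integral_dp hF, jA, jB]
  simp only [integral_const, probReal_univ, one_smul, mul_zero, add_zero, oneStep]
  ring

/-- Conditional expectation of the terminal wealth given the state at epoch `N`. -/
theorem integral_finalState (hF : F.IsMarket m P) {s : State} (hs : s ∈ m.S) :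
    ∫ ω, vFinal (finalState m F s ω) ∂P =
      (s.w : ℝ) + s.p * s.q + gLast m F P s.q s.rAsk s.rBid := by
  have hm := measurable_finalValue (m := m) pathFlow_regular pathFlow_meas s
  have e : ∀ ω, vFinal (finalState m F s ω) =
      finalValue m pathFlow s ((hF.regular.shift (m.t m.N)).path ω) := fun ω =>
    vFinal_finalState hF.regular s ω
  simp only [e]
  rw [integral_shift hF (m.t m.N) hm]
  have e2 : ∀ ω, finalValue m pathFlow s (hF.regular.path ω) = _ := fun ω =>
    finalValue_eq F m s hs ω
  simp only [e2]
  have iA := integrable_orderProfit hF .ask 0 m.dtau s.rAsk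
  have iB := integrable_orderProfit hF .bid 0 m.dtau s.rBid
  have i0 : Integrable (fun _ : Ω => (s.w : ℝ) + s.p * s.q) P := integrable_const _
  have i1 := (integrable_dp hF 0 m.dtau).const_mul (s.q : ℝ)
  have i01 : Integrable (fun ω => ((s.w : ℝ) + s.p * s.q) + s.q * (F.dp 0 m.dtau ω : ℝ)) P :=
    i0.add i1
  have i02 : Integrable (fun ω => ((s.w : ℝ) + s.p * s.q) + s.q * (F.dp 0 m.dtau ω : ℝ)
        + orderProfit F .ask 0 m.dtau s.rAsk ω) P := i01.add iA
  have i03 : Integrable (fun ω => ((s.w : ℝ) + s.p * s.q) + s.q * (F.dp 0 m.dtau ω : ℝ)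
        + orderProfit F .ask 0 m.dtau s.rAsk ω + orderProfit F .bid 0 m.dtau s.rBid ω) P :=
    i02.add iB
  have hq : Integrable (fun ω => |((s.q - ind (fillOut m F .ask 0 s.rAsk ω)
      + ind (fillOut m F .bid 0 s.rBid ω) : ℤ) : ℝ)|) P := by
    have hmq : Measurable fun ω => (s.q - ind (fillOut m F .ask 0 s.rAsk ω)
        + ind (fillOut m F .bid 0 s.rBid ω)) :=
      (measurable_const.sub (measurable_ind (measurableSet_fillOut hF.regular hF.meas ..))).add
        (measurable_ind (measurableSet_fillOut hF.regular hF.meas ..))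
    refine (integrable_const (|(s.q : ℝ)| + 1)).mono'
      ((Measurable.of_discrete (f := fun z : ℤ => |(z : ℝ)|)).comp hmq).aestronglyMeasurable
      (ae_of_all _ fun ω => ?_)
    rw [Real.norm_eq_abs, abs_abs]
    have : |s.q - ind (fillOut m F .ask 0 s.rAsk ω) + ind (fillOut m F .bid 0 s.rBid ω)| ≤
        |s.q| + 1 := by
      have := ind_nonneg (fillOut m F .ask 0 s.rAsk ω)
      have := ind_nonneg (fillOut m F .bid 0 s.rBid ω)
      have := ind_le_one (fillOut m F .ask 0 s.rAsk ω)
      have := ind_le_one (fillOut m F .bid 0 s.rBid ω)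
      grind
    exact_mod_cast this
  rw [integral_sub i03 (hq.const_mul _), integral_add i02 iB, integral_add i01 iA,
    integral_add i0 i1, integral_const_mul, integral_const_mul, integral_dp hF]
  simp only [integral_const, probReal_univ, one_smul, mul_zero, add_zero, gLast, H]
  ring

end OneStep

/-! ### Convergence of orders -/

/-- Sequential convergence of extended integers. -/
def EConv (x : ℕ → EInt) (y : EInt) : Prop :=
  (∀ᶠ n in atTop, x n = y) ∨ (y = ⊤ ∧ ∀ B : ℤ, ∀ᶠ n in atTop, (B : EInt) < x n) ∨
    (y = ⊥ ∧ ∀ B : ℤ, ∀ᶠ n in atTop, x n < (B : EInt))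

/-- Sequential convergence of decisions. -/
def DConv (a : ℕ → Decision) (b : Decision) : Prop :=
  (∀ᶠ n in atTop, a n = b) ∨ ∃ x y, (∀ n, a n = .replace (x n)) ∧ b = .replace y ∧ EConv x y

theorem EConv.const (y : EInt) : EConv (fun _ => y) y := Or.inl (Eventually.of_forall fun _ => rfl)

theorem EConv.comp {x : ℕ → EInt} {y : EInt} (h : EConv x y) {φ : ℕ → ℕ} (hφ : StrictMono φ) :
    EConv (x ∘ φ) y := by
  have ht := hφ.tendsto_atTop
  rcases h with h | ⟨rfl, h⟩ | ⟨rfl, h⟩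
  · exact Or.inl (ht.eventually h)
  · exact Or.inr (Or.inl ⟨rfl, fun B => ht.eventually (h B)⟩)
  · exact Or.inr (Or.inr ⟨rfl, fun B => ht.eventually (h B)⟩)

theorem EConv.congr {x x' : ℕ → EInt} {y : EInt} (h : EConv x y)
    (hx : ∀ᶠ n in atTop, x n = x' n) : EConv x' y := by
  rcases h with h | ⟨rfl, h⟩ | ⟨rfl, h⟩
  · exact Or.inl ((hx.and h).mono fun n hn => hn.1.symm.trans hn.2)
  · exact Or.inr (Or.inl ⟨rfl, fun B => (hx.and (h B)).mono fun n hn => hn.1 ▸ hn.2⟩)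
  · exact Or.inr (Or.inr ⟨rfl, fun B => (hx.and (h B)).mono fun n hn => hn.1 ▸ hn.2⟩)

theorem DConv.comp {a : ℕ → Decision} {b : Decision} (h : DConv a b) {φ : ℕ → ℕ}
    (hφ : StrictMono φ) : DConv (a ∘ φ) b := by
  rcases h with h | ⟨x, y, h1, rfl, h2⟩
  · exact Or.inl (hφ.tendsto_atTop.eventually h)
  · exact Or.inr ⟨x ∘ φ, y, fun n => h1 (φ n), rfl, h2.comp hφ⟩

theorem lt_add_coe_iff (x : EInt) (B c : ℤ) :
    (B : EInt) < x + (c : EInt) ↔ ((B - c : ℤ) : EInt) < x := by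
  rcases eInt_cases x with rfl | ⟨n, rfl⟩ | rfl
  · exact ⟨fun h => absurd h not_lt_bot, fun h => absurd h not_lt_bot⟩
  · rw [coe_add_coe, WithBotTop.coe_lt_coe, WithBotTop.coe_lt_coe]
    omega
  · rw [top_add_coe]
    exact ⟨fun _ => coe_lt_top _, fun _ => coe_lt_top _⟩

/-- The limit `⊥` can be excluded: this lemma serves orders that remain unfilled, and a market order
never does. -/
theorem EConv.add {x : ℕ → EInt} {y : EInt} (h : EConv x y) (hy : y ≠ ⊥) (c : ℤ) :
    EConv (fun n => x n + (c : EInt)) (y + (c : EInt)) := by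
  rcases h with h | ⟨rfl, h⟩ | ⟨rfl, h⟩
  · exact Or.inl (h.mono fun n hn => by simp only [hn])
  · exact Or.inr (Or.inl ⟨rfl, fun B => (h (B - c)).mono fun n hn => (lt_add_coe_iff _ _ _).2 hn⟩)
  · exact absurd rfl hy

/-- Sequential compactness of the extended integers. If no value recurs infinitely often, the
sequence leaves every finite range of integers, and its sign decides between `⊤` and `⊥`. -/
theorem exists_subseq_eConv (x : ℕ → EInt) : ∃ φ : ℕ → ℕ, StrictMono φ ∧ ∃ y, EConv (x ∘ φ) y := by
  by_cases h : ∃ y, ∃ᶠ n in atTop, x n = y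
  · obtain ⟨y, hy⟩ := h
    obtain ⟨φ, hφ, hφy⟩ := extraction_of_frequently_atTop hy
    exact ⟨φ, hφ, y, Or.inl (Eventually.of_forall hφy)⟩
  push Not at h
  have hfin : ∀ a b : ℤ, ∀ᶠ n in atTop, ∀ z ∈ Finset.Icc a b, x n ≠ (z : EInt) := fun a b => by
    rw [Finset.eventually_all]
    exact fun z _ => h z
  by_cases hpos : ∃ᶠ n in atTop, (0 : EInt) < x n
  · obtain ⟨φ, hφ, hφy⟩ := extraction_of_frequently_atTop hpos
    refine ⟨φ, hφ, ⊤, Or.inr (Or.inl ⟨rfl, fun B => ?_⟩)⟩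
    filter_upwards [hφ.tendsto_atTop.eventually (hfin 0 B)] with n hn
    have h0 := hφy n
    simp only [Function.comp_apply]
    rcases eInt_cases (x (φ n)) with h1 | ⟨k, h1⟩ | h1 <;> rw [h1] at h0 hn ⊢
    · exact absurd h0 not_lt_bot
    · have hk : 0 < k := WithBotTop.coe_lt_coe.1 h0
      rw [WithBotTop.coe_lt_coe]
      by_contra! hB
      exact hn k (Finset.mem_Icc.2 ⟨hk.le, hB⟩) rfl
    · exact coe_lt_top B
  · rw [not_frequently] at hpos
    refine ⟨id, strictMono_id, ⊥, Or.inr (Or.inr ⟨rfl, fun B => ?_⟩)⟩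
    filter_upwards [hpos, hfin B 0] with n h0 hn
    simp only [Function.comp_apply, id]
    rcases eInt_cases (x n) with h1 | ⟨k, h1⟩ | h1 <;> rw [h1] at h0 hn ⊢
    · exact bot_lt_coe B
    · have hk : k ≤ 0 := not_lt.1 fun hk => h0 (WithBotTop.coe_lt_coe.2 hk)
      rw [WithBotTop.coe_lt_coe]
      by_contra! hB
      exact hn k (Finset.mem_Icc.2 ⟨hB, hk⟩) rfl
    · exact absurd (coe_lt_top 0) h0

/-- The decision `keep` is isolated; off it, compactness of the extended integers applies. -/
theorem exists_subseq_dConv (a : ℕ → Decision) :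
    ∃ φ : ℕ → ℕ, StrictMono φ ∧ ∃ b, DConv (a ∘ φ) b := by
  by_cases h : ∃ᶠ n in atTop, a n = .keep
  · obtain ⟨φ, hφ, hk⟩ := extraction_of_frequently_atTop h
    exact ⟨φ, hφ, .keep, Or.inl (Eventually.of_forall hk)⟩
  · have h' : ∃ᶠ n in atTop, ∃ x, a n = .replace x := by
      refine ((not_frequently.1 h).mono fun n hn => ?_).frequently
      cases hcase : a n with
      | replace x => exact ⟨x, rfl⟩
      | keep => exact absurd hcase hn
    obtain ⟨φ, hφ, hk⟩ := extraction_of_frequently_atTop h'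
    choose x hx using hk
    obtain ⟨ψ, hψ, y, hy⟩ := exists_subseq_eConv x
    exact ⟨φ ∘ ψ, hφ.comp hψ, .replace y, Or.inr ⟨x ∘ ψ, y, fun n => hx (ψ n), rfl, hy⟩⟩

/-- Singletons are closed. Only the three decisions that restrict actions in `Params.A` are needed.
-/
theorem DConv.eventually_ne {a : ℕ → Decision} {b c : Decision} (h : DConv a b) (hbc : b ≠ c)
    (hc : c = .replace ⊤ ∨ c = .keep ∨ c = .replace ⊥) : ∀ᶠ n in atTop, a n ≠ c := by
  rcases h with h | ⟨x, y, hx, rfl, h⟩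
  · exact h.mono fun n hn => hn ▸ hbc
  · rcases h with h | ⟨rfl, h⟩ | ⟨rfl, h⟩
    · exact h.mono fun n hn => by rw [hx, hn]; exact hbc
    · filter_upwards [h 0] with n hn
      rw [hx]
      rcases hc with rfl | rfl | rfl
      · exact absurd rfl hbc
      · simp
      · intro hcon
        rw [Decision.replace.inj hcon] at hn
        exact not_lt_bot hn
    · filter_upwards [h 0] with n hn
      rw [hx]
      rcases hc with rfl | rfl | rfl
      · intro hcon
        rw [Decision.replace.inj hcon] at hn
        exact not_top_lt hn
      · simp
      · exact absurd rfl hbc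

theorem EConv.eventually_lt_top {x : ℕ → EInt} {y : EInt} (h : EConv x y) (hy : 0 ≤ y)
    (hlt : y < ⊤) : ∀ᶠ n in atTop, x n < ⊤ := by
  rcases h with h | ⟨rfl, h⟩ | ⟨rfl, h⟩
  · exact h.mono fun n hn => hn ▸ hlt
  · exact absurd hlt (lt_irrefl _)
  · exact absurd hy (not_le.2 (bot_lt_coe 0))

section Admissible

variable {m : Params}

theorem Params.A_nonempty (q : ℤ) (rA rB : EInt) : (m.A q rA rB).Nonempty := by
  -- Cancelling both orders is allowed in every state.
  refine ⟨(.replace ⊤, .replace ⊤), ?_⟩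
  unfold Params.A
  split_ifs <;> simp

/-- Limits of admissible actions are admissible. -/
theorem mem_A_of_conv {q : ℤ} {rA rB : EInt} {xA xB : ℕ → EInt} {a : ℕ → Decision × Decision}
    {b : Decision × Decision} (hrA : 0 ≤ rA) (hrB : 0 ≤ rB) (hA : EConv xA rA) (hB : EConv xB rB)
    (ha : ∀ n, a n ∈ m.A q (xA n) (xB n)) (h1 : DConv (fun n => (a n).1) b.1)
    (h2 : DConv (fun n => (a n).2) b.2) : b ∈ m.A q rA rB := by
  have hl := m.qLow_lt
  have hh := m.qHigh_gt
  by_cases hlow : m.NearLow q rA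
  · have hev : ∀ᶠ n in atTop, m.NearLow q (xA n) := by
      rcases hlow with hq | ⟨h0, hq, hlt⟩
      · exact Eventually.of_forall fun n => Or.inl hq
      · exact (hA.eventually_lt_top hrA hlt).mono fun n hn => Or.inr ⟨h0, hq, hn⟩
    unfold Params.A at ha ⊢
    rw [if_pos hlow]
    by_contra hcon
    simp only [Set.mem_ofPred_eq, not_or] at hcon
    obtain ⟨n, hn, n1, n2, n3⟩ := (hev.and ((h1.eventually_ne hcon.1 (Or.inl rfl)).and
      ((h1.eventually_ne hcon.2.1 (Or.inr (Or.inl rfl))).and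
      (h2.eventually_ne hcon.2.2 (Or.inr (Or.inr rfl)))))).exists
    have := ha n
    rw [if_pos hn] at this
    rcases this with h | h | h
    exacts [n1 h, n2 h, n3 h]
  · by_cases hhigh : m.NearHigh q rB
    · have hev : ∀ᶠ n in atTop, m.NearHigh q (xB n) := by
        rcases hhigh with hq | ⟨h0, hq, hlt⟩
        · exact Eventually.of_forall fun n => Or.inl hq
        · exact (hB.eventually_lt_top hrB hlt).mono fun n hn => Or.inr ⟨h0, hq, hn⟩
      have hnl : ∀ n, ¬ m.NearLow q (xA n) := by
        intro n hn
        have e1 : q = m.qLow ∨ q = m.qLow + 1 := hn.imp id fun h => h.2.1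
        have e2 : q = m.qHigh ∨ q = m.qHigh - 1 := hhigh.imp id fun h => h.2.1
        omega
      unfold Params.A at ha ⊢
      rw [if_neg hlow, if_pos hhigh]
      by_contra hcon
      simp only [Set.mem_ofPred_eq, not_or] at hcon
      obtain ⟨n, hn, n1, n2, n3⟩ := (hev.and ((h1.eventually_ne hcon.1 (Or.inr (Or.inr rfl))).and
        ((h2.eventually_ne hcon.2.1 (Or.inl rfl)).and
        (h2.eventually_ne hcon.2.2 (Or.inr (Or.inl rfl)))))).exists
      have := ha n
      rw [if_neg (hnl n), if_pos hn] at this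
      rcases this with h | h | h
      exacts [n1 h, n2 h, n3 h]
    -- The approximating states may be restricted when the limit is not, since finite orders can
    -- converge to `⊤`. The admissible set then jumps upwards in the limit, so limits of admissible
    -- actions are still admissible but continuity of the value may fail.
    · unfold Params.A
      rw [if_neg hlow, if_neg hhigh]
      trivial

end Admissible

/-! ### Pathwise continuity in the orders -/

section Pathwise

variable {Ω : Type*} {F : OrderFlow Ω} {m : Params}

/-- On a fixed path, orders near `⊤` lie beyond the price variation and are never filled, while
orders near `⊥` are marketable on arrival. -/
theorem eventually_filled_iff (hF : F.Regular) {x : ℕ → EInt} {y : EInt} (h : EConv x y) (σ : Side)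
    (t₀ a b : ℝ≥0) (ω : Ω) :
    ∀ᶠ n in atTop, F.Filled σ t₀ a b (x n) ω ↔ F.Filled σ t₀ a b y ω := by
  rcases h with h | ⟨rfl, h⟩ | ⟨rfl, h⟩
  · exact h.mono fun n hn => by simp only [hn]
  · filter_upwards [h (F.span (max t₀ (max a b)) ω)] with n hn
    refine iff_of_false (fun hfill => ?_) (not_filled_top F _ _ _ _ _)
    exact not_lt.2 (le_span_of_filled hF (c := max t₀ (max a b)) (le_max_left _ _)
      ((le_max_left _ _).trans (le_max_right _ _)) ((le_max_right _ _).trans (le_max_right _ _))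
      hfill) hn
  · filter_upwards [h (σ.sgn * F.dp t₀ a ω)] with n hn
    exact iff_of_true (Or.inl hn) (filled_bot F ..)

theorem eventually_orderProfit_eq (hF : F.Regular) {x : ℕ → EInt} {y : EInt} (h : EConv x y)
    (σ : Side) (t₁ t₂ : ℝ≥0) (ω : Ω) :
    ∀ᶠ n in atTop, orderProfit F σ t₁ t₂ (x n) ω = orderProfit F σ t₁ t₂ y ω := by
  have hfill := eventually_filled_iff hF h σ 0 t₁ (t₁ + t₂) ω
  simp only [orderProfit_eq, profit]
  rcases h with h | ⟨rfl, -⟩ | ⟨rfl, h⟩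
  · exact h.mono fun n hn => by simp only [hn]
  · filter_upwards [hfill] with n hn
    rw [hn, ind_of_false (not_filled_top F _ _ _ _ _)]
    simp
  · filter_upwards [hfill, h (σ.sgn * F.dp 0 t₁ ω)] with n hn hlt
    rw [hn]
    congr 3
    rcases eInt_cases (x n) with h1 | ⟨k, h1⟩ | h1 <;> rw [h1] at hlt ⊢
    -- Strict inequality of integers gains a full tick, exactly enough for the maximum to equal
    -- -1/2.
    · have hk : k + 1 ≤ σ.sgn * F.dp 0 t₁ ω := WithBotTop.coe_lt_coe.1 hlt
      have hk' : (k : ℚ) + 1 ≤ σ.sgn * F.dp 0 t₁ ω := by exact_mod_cast hk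
      rw [maxShift_coe, maxShift_bot]
      exact max_eq_right (by linarith)
    · exact absurd hlt not_top_lt

theorem eventually_fillOut_iff (hF : F.Regular) {x : ℕ → EInt} {y : EInt} (h : EConv x y)
    (σ : Side) (i : ℕ) (ω : Ω) :
    ∀ᶠ n in atTop, fillOut m F σ i (x n) ω ↔ fillOut m F σ i y ω :=
  eventually_filled_iff hF h ..

theorem eventually_fillLate_iff (hF : F.Regular) {x : ℕ → EInt} {r : EInt} (h : EConv x r)
    {a : ℕ → Decision} {b : Decision} (ha : DConv a b) (σ : Side) (i : ℕ) (ω : Ω) :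
    ∀ᶠ n in atTop, fillLate m F σ i (x n) (a n) ω ↔ fillLate m F σ i r b ω := by
  rcases ha with ha | ⟨z, y, hz, rfl, hy⟩
  · have h1 := eventually_fillOut_iff (m := m) hF h σ i ω
    have h2 := eventually_filled_iff hF h σ (m.t i) (m.tPlus i) (m.t (i + 1)) ω
    filter_upwards [ha, h1, h2] with n hn hn1 hn2
    rw [hn]
    cases b with
    | replace δ => exact Iff.rfl
    | keep => simp only [fillLate, hn1, hn2]
  · filter_upwards [eventually_filled_iff hF hy σ (m.t i) (m.tPlus i) (m.t (i + 1)) ω] with n hn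
    rw [hz]
    exact hn

theorem eConv_nextR (hF : F.Regular) {x : ℕ → EInt} {r : EInt} (h : EConv x r) (hr : 0 ≤ r)
    {a : ℕ → Decision} {b : Decision} (ha : DConv a b) (σ : Side) (i : ℕ) (ω : Ω) :
    EConv (fun n => nextR m F σ i (x n) (a n) ω) (nextR m F σ i r b ω) := by
  have hlate := eventually_fillLate_iff (m := m) hF h ha σ i ω
  have hout := eventually_fillOut_iff (m := m) hF h σ i ω
  cases b with
  | keep =>
    have ha' : ∀ᶠ n in atTop, a n = .keep := by
      rcases ha with ha | ⟨z, y, -, hcon, -⟩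
      · exact ha
      · exact absurd hcon (by simp)
    simp only [nextR]
    split_ifs with hcase
    · refine Or.inl ?_
      filter_upwards [hlate, hout, ha'] with n h1 h2 h3
      rw [h3] at h1 ⊢
      rw [← h1, ← h2] at hcase
      exact if_pos hcase
    · refine (h.add (ne_of_gt ((bot_lt_coe 0).trans_le hr)) _).congr ?_
      filter_upwards [hlate, hout, ha'] with n h1 h2 h3
      rw [h3] at h1 ⊢
      rw [← h1, ← h2] at hcase
      exact (if_neg hcase).symm
  | replace δ =>
    have ha' : ∃ z : ℕ → EInt, (∀ᶠ n in atTop, a n = .replace (z n)) ∧ EConv z δ := by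
      rcases ha with ha | ⟨z, y, hz, hy, hc⟩
      · exact ⟨fun _ => δ, ha, EConv.const δ⟩
      · rw [Decision.replace.inj hy]
        exact ⟨z, Eventually.of_forall hz, hc⟩
    obtain ⟨z, hz, hc⟩ := ha'
    simp only [nextR]
    split_ifs with hcase
    · refine Or.inl ?_
      filter_upwards [hlate, hz] with n h1 h3
      rw [h3] at h1 ⊢
      rw [← h1] at hcase
      exact if_pos hcase
    -- A market order is always filled, so an unfilled order is not one.
    · have hδ : δ ≠ ⊥ := by
        rintro rfl
        exact hcase (filled_bot F ..)
      refine (hc.add hδ _).congr ?_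
      filter_upwards [hlate, hz] with n h1 h3
      rw [h3] at h1 ⊢
      rw [← h1] at hcase
      exact (if_neg hcase).symm

theorem eventually_nextQ_eq (hF : F.Regular) {xA xB : ℕ → EInt} {rA rB : EInt} (hA : EConv xA rA)
    (hB : EConv xB rB) {a : ℕ → Decision × Decision} {b : Decision × Decision}
    (h1 : DConv (fun n => (a n).1) b.1) (h2 : DConv (fun n => (a n).2) b.2) (i : ℕ) (q : ℤ)
    (ω : Ω) :
    ∀ᶠ n in atTop, nextQ m F i q (xA n) (xB n) (a n) ω = nextQ m F i q rA rB b ω := by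
  filter_upwards [eventually_fillOut_iff (m := m) hF hA .ask i ω,
    eventually_fillOut_iff (m := m) hF hB .bid i ω,
    eventually_fillLate_iff (m := m) hF hA h1 .ask i ω,
    eventually_fillLate_iff (m := m) hF hB h2 .bid i ω] with n e1 e2 e3 e4
  simp only [nextQ, e1, e2, e3, e4]

end Pathwise

/-! ### Semicontinuity and attainment -/

section Semicontinuity

variable {Ω : Type*} [mΩ : MeasurableSpace Ω] {F : OrderFlow Ω} {m : Params} {P : Measure Ω}
  [IsProbabilityMeasure P]

/-- A reverse Fatou lemma for bounded functions. -/
theorem eventually_integral_lt {f : ℕ → Ω → ℝ} {f₀ : Ω → ℝ} {C : ℝ} (hf : ∀ n, Measurable (f n))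
    (hf₀ : Measurable f₀) (hC : ∀ n ω, |f n ω| ≤ C) (hC₀ : ∀ ω, |f₀ ω| ≤ C)
    (h : ∀ ω c, f₀ ω < c → ∀ᶠ n in atTop, f n ω < c) {c : ℝ} (hc : ∫ ω, f₀ ω ∂P < c) :
    ∀ᶠ n in atTop, ∫ ω, f n ω ∂P < c := by
  -- The maximum with `f₀` bounds `f n` from above and converges to `f₀`, so dominated convergence
  -- applies to it.
  have hmax : ∀ n ω, |max (f n ω) (f₀ ω)| ≤ C := fun n ω =>
    abs_max_le_max_abs_abs.trans (max_le (hC n ω) (hC₀ ω))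
  have hlim : Tendsto (fun n => ∫ ω, max (f n ω) (f₀ ω) ∂P) atTop (𝓝 (∫ ω, f₀ ω ∂P)) := by
    refine tendsto_integral_of_dominated_convergence (fun _ => C)
      (fun n => ((hf n).max hf₀).aestronglyMeasurable) (integrable_const C)
      (fun n => ae_of_all _ (hmax n)) (ae_of_all _ fun ω => ?_)
    rw [tendsto_order]
    refine ⟨fun b hb => Eventually.of_forall fun n => hb.trans_le (le_max_right _ _),
      fun b hb => (h ω b hb).mono fun n hn => max_lt hn hb⟩
  filter_upwards [(tendsto_order.1 hlim).2 c hc] with n hn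
  refine (integral_mono ?_ ?_ fun ω => le_max_left (f n ω) (f₀ ω)).trans_lt hn
  · exact (integrable_const C).mono' (hf n).aestronglyMeasurable (ae_of_all _ (hC n))
  · exact (integrable_const C).mono' ((hf n).max hf₀).aestronglyMeasurable (ae_of_all _ (hmax n))

/-- Profits are eventually constant along the sequence on each path, and the bound of
`norm_orderProfit_le` does not depend on the order. -/
theorem tendsto_H (hF : F.IsMarket m P) (σ : Side) (t₁ t₂ : ℝ≥0) {x : ℕ → EInt} {y : EInt}
    (h : EConv x y) : Tendsto (fun n => H F P σ t₁ t₂ (x n)) atTop (𝓝 (H F P σ t₁ t₂ y)) :=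
  tendsto_integral_of_dominated_convergence _
    (fun n => (integrable_orderProfit hF σ t₁ t₂ (x n)).aestronglyMeasurable)
    (integrable_orderProfit_bound hF (t₁ + t₂))
    (fun n => ae_of_all _ (norm_orderProfit_le hF.regular σ t₁ t₂ (x n)))
    (ae_of_all _ fun ω =>
      tendsto_nhds_of_eventually_eq (eventually_orderProfit_eq hF.regular h σ t₁ t₂ ω))

theorem tendsto_Hact (hF : F.IsMarket m P) (σ : Side) {x : ℕ → EInt} {r : EInt} (h : EConv x r)
    {a : ℕ → Decision} {b : Decision} (ha : DConv a b) :
    Tendsto (fun n => Hact m F P σ (x n) (a n)) atTop (𝓝 (Hact m F P σ r b)) := by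
  rcases ha with ha | ⟨z, y, hz, rfl, hy⟩
  · refine Tendsto.congr' (f₁ := fun n => Hact m F P σ (x n) b)
      (ha.mono fun n hn => by simp only [hn]) ?_
    cases b with
    | replace δ => exact (tendsto_H hF σ _ _ h).add_const _
    | keep => exact tendsto_H hF σ _ _ h
  · simp only [hz]
    exact (tendsto_H hF σ _ _ h).add (tendsto_H hF σ _ _ hy)

theorem abs_H_le (hF : F.IsMarket m P) (σ : Side) (t₁ t₂ : ℝ≥0) (x : EInt) :
    |H F P σ t₁ t₂ x| ≤ ∫ ω, (3 * (F.span (t₁ + t₂) ω : ℝ) + 1) ∂P :=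
  norm_integral_le_of_norm_le (integrable_orderProfit_bound hF (t₁ + t₂))
    (ae_of_all _ (norm_orderProfit_le hF.regular σ t₁ t₂ x))

theorem exists_abs_Hact_le (hF : F.IsMarket m P) :
    ∃ K, ∀ σ r a, |Hact m F P σ r a| ≤ K := by
  refine ⟨(∫ ω, (3 * (F.span (0 + m.dtau) ω : ℝ) + 1) ∂P)
    + (∫ ω, (3 * (F.span (m.dtau + (m.dt - m.dtau)) ω : ℝ) + 1) ∂P)
    + ∫ ω, (3 * (F.span (0 + m.dt) ω : ℝ) + 1) ∂P, fun σ r a => ?_⟩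
  have h1 := abs_H_le hF σ 0 m.dtau r
  have h3 := abs_H_le hF σ 0 m.dt r
  cases a with
  | replace δ =>
    have h2 := abs_H_le hF σ m.dtau (m.dt - m.dtau) δ
    have := abs_add_le (H F P σ 0 m.dtau r) (H F P σ m.dtau (m.dt - m.dtau) δ)
    have := abs_nonneg (H F P σ 0 m.dt r)
    simp only [Hact]
    linarith
  | keep =>
    have h2 := abs_H_le hF σ m.dtau (m.dt - m.dtau) r
    have := abs_nonneg (H F P σ 0 m.dtau r)
    have := abs_nonneg (H F P σ m.dtau (m.dt - m.dtau) r)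
    simp only [Hact]
    linarith

/-- Boundedness on the valid states. -/
def BoundedOnValid (m : Params) (h : ℤ → EInt → EInt → ℝ) : Prop :=
  ∃ C, ∀ q rA rB, m.Valid q rA rB → |h q rA rB| ≤ C

/-- Sequential upper semicontinuity on the valid states. -/
def UpperSemicontinuousOnValid (m : Params) (h : ℤ → EInt → EInt → ℝ) : Prop :=
  ∀ ⦃q : ℤ⦄ ⦃rA rB : EInt⦄ ⦃xA xB : ℕ → EInt⦄, m.Valid q rA rB →
    (∀ᶠ n in atTop, m.Valid q (xA n) (xB n)) → EConv xA rA → EConv xB rB →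
      ∀ c, h q rA rB < c → ∀ᶠ n in atTop, h q (xA n) (xB n) < c

variable {h : ℤ → EInt → EInt → ℝ}

theorem integrable_next (hF : F.IsMarket m P) (hb : BoundedOnValid m h) {q : ℤ} {rA rB : EInt}
    (hv : m.Valid q rA rB) {a : Decision × Decision} (ha : a ∈ m.A q rA rB) :
    Integrable (fun ω => h (nextQ m F 0 q rA rB a ω) (nextR m F .ask 0 rA a.1 ω)
      (nextR m F .bid 0 rB a.2 ω)) P := by
  obtain ⟨C, hC⟩ := hb
  exact (integrable_const C).mono'
    (measurable_next hF.regular hF.meas h q rA rB a).aestronglyMeasurable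
    (ae_of_all _ fun ω => hC _ _ _ (valid_next F m 0 hv ha ω))

theorem exists_abs_oneStep_le (hF : F.IsMarket m P) (hb : BoundedOnValid m h) :
    ∃ C, ∀ q rA rB, m.Valid q rA rB → ∀ a ∈ m.A q rA rB, |oneStep m F P h q rA rB a| ≤ C := by
  obtain ⟨C, hC⟩ := hb
  obtain ⟨K, hK⟩ := exists_abs_Hact_le hF
  refine ⟨C + K + K, fun q rA rB hv a ha => ?_⟩
  have h1 : |∫ ω, h (nextQ m F 0 q rA rB a ω) (nextR m F .ask 0 rA a.1 ω)
      (nextR m F .bid 0 rB a.2 ω) ∂P| ≤ C := by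
    have := norm_integral_le_of_norm_le (integrable_const (μ := P) C)
      (ae_of_all P fun ω => (Real.norm_eq_abs _).trans_le
        (hC _ _ _ (valid_next F m 0 hv ha ω)))
    simpa using this
  rw [oneStep]
  exact (abs_add_le _ _).trans (add_le_add ((abs_add_le _ _).trans (add_le_add h1 (hK _ _ _)))
    (hK _ _ _))

/-- The one-step value is upper semicontinuous in the outstanding orders and the action. -/
theorem eventually_oneStep_lt (hF : F.IsMarket m P) (hb : BoundedOnValid m h)
    (hu : UpperSemicontinuousOnValid m h) {q : ℤ} {rA rB : EInt} {xA xB : ℕ → EInt}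
    (hv : m.Valid q rA rB) (hvx : ∀ n, m.Valid q (xA n) (xB n)) (hA : EConv xA rA)
    (hB : EConv xB rB) {a : ℕ → Decision × Decision} {b : Decision × Decision}
    (ha : ∀ n, a n ∈ m.A q (xA n) (xB n)) (hbA : b ∈ m.A q rA rB)
    (h1 : DConv (fun n => (a n).1) b.1) (h2 : DConv (fun n => (a n).2) b.2) {c : ℝ}
    (hc : oneStep m F P h q rA rB b < c) :
    ∀ᶠ n in atTop, oneStep m F P h q (xA n) (xB n) (a n) < c := by
  obtain ⟨C, hC⟩ := hb
  have hI : ∀ c', ∫ ω, h (nextQ m F 0 q rA rB b ω) (nextR m F .ask 0 rA b.1 ω)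
      (nextR m F .bid 0 rB b.2 ω) ∂P < c' →
      ∀ᶠ n in atTop, ∫ ω, h (nextQ m F 0 q (xA n) (xB n) (a n) ω)
        (nextR m F .ask 0 (xA n) (a n).1 ω) (nextR m F .bid 0 (xB n) (a n).2 ω) ∂P < c' := by
    intro c' hc'
    refine eventually_integral_lt
      (fun n => measurable_next hF.regular hF.meas h q (xA n) (xB n) (a n))
      (measurable_next hF.regular hF.meas h q rA rB b)
      (fun n ω => hC _ _ _ (valid_next F m 0 (hvx n) (ha n) ω))
      (fun ω => hC _ _ _ (valid_next F m 0 hv hbA ω)) (fun ω c hc => ?_) hc'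
    have hq := eventually_nextQ_eq (m := m) hF.regular hA hB h1 h2 0 q ω
    have := hu (valid_next F m 0 hv hbA ω)
      (hq.mono fun n hn => hn ▸ valid_next F m 0 (hvx n) (ha n) ω)
      (eConv_nextR hF.regular hA hv.2.2.1 h1 .ask 0 ω)
      (eConv_nextR hF.regular hB hv.2.2.2.1 h2 .bid 0 ω) c hc
    filter_upwards [hq, this] with n e1 e2
    rw [e1]
    exact e2
  have hT := (tendsto_Hact (m := m) hF .ask hA h1).add (tendsto_Hact (m := m) hF .bid hB h2)
  -- Half of the gap is left to the upper semicontinuous integral, half to the convergent order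
  -- values.
  set ε := (c - oneStep m F P h q rA rB b) / 2 with hε
  have hε0 : 0 < ε := by rw [hε]; linarith
  filter_upwards [hI _ (lt_add_of_pos_right _ hε0),
    (tendsto_order.1 hT).2 _ (lt_add_of_pos_right _ hε0)] with n e1 e2
  simp only [oneStep] at hε ⊢
  linarith

/-- The maximum over the admissible actions is attained. -/
theorem exists_isMaxOn_oneStep (hF : F.IsMarket m P) (hb : BoundedOnValid m h)
    (hu : UpperSemicontinuousOnValid m h) {q : ℤ} {rA rB : EInt} (hv : m.Valid q rA rB) :
    ∃ a ∈ m.A q rA rB, oneStep m F P h q rA rB a = sSup (oneStep m F P h q rA rB '' m.A q rA rB) ∧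
      ∀ a' ∈ m.A q rA rB, oneStep m F P h q rA rB a' ≤ oneStep m F P h q rA rB a := by
  obtain ⟨C, hC⟩ := exists_abs_oneStep_le hF hb
  have hne : (oneStep m F P h q rA rB '' m.A q rA rB).Nonempty := (m.A_nonempty q rA rB).image _
  have hbdd : BddAbove (oneStep m F P h q rA rB '' m.A q rA rB) := by
    refine ⟨C, ?_⟩
    rintro _ ⟨a, ha, rfl⟩
    exact (le_abs_self _).trans (hC q rA rB hv a ha)
  -- A maximizing sequence of actions has a convergent subsequence, one side after the other; by
  -- upper semicontinuity its limit is a maximizer.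
  obtain ⟨u, -, hlim, hmem⟩ := exists_seq_tendsto_sSup hne hbdd
  choose a ha hau using hmem
  obtain ⟨φ, hφ, b1, hb1⟩ := exists_subseq_dConv fun n => (a n).1
  obtain ⟨ψ, hψ, b2, hb2⟩ := exists_subseq_dConv fun n => (a (φ n)).2
  have hb1' : DConv (fun n => (a (φ (ψ n))).1) b1 := hb1.comp hψ
  have hbA : (b1, b2) ∈ m.A q rA rB :=
    mem_A_of_conv hv.2.2.1 hv.2.2.2.1 (EConv.const rA) (EConv.const rB)
      (fun n => ha (φ (ψ n))) hb1' hb2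
  have hle : sSup (oneStep m F P h q rA rB '' m.A q rA rB) ≤ oneStep m F P h q rA rB (b1, b2) := by
    by_contra! hlt
    obtain ⟨c, hc1, hc2⟩ := exists_between hlt
    have hev := eventually_oneStep_lt hF hb hu hv (fun _ => hv) (EConv.const rA) (EConv.const rB)
      (fun n => ha (φ (ψ n))) hbA hb1' hb2 hc1
    have hlim' := hlim.comp (hφ.comp hψ).tendsto_atTop
    obtain ⟨n, e1, e2⟩ := (hev.and ((tendsto_order.1 hlim').1 c hc2)).exists
    rw [Function.comp_apply, Function.comp_apply, ← hau] at e2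
    exact lt_asymm e1 e2
  have hge : ∀ a' ∈ m.A q rA rB,
      oneStep m F P h q rA rB a' ≤ sSup (oneStep m F P h q rA rB '' m.A q rA rB) :=
    fun a' ha' => le_csSup hbdd ⟨a', ha', rfl⟩
  exact ⟨_, hbA, le_antisymm (hge _ hbA) hle, fun a' ha' => (hge a' ha').trans hle⟩

theorem boundedOnValid_gLast (hF : F.IsMarket m P) : BoundedOnValid m (gLast m F P) := by
  refine ⟨(∫ ω, (3 * (F.span (0 + m.dtau) ω : ℝ) + 1) ∂P)
    + (∫ ω, (3 * (F.span (0 + m.dtau) ω : ℝ) + 1) ∂P)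
    + (|(m.qLow : ℝ)| + |(m.qHigh : ℝ)| + 1), fun q rA rB hv => ?_⟩
  have h1 := abs_H_le hF .ask 0 m.dtau rA
  have h2 := abs_H_le hF .bid 0 m.dtau rB
  have h3 : |∫ ω, |((q - ind (fillOut m F .ask 0 rA ω) + ind (fillOut m F .bid 0 rB ω) : ℤ) : ℝ)|
      ∂P| ≤ |(m.qLow : ℝ)| + |(m.qHigh : ℝ)| + 1 := by
    have hp : ∀ ω, ‖|((q - ind (fillOut m F .ask 0 rA ω)
        + ind (fillOut m F .bid 0 rB ω) : ℤ) : ℝ)|‖ ≤ |(m.qLow : ℝ)| + |(m.qHigh : ℝ)| + 1 := by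
      intro ω
      rw [Real.norm_eq_abs, abs_abs]
      have : |q - ind (fillOut m F .ask 0 rA ω) + ind (fillOut m F .bid 0 rB ω)| ≤
          |m.qLow| + |m.qHigh| + 1 := by
        have := ind_nonneg (fillOut m F .ask 0 rA ω)
        have := ind_nonneg (fillOut m F .bid 0 rB ω)
        have := ind_le_one (fillOut m F .ask 0 rA ω)
        have := ind_le_one (fillOut m F .bid 0 rB ω)
        have := hv.1
        have := hv.2.1
        grind
      exact_mod_cast this
    have := norm_integral_le_of_norm_le (integrable_const (μ := P) _) (ae_of_all _ hp)
    simpa using this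
  rw [gLast]
  rw [abs_le] at h1 h2 h3 ⊢
  have := abs_nonneg (m.qLow : ℝ)
  have := abs_nonneg (m.qHigh : ℝ)
  constructor <;> linarith

/-- Without a choice of action the function is even continuous, by dominated convergence. -/
theorem upperSemicontinuousOnValid_gLast (hF : F.IsMarket m P) :
    UpperSemicontinuousOnValid m (gLast m F P) := by
  intro q rA rB xA xB _ _ hA hB c hc
  have hq : ∀ rA rB, Measurable fun ω => |((q - ind (fillOut m F .ask 0 rA ω)
      + ind (fillOut m F .bid 0 rB ω) : ℤ) : ℝ)| := fun rA rB =>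
    (Measurable.of_discrete (f := fun z : ℤ => |(z : ℝ)|)).comp
      ((measurable_const.sub (measurable_ind (measurableSet_fillOut hF.regular hF.meas ..))).add
        (measurable_ind (measurableSet_fillOut hF.regular hF.meas ..)))
  have hlim : Tendsto (fun n => ∫ ω, |((q - ind (fillOut m F .ask 0 (xA n) ω)
      + ind (fillOut m F .bid 0 (xB n) ω) : ℤ) : ℝ)| ∂P) atTop
      (𝓝 (∫ ω, |((q - ind (fillOut m F .ask 0 rA ω)
        + ind (fillOut m F .bid 0 rB ω) : ℤ) : ℝ)| ∂P)) := by
    refine tendsto_integral_of_dominated_convergence (fun _ => |(q : ℝ)| + 1)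
      (fun n => (hq _ _).aestronglyMeasurable) (integrable_const _)
      (fun n => ae_of_all _ fun ω => ?_) (ae_of_all _ fun ω => ?_)
    · rw [Real.norm_eq_abs, abs_abs]
      have : |q - ind (fillOut m F .ask 0 (xA n) ω) + ind (fillOut m F .bid 0 (xB n) ω)| ≤
          |q| + 1 := by
        have := ind_nonneg (fillOut m F .ask 0 (xA n) ω)
        have := ind_nonneg (fillOut m F .bid 0 (xB n) ω)
        have := ind_le_one (fillOut m F .ask 0 (xA n) ω)
        have := ind_le_one (fillOut m F .bid 0 (xB n) ω)
        grind
      exact_mod_cast this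
    · refine tendsto_nhds_of_eventually_eq ?_
      filter_upwards [eventually_fillOut_iff (m := m) hF.regular hA .ask 0 ω,
        eventually_fillOut_iff (m := m) hF.regular hB .bid 0 ω] with n e1 e2
      simp only [e1, e2]
  have := ((tendsto_H hF .ask 0 m.dtau hA).add (tendsto_H hF .bid 0 m.dtau hB)).sub
    (hlim.const_mul (1 / 2))
  exact (tendsto_order.1 this).2 c hc

/-- If the supremum stayed at least `c` along a subsequence, the maximizers there would have an
admissible limit action. The one-step value is upper semicontinuous jointly in orders and action,
and below `c` at that limit: a contradiction. -/
theorem upperSemicontinuousOnValid_sSup (hF : F.IsMarket m P) (hb : BoundedOnValid m h)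
    (hu : UpperSemicontinuousOnValid m h) :
    UpperSemicontinuousOnValid m
      fun q rA rB => sSup (oneStep m F P h q rA rB '' m.A q rA rB) := by
  intro q rA rB xA xB hv hvx hA hB c hc
  by_contra hcon
  rw [not_eventually] at hcon
  obtain ⟨φ, hφ, hφ'⟩ := extraction_of_frequently_atTop (hcon.and_eventually hvx)
  choose a ha hsup _ using fun n => exists_isMaxOn_oneStep hF hb hu (hφ' n).2
  obtain ⟨ψ, hψ, b1, hb1⟩ := exists_subseq_dConv fun n => (a n).1
  obtain ⟨χ, hχ, b2, hb2⟩ := exists_subseq_dConv fun n => (a (ψ n)).2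
  have hmono := hφ.comp (hψ.comp hχ)
  have hb1' : DConv (fun n => (a (ψ (χ n))).1) b1 := hb1.comp hχ
  have hbA : (b1, b2) ∈ m.A q rA rB :=
    mem_A_of_conv hv.2.2.1 hv.2.2.2.1 (hA.comp hmono) (hB.comp hmono)
      (fun n => ha (ψ (χ n))) hb1' hb2
  obtain ⟨a₀, _, hsup₀, hmax₀⟩ := exists_isMaxOn_oneStep hF hb hu hv
  have hlt : oneStep m F P h q rA rB (b1, b2) < c :=
    ((hmax₀ _ hbA).trans_eq hsup₀).trans_lt hc
  obtain ⟨n, hn⟩ := (eventually_oneStep_lt hF hb hu hv (fun n => (hφ' (ψ (χ n))).2)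
    (hA.comp hmono) (hB.comp hmono) (fun n => ha (ψ (χ n))) hbA hb1' hb2 hlt).exists
  exact (hφ' (ψ (χ n))).1 ((hsup _).symm.trans_lt hn)

/-- Backward induction. Attainment makes the supremum a one-step value, so it inherits the bound of
`exists_abs_oneStep_le`. -/
theorem gRem_regular (hF : F.IsMarket m P) (k : ℕ) :
    BoundedOnValid m (gRem m F P k) ∧ UpperSemicontinuousOnValid m (gRem m F P k) := by
  induction k with
  | zero => exact ⟨boundedOnValid_gLast hF, upperSemicontinuousOnValid_gLast hF⟩
  | succ k ih =>
    refine ⟨?_, upperSemicontinuousOnValid_sSup hF ih.1 ih.2⟩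
    obtain ⟨C, hC⟩ := exists_abs_oneStep_le hF ih.1
    refine ⟨C, fun q rA rB hv => ?_⟩
    obtain ⟨a, ha, hsup, -⟩ := exists_isMaxOn_oneStep hF ih.1 ih.2 hv
    rw [gRem, ← hsup]
    exact hC q rA rB hv a ha

/-- The maximum in the backward recursion is attained. -/
theorem exists_oneStep_eq_gRem (hF : F.IsMarket m P) (k : ℕ) {q : ℤ} {rA rB : EInt}
    (hv : m.Valid q rA rB) :
    ∃ a ∈ m.A q rA rB, oneStep m F P (gRem m F P k) q rA rB a = gRem m F P (k + 1) q rA rB ∧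
      ∀ a' ∈ m.A q rA rB,
        oneStep m F P (gRem m F P k) q rA rB a' ≤ gRem m F P (k + 1) q rA rB := by
  obtain ⟨a, ha, hsup, hmax⟩ :=
    exists_isMaxOn_oneStep hF (gRem_regular hF k).1 (gRem_regular hF k).2 hv
  exact ⟨a, ha, hsup, fun a' ha' => (hmax a' ha').trans_eq hsup⟩

end Semicontinuity

/-! ### Growth of wealth and price along a run -/

section Growth

variable {Ω : Type*} {F : OrderFlow Ω} {m : Params}

theorem abs_priceOut_mul_le {σ : Side} {p B : ℤ} {r : EInt} (hr : 0 ≤ r) (hB : 0 ≤ B) {A : Prop}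
    (h : A → r ≤ (B : EInt)) : |priceOut σ p r * ind A| ≤ (|p| : ℤ) + 1 + (B : ℚ) := by
  have hB' : (0 : ℚ) ≤ B := by exact_mod_cast hB
  have hp : |(p : ℚ)| = ((|p| : ℤ) : ℚ) := by push_cast; rfl
  have hp0 := abs_nonneg (p : ℚ)
  by_cases hA : A
  · have hrB := h hA
    rw [ind_of_true hA, Int.cast_one, mul_one, priceOut]
    rcases eInt_nonneg_cases hr with ⟨n, hn, rfl⟩ | rfl
    · have hnB : (n : ℚ) ≤ B := by exact_mod_cast WithBotTop.coe_le_coe.1 hrB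
      have hn' : (0 : ℚ) ≤ n := by exact_mod_cast hn
      rw [finitePart_coe, ← hp]
      refine (abs_add_le _ _).trans ?_
      have : |(σ.sgn : ℚ) * (1 / 2 + n)| = 1 / 2 + n := by
        rw [abs_mul, abs_of_nonneg (by linarith : (0 : ℚ) ≤ 1 / 2 + n)]
        cases σ <;> simp [Side.sgn]
      rw [this]
      linarith
    · exact absurd hrB (not_le.2 (coe_lt_top B))
  · rw [ind_of_false hA, Int.cast_zero, mul_zero, abs_zero, ← hp]
    linarith

theorem abs_priceLate_mul_le (hF : F.Regular) (σ : Side) (i : ℕ) {c : ℝ≥0} (hc : m.t (i + 1) ≤ c)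
    (p : ℤ) {r : EInt} (hr : 0 ≤ r) (a : Decision) (ω : Ω) :
    |priceLate m F σ i p r a ω * ind (fillLate m F σ i r a ω)| ≤
      (|p| : ℤ) + 1 + (F.span c ω : ℚ) := by
  have hp : |(p : ℚ)| = ((|p| : ℤ) : ℚ) := by push_cast; rfl
  have hB := span_nonneg (F := F) c ω
  have h1 : m.tPlus i ≤ c := (m.tPlus_lt i).le.trans hc
  have h0 : m.t i ≤ c := (m.t_le_tPlus i).trans h1
  cases a with
  | keep => exact abs_priceOut_mul_le hr hB fun h => le_span_of_filled hF h0 h1 hc h.2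
  | replace δ =>
    have hB' : (0 : ℚ) ≤ F.span c ω := by exact_mod_cast hB
    have hp0 := abs_nonneg (p : ℚ)
    by_cases hA : fillLate m F σ i r (.replace δ) ω
    · have hδ := le_span_of_filled hF h0 h1 hc hA
      rw [ind_of_true hA, Int.cast_one, mul_one, priceLate, ← hp]
      have hd : |((σ.sgn * F.dp (m.t i) (m.tPlus i) ω : ℤ) : ℚ)| ≤ F.span c ω := by
        have := abs_dp_le hF h0 h1 ω
        rw [← Side.abs_sgn_mul σ] at this
        exact_mod_cast this
      push_cast at hd
      rw [abs_le] at hd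
      have hmax : |maxShift δ (1 / 2) (-1 / 2 + σ.sgn * F.dp (m.t i) (m.tPlus i) ω)| ≤
          1 / 2 + (F.span c ω : ℚ) := by
        rcases eInt_cases δ with rfl | ⟨n, rfl⟩ | rfl
        · rw [maxShift_bot, abs_le]
          constructor <;> linarith
        · have hn : (n : ℚ) ≤ F.span c ω := by exact_mod_cast WithBotTop.coe_le_coe.1 hδ
          rw [maxShift_coe, abs_le]
          exact ⟨le_max_of_le_right (by linarith), max_le (by linarith) (by linarith)⟩
        · exact absurd hδ (not_le.2 (coe_lt_top _))
      refine (abs_add_le _ _).trans ?_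
      have : |(σ.sgn : ℚ) * maxShift δ (1 / 2) (-1 / 2 + σ.sgn * F.dp (m.t i) (m.tPlus i) ω)| =
          |maxShift δ (1 / 2) (-1 / 2 + σ.sgn * F.dp (m.t i) (m.tPlus i) ω)| := by
        rw [abs_mul]
        cases σ <;> simp [Side.sgn]
      rw [this]
      linarith
    · rw [ind_of_false hA, Int.cast_zero, mul_zero, abs_zero, ← hp]
      linarith

/-- The size of a state, as far as it is not bounded by the constraints. -/
def State.size (s : State) : ℚ := |s.w| + |(s.p : ℚ)| + 1

/-- Each of the four possible executions moves at most |p| + 1 plus the variation. Together with the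
price move and the variation added on the left, no coefficient exceeds 6. -/
theorem size_nextState_le (hF : F.Regular) (i : ℕ) {c : ℝ≥0} (hc : m.t (i + 1) ≤ c) {s : State}
    (hs : s ∈ m.S) (a : Decision × Decision) (ω : Ω) :
    (nextState m F i s a ω).size + F.span c ω ≤ 6 * (s.size + F.span c ω) := by
  have h1 : m.tPlus i ≤ c := (m.tPlus_lt i).le.trans hc
  have h0 : m.t i ≤ c := (m.t_le_tPlus i).trans h1
  have hB := span_nonneg (F := F) c ω
  have hB' : (0 : ℚ) ≤ F.span c ω := by exact_mod_cast hB
  have e1 := abs_priceOut_mul_le (σ := .ask) (p := s.p) hs.2.2.1 hB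
    (A := fillOut m F .ask i s.rAsk ω) fun h => le_span_of_filled hF h0 h0 h1 h
  have e2 := abs_priceOut_mul_le (σ := .bid) (p := s.p) hs.2.2.2.1 hB
    (A := fillOut m F .bid i s.rBid ω) fun h => le_span_of_filled hF h0 h0 h1 h
  have e3 := abs_priceLate_mul_le hF .ask i hc s.p hs.2.2.1 a.1 ω
  have e4 := abs_priceLate_mul_le hF .bid i hc s.p hs.2.2.2.1 a.2 ω
  have e5 : |(F.dp (m.t i) (m.t (i + 1)) ω : ℚ)| ≤ F.span c ω := by
    exact_mod_cast abs_dp_le hF h0 hc ω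
  have hw : |(nextState m F i s a ω).w| ≤ |s.w| + 4 * (|(s.p : ℚ)| + 1 + F.span c ω) := by
    push_cast at e1 e2 e3 e4
    simp only [nextState]
    rw [abs_le] at e1 e2 e3 e4 ⊢
    have := neg_abs_le s.w
    have := le_abs_self s.w
    constructor <;> linarith
  have hp : |((nextState m F i s a ω).p : ℚ)| ≤ |(s.p : ℚ)| + F.span c ω := by
    simp only [nextState, Int.cast_add]
    exact (abs_add_le _ _).trans (by linarith)
  have := abs_nonneg s.w
  have := abs_nonneg (s.p : ℚ)
  simp only [State.size]
  linarith

theorem size_run_le (hF : F.Regular) {π : Policy} (hπ : π.Admissible m) {i : ℕ} {s : State}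
    (hs : s ∈ m.S) {c : ℝ≥0} (ω : Ω) :
    ∀ k, i + k ≤ m.N → m.t (i + k) ≤ c →
      (run m F π i s ω k).size + F.span c ω ≤ 6 ^ k * (s.size + F.span c ω)
  | 0, _, _ => by rw [pow_zero, one_mul]; rfl
  | k + 1, h, hc => by
    have ih := size_run_le hF hπ (i := i) hs ω k (by omega) ((m.t_mono (by omega)).trans hc)
    have h1 := size_nextState_le hF (i + k) hc (run_mem F hπ (i := i) hs ω k (by omega))
      (π (i + k) (run m F π i s ω k)) ω
    rw [pow_succ]
    simp only [run]
    linarith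

theorem abs_inventory_le {q : ℤ} {rA rB : EInt} (hv : m.Valid q rA rB) :
    |q| ≤ |m.qLow| + |m.qHigh| := by
  have := hv.1
  have := hv.2.1
  grind

/-- Writing Q for the sum of the absolute inventory bounds, the final inventory is at most Q + 1 in
absolute value. Thus wealth, marked inventory and unwinding cost have coefficients at most Q + 3,
below the constant Q + 4. -/
theorem abs_finalState_le (hF : F.Regular) {c : ℝ≥0} (hc : m.tPlus m.N ≤ c) {s : State}
    (hs : s ∈ m.S) (ω : Ω) :
    |vFinal (finalState m F s ω)| ≤
      (((((|m.qLow| + |m.qHigh| : ℤ) : ℚ) + 4) * (s.size + F.span c ω) : ℚ) : ℝ) := by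
  have h0 : m.t m.N ≤ c := (m.t_le_tPlus m.N).trans hc
  have hB := span_nonneg (F := F) c ω
  have hB' : (0 : ℚ) ≤ F.span c ω := by exact_mod_cast hB
  have e1 := abs_priceOut_mul_le (σ := .ask) (p := s.p) hs.2.2.1 hB
    (A := fillOut m F .ask m.N s.rAsk ω) fun h => le_span_of_filled hF h0 h0 hc h
  have e2 := abs_priceOut_mul_le (σ := .bid) (p := s.p) hs.2.2.2.1 hB
    (A := fillOut m F .bid m.N s.rBid ω) fun h => le_span_of_filled hF h0 h0 hc h
  have e5 : |(F.dp (m.t m.N) (m.tPlus m.N) ω : ℚ)| ≤ F.span c ω := by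
    exact_mod_cast abs_dp_le hF h0 hc ω
  have hw : |(finalState m F s ω).w| ≤ |s.w| + 2 * (|(s.p : ℚ)| + 1 + F.span c ω) := by
    push_cast at e1 e2
    simp only [finalState]
    rw [abs_le] at e1 e2 ⊢
    have := neg_abs_le s.w
    have := le_abs_self s.w
    constructor <;> linarith
  have hp : |((finalState m F s ω).p : ℚ)| ≤ |(s.p : ℚ)| + F.span c ω := by
    simp only [finalState, Int.cast_add]
    exact (abs_add_le _ _).trans (by linarith)
  set Q : ℚ := ((|m.qLow| + |m.qHigh| : ℤ) : ℚ) with hQ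
  have hQ0 : 0 ≤ Q := by rw [hQ]; exact_mod_cast add_nonneg (abs_nonneg _) (abs_nonneg _)
  have hq : |((finalState m F s ω).q : ℚ)| ≤ Q + 1 := by
    have : |(finalState m F s ω).q| ≤ |m.qLow| + |m.qHigh| + 1 := by
      have := abs_inventory_le hs
      have := ind_nonneg (fillOut m F .ask m.N s.rAsk ω)
      have := ind_nonneg (fillOut m F .bid m.N s.rBid ω)
      have := ind_le_one (fillOut m F .ask m.N s.rAsk ω)
      have := ind_le_one (fillOut m F .bid m.N s.rBid ω)
      simp only [finalState]
      grind
    rw [hQ]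
    exact_mod_cast this
  have hw0 := abs_nonneg s.w
  have hp0 := abs_nonneg (s.p : ℚ)
  have key : |(finalState m F s ω).w + (finalState m F s ω).p * (finalState m F s ω).q
      - (1 / 2 * |((finalState m F s ω).q : ℚ)|)| ≤ (Q + 4) * (s.size + F.span c ω) := by
    have hpq : |((finalState m F s ω).p : ℚ) * (finalState m F s ω).q| ≤
        (|(s.p : ℚ)| + F.span c ω) * (Q + 1) := by
      rw [abs_mul]
      exact mul_le_mul hp hq (abs_nonneg _) (by linarith)
    have h3 : |(1 / 2 * |((finalState m F s ω).q : ℚ)|)| ≤ Q + 1 := by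
      rw [abs_mul, abs_abs, abs_of_pos (by norm_num : (0 : ℚ) < 1 / 2)]
      have := abs_nonneg ((finalState m F s ω).q : ℚ)
      linarith
    refine (abs_sub _ _).trans ((add_le_add ((abs_add_le _ _).trans (add_le_add hw hpq)) h3).trans ?_)
    have := mul_nonneg hQ0 hw0
    rw [State.size]
    nlinarith
  have key' := (Rat.cast_le (K := ℝ)).2 key
  rw [vFinal]
  push_cast at key' ⊢
  exact key'

end Growth

/-! ### Dynamic programming -/

section DynamicProgramming

variable {Ω : Type*} [mΩ : MeasurableSpace Ω] {F : OrderFlow Ω} {m : Params} {P : Measure Ω}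
  [IsProbabilityMeasure P]

/-- The value of a state whose extra value, beyond wealth and marked inventory, is `h`. -/
def markedValue (h : ℤ → EInt → EInt → ℝ) (s : State) : ℝ :=
  (s.w : ℝ) + s.p * s.q + h s.q s.rAsk s.rBid

theorem integrable_size_bound (hF : F.IsMarket m P) (K : ℝ) (x : ℚ) (c : ℝ≥0) :
    Integrable (fun ω => K * ((x : ℝ) + F.span c ω)) P :=
  (((integrable_const (x : ℝ)).add (integrable_span hF c))).const_mul K

/-- The state at epoch `N` is bounded by a power of 6 times a constant plus the variation, whatever
the policy, and the variation is integrable. -/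
theorem integrable_terminalWealth (hF : F.IsMarket m P) {π : Policy} (hπ : π.Admissible m)
    {i : ℕ} (hi : i ≤ m.N) {s : State} (hs : s ∈ m.S) :
    Integrable (terminalWealth m F π i s) P := by
  have hmeas : Measurable (terminalWealth m F π i s) := by
    have h1 : Measurable fun z : State × Ω => vFinal (finalState m F z.1 z.2) :=
      measurable_from_prod_countable_right fun s => by
        simp only [vFinal_finalState hF.regular]
        exact measurable_finalValue (hF.regular.shift _) (hF.meas.shift _) s
    have h2 := h1.comp ((measurable_run hF.regular hF.meas (m := m) π i s (m.N - i)).prodMk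
      measurable_id)
    exact h2
  set Q : ℚ := ((|m.qLow| + |m.qHigh| : ℤ) : ℚ) + 4 with hQ
  have hQ0 : 0 ≤ Q := by
    rw [hQ]; exact_mod_cast add_nonneg (add_nonneg (abs_nonneg _) (abs_nonneg _)) (by norm_num)
  refine (integrable_size_bound hF ((Q * 6 ^ (m.N - i) : ℚ) : ℝ) s.size (m.tPlus m.N)).mono'
    hmeas.aestronglyMeasurable (ae_of_all _ fun ω => ?_)
  have hN : i + (m.N - i) = m.N := by omega
  have h1 := abs_finalState_le hF.regular le_rfl (run_mem F hπ (i := i) hs ω (m.N - i) hN.le) ω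
  have h2 := size_run_le hF.regular hπ hs (c := m.tPlus m.N) ω (m.N - i) hN.le
    (by rw [hN]; exact m.t_le_tPlus _)
  have h3 := mul_le_mul_of_nonneg_left h2 hQ0
  rw [← mul_assoc] at h3
  have h4 := (Rat.cast_le (K := ℝ)).2 h3
  refine (h1.trans h4).trans_eq ?_
  push_cast
  ring

theorem integrable_markedValue (hF : F.IsMarket m P) {h : ℤ → EInt → EInt → ℝ}
    (hb : BoundedOnValid m h) {π : Policy} (hπ : π.Admissible m) {i k : ℕ} (hk : i + k ≤ m.N)
    {s : State} (hs : s ∈ m.S) :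
    Integrable (fun ω => markedValue h (run m F π i s ω k)) P := by
  obtain ⟨C, hC⟩ := hb
  set Q : ℚ := ((|m.qLow| + |m.qHigh| : ℤ) : ℚ) + 1 with hQ
  have hQ1 : 1 ≤ Q := by
    rw [hQ]
    have : (0 : ℚ) ≤ ((|m.qLow| + |m.qHigh| : ℤ) : ℚ) := by
      exact_mod_cast add_nonneg (abs_nonneg m.qLow) (abs_nonneg m.qHigh)
    linarith
  refine ((integrable_size_bound hF ((Q * 6 ^ k : ℚ) : ℝ) s.size (m.t (i + k))).add
    (integrable_const C)).mono' ((Measurable.of_discrete (f := markedValue h)).comp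
      (measurable_run hF.regular hF.meas π i s k)).aestronglyMeasurable (ae_of_all _ fun ω => ?_)
  have hm := run_mem F hπ (i := i) hs ω k hk
  have h2 := size_run_le hF.regular hπ hs ω k hk le_rfl
  set s' := run m F π i s ω k
  have hB' : (0 : ℚ) ≤ F.span (m.t (i + k)) ω := by exact_mod_cast span_nonneg _ ω
  have h1 : |s'.w + s'.p * s'.q| ≤ Q * 6 ^ k * (s.size + F.span (m.t (i + k)) ω) := by
    have hq : |(s'.q : ℚ)| ≤ Q := by
      have : |(s'.q : ℚ)| ≤ ((|m.qLow| + |m.qHigh| : ℤ) : ℚ) := by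
        exact_mod_cast abs_inventory_le hm
      linarith
    have hpq : |(s'.p : ℚ) * s'.q| ≤ |(s'.p : ℚ)| * Q := by
      rw [abs_mul]
      exact mul_le_mul_of_nonneg_left hq (abs_nonneg _)
    have hle : |s'.w| + |(s'.p : ℚ)| * Q ≤ Q * (s'.size + F.span (m.t (i + k)) ω) := by
      have := mul_le_mul_of_nonneg_right hQ1 (abs_nonneg s'.w)
      rw [State.size]
      nlinarith
    calc |s'.w + s'.p * s'.q| ≤ |s'.w| + |(s'.p : ℚ)| * Q :=
          (abs_add_le _ _).trans (add_le_add le_rfl hpq)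
      _ ≤ Q * (s'.size + F.span (m.t (i + k)) ω) := hle
      _ ≤ Q * (6 ^ k * (s.size + F.span (m.t (i + k)) ω)) :=
          mul_le_mul_of_nonneg_left h2 (by linarith)
      _ = _ := by ring
  have h1' := (Rat.cast_le (K := ℝ)).2 h1
  push_cast at h1'
  rw [Real.norm_eq_abs, markedValue]
  refine (abs_add_le _ _).trans (add_le_add ?_ (hC _ _ _ hm))
  push_cast
  exact h1'

theorem run_path {Ω : Type*} {F : OrderFlow Ω} (hF : F.Regular)
    (π : Policy) (i : ℕ) (s : State) (ω : Ω) (k : ℕ) :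
    run m pathFlow π i s (hF.path ω) k = run m F π i s ω k := by
  induction k with
  | zero => rfl
  | succ k ih =>
    simp only [run, ih]
    rfl

/-- The state at epoch `i + k` is a functional of the flow stopped there, which is independent of
the flow after it. -/
theorem indepFun_run (hF : F.IsMarket m P) (π : Policy) (i k : ℕ) (s : State) :
    IndepFun (fun ω => run m F π i s ω k) (hF.regular.shift (m.t (i + k))).path P := by
  have h := (indepFun_path hF (m.t (i + k))).comp
    (measurable_run pathFlow_regular pathFlow_meas (m := m) π i s k) measurable_id
  refine h.congr (ae_of_all _ fun ω => ?_) (ae_of_all _ fun ω => rfl)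
  exact (run_path (hF.regular.stopAt _) π i s ω k).trans (run_stopAt hF.regular π i s ω k le_rfl)

/-- Expectations after one more period. -/
theorem integral_run_succ (hF : F.IsMarket m P) {h : ℤ → EInt → EInt → ℝ}
    (hb : BoundedOnValid m h) {π : Policy} (hπ : π.Admissible m) {i k : ℕ} (hk : i + k < m.N)
    {s : State} (hs : s ∈ m.S) :
    Integrable (fun ω => markedValue (fun q rA rB => oneStep m F P h q rA rB
        (π (i + k) (run m F π i s ω k))) (run m F π i s ω k)) P ∧
      ∫ ω, markedValue h (run m F π i s ω (k + 1)) ∂P =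
        ∫ ω, markedValue (fun q rA rB => oneStep m F P h q rA rB
          (π (i + k) (run m F π i s ω k))) (run m F π i s ω k) ∂P := by
  have hrun : ∀ s' ω, nextState m F (i + k) s' (π (i + k) s') ω =
      nextState m pathFlow 0 s' (π (i + k) s') ((hF.regular.shift (m.t (i + k))).path ω) :=
    fun s' ω => (nextState_shift hF.regular (i + k) s' _ ω).symm
  have hint : Integrable (fun ω => markedValue h (nextState m pathFlow 0 (run m F π i s ω k)
      (π (i + k) (run m F π i s ω k)) ((hF.regular.shift (m.t (i + k))).path ω))) P := by
    simp only [← hrun]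
    exact integrable_markedValue hF hb hπ (k := k + 1) hk hs
  obtain ⟨h1, h2⟩ := integral_freeze (indepFun_run hF π i k s)
    (measurable_run hF.regular hF.meas π i s k)
    ((hF.meas.shift _).measurable_path (hF.regular.shift _))
    (f := fun s' z => markedValue h (nextState m pathFlow 0 s' (π (i + k) s') z))
    (fun s' => (Measurable.of_discrete (f := markedValue h)).comp
      (measurable_nextState pathFlow_regular pathFlow_meas 0 s' _)) hint
  -- Once the state is frozen, so is the action, and the inner integral is a one-step expectation.
  have hcond : ∀ ω, ∫ ω', markedValue h (nextState m pathFlow 0 (run m F π i s ω k)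
      (π (i + k) (run m F π i s ω k)) ((hF.regular.shift (m.t (i + k))).path ω')) ∂P =
      markedValue (fun q rA rB => oneStep m F P h q rA rB
        (π (i + k) (run m F π i s ω k))) (run m F π i s ω k) := fun ω => by
    have hm := run_mem F hπ (i := i) hs ω k hk.le
    simp only [← hrun]
    exact (integral_nextState hF (i + k) hm _
      (integrable_next hF hb hm (hπ _ hk.le _ hm)) fun _ => rfl).2
  simp only [hcond] at h1 h2
  refine ⟨h1, ?_⟩
  rw [← h2]
  simp only [← hrun]
  rfl

/-- The state at epoch `N` is frozen and the expectation is taken over the remaining latency window.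
-/
theorem integral_terminalWealth (hF : F.IsMarket m P) {π : Policy} (hπ : π.Admissible m) {i : ℕ}
    (hi : i ≤ m.N) {s : State} (hs : s ∈ m.S) :
    ∫ ω, terminalWealth m F π i s ω ∂P =
      ∫ ω, markedValue (gLast m F P) (run m F π i s ω (m.N - i)) ∂P := by
  have hN : i + (m.N - i) = m.N := by omega
  have hfin : ∀ s' ω, vFinal (finalState m F s' ω) =
      finalValue m pathFlow s' ((hF.regular.shift (m.t (i + (m.N - i)))).path ω) := fun s' ω => by
    simp only [hN]
    exact vFinal_finalState hF.regular s' ω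
  have hint := integrable_terminalWealth hF hπ hi hs
  unfold terminalWealth at hint ⊢
  simp only [hfin] at hint ⊢
  obtain ⟨-, h2⟩ := integral_freeze (indepFun_run hF π i (m.N - i) s)
    (measurable_run hF.regular hF.meas π i s _)
    ((hF.meas.shift _).measurable_path (hF.regular.shift _))
    (f := fun s' z => finalValue m pathFlow s' z)
    (fun s' => measurable_finalValue pathFlow_regular pathFlow_meas s') hint
  rw [h2]
  simp only [← hfin]
  exact integral_congr_ae (ae_of_all _ fun ω =>
    integral_finalState hF (run_mem F hπ (i := i) hs ω (m.N - i) hN.le))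

/-- Supermartingale property of the marked value: no admissible action beats the maximum in the
recursion. -/
theorem integral_run_le (hF : F.IsMarket m P) {π : Policy} (hπ : π.Admissible m) {i : ℕ}
    {s : State} (hs : s ∈ m.S) :
    ∀ k, i + k ≤ m.N → ∫ ω, markedValue (gRem m F P (m.N - (i + k))) (run m F π i s ω k) ∂P ≤
      markedValue (gRem m F P (m.N - i)) s
  | 0, _ => by simp [run]
  | k + 1, hk => by
    refine le_trans ?_ (integral_run_le hF hπ (i := i) hs k (by omega))
    have hsucc : m.N - (i + k) = m.N - (i + (k + 1)) + 1 := by omega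
    obtain ⟨h1, h2⟩ := integral_run_succ hF (gRem_regular hF (m.N - (i + (k + 1)))).1 hπ
      (i := i) (k := k) (by omega) hs
    rw [h2]
    refine integral_mono h1
      (integrable_markedValue hF (gRem_regular hF _).1 hπ (by omega : i + k ≤ m.N) hs) fun ω => ?_
    have hm := run_mem F hπ (i := i) hs ω k (by omega)
    obtain ⟨_, _, _, hmax⟩ := exists_oneStep_eq_gRem hF (m.N - (i + (k + 1))) hm
    simp only [markedValue]
    rw [hsucc]
    exact add_le_add_right (hmax _ (hπ _ (by omega) _ hm)) _

/-- Under a maximizing policy the supermartingale inequality is an equality at every step. -/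
theorem integral_run_eq (hF : F.IsMarket m P) {π : Policy} (hπ : π.Admissible m)
    (hopt : ∀ j < m.N, ∀ s ∈ m.S, oneStep m F P (gRem m F P (m.N - (j + 1))) s.q s.rAsk s.rBid
      (π j s) = gRem m F P (m.N - j) s.q s.rAsk s.rBid) {i : ℕ} {s : State} (hs : s ∈ m.S) :
    ∀ k, i + k ≤ m.N → ∫ ω, markedValue (gRem m F P (m.N - (i + k))) (run m F π i s ω k) ∂P =
      markedValue (gRem m F P (m.N - i)) s
  | 0, _ => by simp [run]
  | k + 1, hk => by
    rw [← integral_run_eq hF hπ hopt (i := i) hs k (by omega),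
      (integral_run_succ hF (gRem_regular hF (m.N - (i + (k + 1)))).1 hπ (k := k) (by omega) hs).2]
    refine integral_congr_ae (ae_of_all _ fun ω => ?_)
    have := hopt (i + k) (by omega) _ (run_mem F hπ (i := i) hs ω k (by omega))
    simp only [markedValue]
    rw [← this]
    rfl

/-- Attained maximizers are chosen separately for each epoch and state; no measurable selection is
involved. -/
theorem exists_optimal_policy (hF : F.IsMarket m P) :
    ∃ π : Policy, π.Admissible m ∧ ∀ j < m.N, ∀ s ∈ m.S,
      oneStep m F P (gRem m F P (m.N - (j + 1))) s.q s.rAsk s.rBid (π j s) =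
        gRem m F P (m.N - j) s.q s.rAsk s.rBid := by
  have h : ∀ j s, ∃ a, (s ∈ m.S → a ∈ m.A s.q s.rAsk s.rBid) ∧ (j < m.N → s ∈ m.S →
      oneStep m F P (gRem m F P (m.N - (j + 1))) s.q s.rAsk s.rBid a =
        gRem m F P (m.N - j) s.q s.rAsk s.rBid) := by
    intro j s
    by_cases hs : s ∈ m.S
    · by_cases hj : j < m.N
      · obtain ⟨a, ha, heq, -⟩ := exists_oneStep_eq_gRem hF (m.N - (j + 1)) hs
        refine ⟨a, fun _ => ha, fun _ _ => ?_⟩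
        rw [heq, show m.N - (j + 1) + 1 = m.N - j by omega]
      · obtain ⟨a, ha⟩ := m.A_nonempty s.q s.rAsk s.rBid
        exact ⟨a, fun _ => ha, fun h => absurd h hj⟩
    · exact ⟨(.keep, .keep), fun h => absurd h hs, fun _ h => absurd h hs⟩
  choose π h1 h2 using h
  exact ⟨π, fun j _ s hs => h1 j s hs, fun j hj s hs => h2 j s hj hs⟩

/-- The value set has the greatest element `w + pq + g_i(q, r⁺, r⁻)`. -/
theorem isGreatest_valueSet (hF : F.IsMarket m P) {i : ℕ} (hi : i ≤ m.N) {s : State}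
    (hs : s ∈ m.S) :
    IsGreatest (valueSet m F P i s) ((s.w : ℝ) + s.p * s.q + g m F P i s.q s.rAsk s.rBid) := by
  have hN : i + (m.N - i) = m.N := by omega
  have hzero : gLast m F P = gRem m F P (m.N - (i + (m.N - i))) := by
    rw [hN, Nat.sub_self]
    rfl
  constructor
  · obtain ⟨π, hπ, hopt⟩ := exists_optimal_policy hF
    refine ⟨π, hπ, ?_⟩
    rw [integral_terminalWealth hF hπ hi hs, hzero, integral_run_eq hF hπ hopt hs _ hN.le]
    rfl
  · rintro _ ⟨π, hπ, rfl⟩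
    rw [integral_terminalWealth hF hπ hi hs, hzero]
    exact integral_run_le hF hπ hs _ hN.le

end DynamicProgramming

end MarketMaking

end

-- The theorem

open MarketMaking in
theorem theorem2 {Ω : Type*} [MeasurableSpace Ω] (P : Measure Ω) [IsProbabilityMeasure P]
    (m : Params) (F : OrderFlow Ω) (hF : F.IsMarket m P) :
    -- all expectations that occur exist
    (∀ σ t₁ t₂ x, Integrable (orderProfit F σ t₁ t₂ x) P) ∧
    (∀ π : Policy, π.Admissible m → ∀ i ≤ m.N, ∀ s ∈ m.S,
      Integrable (terminalWealth m F π i s) P) ∧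
    (∀ i < m.N, ∀ q rA rB, m.Valid q rA rB → ∀ a ∈ m.A q rA rB,
      Integrable (fun ω => g m F P (i + 1) (nextQ m F 0 q rA rB a ω)
        (nextR m F .ask 0 rA a.1 ω) (nextR m F .bid 0 rB a.2 ω)) P) ∧
    -- the decomposition of the value functions, whose suprema are finite
    (∀ s ∈ m.S, vFinal s = (s.w : ℝ) + s.p * s.q - 1 / 2 * |(s.q : ℝ)|) ∧
    (∀ i ≤ m.N, ∀ s ∈ m.S, IsLUB (valueSet m F P i s) (v m F P i s) ∧
      v m F P i s = (s.w : ℝ) + s.p * s.q + g m F P i s.q s.rAsk s.rBid) ∧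
    -- the explicit terminal function
    (∀ q rA rB, m.Valid q rA rB →
      g m F P m.N q rA rB = H F P .ask 0 m.dtau rA + H F P .bid 0 m.dtau rB
        - 1 / 2 * ∫ ω, |((q - ind (fillOut m F .ask 0 rA ω)
            + ind (fillOut m F .bid 0 rB ω) : ℤ) : ℝ)| ∂P) ∧
    -- the backward recursion, in which the maximum is attained
    (∀ i < m.N, ∀ q rA rB, m.Valid q rA rB →
      (∀ a ∈ m.A q rA rB, G m F P i q rA rB a =
        (∫ ω, g m F P (i + 1) (nextQ m F 0 q rA rB a ω)
          (nextR m F .ask 0 rA a.1 ω) (nextR m F .bid 0 rB a.2 ω) ∂P)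
          + Hact m F P .ask rA a.1 + Hact m F P .bid rB a.2) ∧
      IsGreatest (G m F P i q rA rB '' m.A q rA rB) (g m F P i q rA rB)) := by
  refine ⟨integrable_orderProfit hF,
    fun π hπ i hi s hs => integrable_terminalWealth hF hπ hi hs,
    fun i _ q rA rB hv a ha => integrable_next hF (gRem_regular hF _).1 hv ha,
    fun _ _ => rfl, fun i hi s hs => ?_, fun q rA rB _ => ?_, fun i hi q rA rB hv =>
    ⟨fun _ _ => rfl, ?_⟩⟩
  · have h := isGreatest_valueSet hF hi hs
    have hv : v m F P i s = _ := h.csSup_eq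
    rw [hv]
    exact ⟨h.isLUB, rfl⟩
  · rw [g, Nat.sub_self]
    rfl
  · have hsucc : m.N - i = m.N - (i + 1) + 1 := by omega
    obtain ⟨a, ha, heq, hmax⟩ := exists_oneStep_eq_gRem hF (m.N - (i + 1)) hv
    rw [g, hsucc]
    refine ⟨⟨a, ha, heq⟩, ?_⟩
    rintro _ ⟨a', ha', rfl⟩
    exact hmax a' ha'
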